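/- Let $0\le\delta<c$ be constant integers. Let $k=2^{\ell}$ with $\ell=\log k\ge 1$ (logarithms to base $2$), $K=\lceil k/\log k\rceil$, and let $GF(k)=GF(2)[X]/(f)$ with $f$ irreducible of degree $\ell$, an element being identified with its $\ell$ coefficients (most significant bit first). *Guess & Check code.* A message $\mathbf u\in\{0,1\}^k$ is cut into $K$ adjacent blocks of $\log k$ bits (the last one possibly shorter and then padded with zeros), read as $\mathbf U\in GF(k)^K$. A systematic $(K+c,K)$ MDS code over $GF(k)$ with generator matrix $[I\,|\,G]$ gives $c$ parity symbols $\mathbf U G$. The codeword $\mathbf x$ consists of $\mathbf u$ followed by the $c\log k$ parity bits, each repeated $\delta+1$ times; its length is denoted by $n$. *Decoder.* Given $\mathbf y$, obtained from $\mathbf x$ by at most $\delta$ deletions: (1) read $\mathbf y$ from right to left and recover the $c\log k$ parity bits one after another, each together with the up to $\delta$ equal bits that follow it; what is left is the received systematic part $\mathbf s$, with $d=k-|\mathbf s|$ bits missing. (2) Go through all cases, i.e. all ways to distribute $d$ deletions among the $K$ blocks. (3) In each case chunk $\mathbf s$ accordingly, regard the $z$ affected blocks as erased, and decode the erasures from the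 first $z$ parities. The case is possible if the decoded string in $GF(k)^K$ satisfies the remaining $c-z$ parities and the binary representation of every decoded erasure is a supersequence of its sub-block. (4) If possible cases exist and all lead to the same string, output it (as a message of $k$ bits); otherwise declare a decoding failure. **Theorem.** For all $\ell$, all such $f$ and all such MDS codes the following hold, with constants in the $\mathcal O$'s that depend only on $\delta$ and $c$. 0. If at most $\delta$ bits of $\mathbf x$ are deleted, at arbitrary positions, the decoder either declares a failure or outputs $\mathbf u$. 1. Redundancy: $n-k=c(\delta+1)\log k$ bits. 2. Encoding takes $\mathcal O(k\log k)$ steps, and decoding any word obtained from a codeword by at most $\delta$ deletions takes $\mathcal O\!\left(k^{\delta+1}/\log^{\delta-1}k\right)$ steps. Precisely: there are an encoding and a decoding program, depending only on $\delta$ and $c$, in a structured imperative language over cons cells in which every operation on a single cell costs one step; they receive the coefficients of $f$ and the entries of $G$ as bit strings together with the word to be encoded or decoded, and halt with the output of the encoder or decoder within these numbers of steps. 3. If the set of deleted positions, of size at most $\delta$, is fixed or random, but independent of the codeword, and the message is uniform on $\{0,1\}^k$, then the probability of a decoding failure is $\mathcal O\!\left(k^{2\delta-c}/\log^{\delta}k\right)$.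 -/

import Mathlib

open Finset Polynomial

/-! ### A machine model with a step count

Structured programs over cons cells.  Values are binary trees (`nil` or a cell with two pointers);
every elementary operation inspects or creates a single cell and costs one step. -/

/-- Values: cons trees. -/
inductive Val : Type
  | nil : Val
  | cons : Val → Val → Val

namespace Val

/-- First component of a cell (`nil` on `nil`). -/
def hd : Val → Val
  | nil => nil
  | cons a _ => a

/-- Second component of a cell (`nil` on `nil`). -/
def tl : Val → Val
  | nil => nil
  | cons _ b => b

/-- A bit as a value. -/
def ofBool : Bool → Val
  | false => nil
  | true => cons nil nil

/-- A list of values as a (nil-terminated) chain of cells. -/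
def ofList : List Val → Val
  | [] => nil
  | a :: l => cons a (ofList l)

/-- A bit string as a value. -/
def ofBits (l : List Bool) : Val := ofList (l.map ofBool)

/-- An optional bit string as a value (`none` is the error message). -/
def ofOptionBits : Option (List Bool) → Val
  | none => nil
  | some l => cons nil (ofBits l)

end Val

/-- Expressions over the variables `0, 1, 2, …`. -/
inductive Expr : Type
  | nil : Expr
  | var : ℕ → Expr
  | cons : Expr → Expr → Expr
  | hd : Expr → Expr
  | tl : Expr → Expr

namespace Expr

/-- The value of an expression in a store. -/
def eval (s : ℕ → Val) : Expr → Val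
  | nil => Val.nil
  | var x => s x
  | cons a b => Val.cons (eval s a) (eval s b)
  | hd a => (eval s a).hd
  | tl a => (eval s a).tl

/-- The number of operations in an expression: the cost of evaluating it. -/
def size : Expr → ℕ
  | nil => 1
  | var _ => 1
  | cons a b => size a + size b + 1
  | hd a => size a + 1
  | tl a => size a + 1

end Expr

/-- Programs: assignment, sequencing, branching, loops and (non-recursive) procedure calls.
`call x p e` runs the procedure `p` on the argument `e` with its own local variables
and stores the result in `x`. -/
inductive Prog : Type
  | assign : ℕ → Expr → Prog
  | seq : Prog → Prog → Prog
  | ite : Expr → Prog → Prog → Prog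
  | loop : Expr → Prog → Prog
  | call : ℕ → Prog → Expr → Prog

/-- The store at the start of a run: variable `0` holds the input, all others are `nil`. -/
def inputStore (v : Val) : ℕ → Val := Function.update (fun _ => Val.nil) 0 v

/-- `Runs p s s' t`: started in the store `s`, the program `p` halts in the store `s'`
after exactly `t` steps.  In tests, `nil` counts as false and every cell as true. -/
inductive Runs : Prog → (ℕ → Val) → (ℕ → Val) → ℕ → Prop
  | assign (x : ℕ) (e : Expr) (s : ℕ → Val) :
      Runs (.assign x e) s (Function.update s x (e.eval s)) (e.size + 1)
  | seq {p q : Prog} {s s' s'' : ℕ → Val} {m n : ℕ} :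
      Runs p s s' m → Runs q s' s'' n → Runs (.seq p q) s s'' (m + n + 1)
  | ite_true {e : Expr} {p q : Prog} {s s' : ℕ → Val} {m : ℕ} :
      e.eval s ≠ Val.nil → Runs p s s' m → Runs (.ite e p q) s s' (e.size + m + 1)
  | ite_false {e : Expr} {p q : Prog} {s s' : ℕ → Val} {m : ℕ} :
      e.eval s = Val.nil → Runs q s s' m → Runs (.ite e p q) s s' (e.size + m + 1)
  | loop_done {e : Expr} {p : Prog} {s : ℕ → Val} :
      e.eval s = Val.nil → Runs (.loop e p) s s (e.size + 1)
  | loop_step {e : Expr} {p : Prog} {s s' s'' : ℕ → Val} {m n : ℕ} :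
      e.eval s ≠ Val.nil → Runs p s s' m → Runs (.loop e p) s' s'' n →
        Runs (.loop e p) s s'' (e.size + m + n + 1)
  | call {x : ℕ} {p : Prog} {e : Expr} {s s' : ℕ → Val} {m : ℕ} :
      Runs p (inputStore (e.eval s)) s' m →
        Runs (.call x p e) s (Function.update s x (s' 0)) (e.size + m + 1)

/-- On input `v`, the program `p` halts with output `w` (in variable `0`) after at most `T` steps. -/
def HaltsWithin (p : Prog) (v w : Val) (T : ℝ) : Prop :=
  ∃ (s : ℕ → Val) (t : ℕ), Runs p (inputStore v) s t ∧ s 0 = w ∧ (t : ℝ) ≤ T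

/-! ### Guess & Check codes for messages of `k = 2 ^ ℓ` bits, `ℓ = log₂ k` -/

/-- The number `⌈k / log k⌉` of blocks of a message of `k = 2 ^ ℓ` bits. -/
def numBlocks (ℓ : ℕ) : ℕ := 2 ^ ℓ ⌈/⌉ ℓ

/-- The number of message bits in block `j`: this is `ℓ`, except that the last block may be
shorter. -/
def blockLen (ℓ : ℕ) (j : Fin (numBlocks ℓ)) : ℕ := min ℓ (2 ^ ℓ - j * ℓ)

open Classical in
/-- The linear code with systematic generator matrix `[I | G]`, `G` of size `m × c`, is MDS:
its minimum distance is the largest possible one, `c + 1`. -/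
def IsSystematicMDS {F : Type*} [CommRing F] {m c : ℕ} (G : Matrix (Fin m) (Fin c) F) : Prop :=
  ∀ U : Fin m → F, U ≠ 0 →
    c + 1 ≤ hammingNorm (Sum.elim U (Matrix.vecMul U G) : Fin m ⊕ Fin c → F)

/-- The data of a Guess & Check code for messages of `2 ^ ℓ` bits with `c` parity symbols: the field
`GF(2 ^ ℓ) = GF(2)[X] / (f)` and a systematic `(⌈k / log k⌉ + c, ⌈k / log k⌉)` MDS code over it. -/
structure GCCode (c ℓ : ℕ) where
  f : (ZMod 2)[X]
  monic : f.Monic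
  irreducible : Irreducible f
  natDegree_eq : f.natDegree = ℓ
  G : Matrix (Fin (numBlocks ℓ)) (Fin c) (AdjoinRoot f)
  mds : IsSystematicMDS G

/-- The length of the binary codewords. -/
def gcLength (δ c ℓ : ℕ) : ℕ := 2 ^ ℓ + c * (δ + 1) * ℓ

/-- Delete the positions in `D` from a string. -/
def deletePositions {n : ℕ} (D : Finset (Fin n)) (x : List Bool) : List Bool :=
  (x.zipIdx.filter fun b => b.2 ∉ D.map Fin.valEmbedding).map Prod.fst

/-- Decode the repeated parity bits: `w` is the received word read from right to left and `m` the
number of parity bits still to be read.  Each parity bit is read together with the equal bits that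
follow it, at most `δ + 1` bits in all.  The result is the string of parity bits (in the
original order) and the rest of the received word (still reversed). -/
def readParity (δ : ℕ) : ℕ → List Bool → List Bool × List Bool
  | 0, w => ([], w)
  | _ + 1, [] => ([], [])
  | m + 1, b :: w =>
    let r := readParity δ m (w.drop (min δ (w.takeWhile (· == b)).length))
    (r.1 ++ [b], r.2)

namespace GCCode

noncomputable section

variable {c ℓ : ℕ} (𝒞 : GCCode c ℓ)

/-- The symbol of a block of at most `ℓ` bits, the leftmost bit being the most significant one;
a shorter block is padded with zeros to the length `ℓ`. -/
def symbol (b : List Bool) : AdjoinRoot 𝒞.f :=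
  ∑ i : Fin ℓ, if b.getD i false then AdjoinRoot.root 𝒞.f ^ (ℓ - 1 - (i : ℕ)) else 0

/-- The binary representation of a symbol, most significant bit first. -/
def bits (a : AdjoinRoot 𝒞.f) : List Bool :=
  List.ofFn fun i : Fin ℓ =>
    decide ((AdjoinRoot.modByMonicHom 𝒞.monic a).coeff (ℓ - 1 - (i : ℕ)) = 1)

/-- The `2 ^ ℓ`-ary string of a message. -/
def symbols (u : Fin (2 ^ ℓ) → Bool) (j : Fin (numBlocks ℓ)) : AdjoinRoot 𝒞.f :=
  𝒞.symbol (((List.ofFn u).drop (j * ℓ)).take ℓ)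

/-- The parity symbols of a `2 ^ ℓ`-ary string. -/
def parity (U : Fin (numBlocks ℓ) → AdjoinRoot 𝒞.f) : Fin c → AdjoinRoot 𝒞.f :=
  Matrix.vecMul U 𝒞.G

/-- The encoder: the message, followed by the parity bits, each of them `δ + 1` times. -/
def encode (δ : ℕ) (u : Fin (2 ^ ℓ) → Bool) : List Bool :=
  List.ofFn u ++
    ((List.ofFn (𝒞.parity (𝒞.symbols u))).flatMap 𝒞.bits).flatMap (List.replicate (δ + 1))

/-- The sub-block chunked at block `j` from the received systematic bits `s`, under the guess that
`g i` bits were deleted in block `i` for every `i`. -/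
def subBlock (s : List Bool) (g : Fin (numBlocks ℓ) → ℕ) (j : Fin (numBlocks ℓ)) : List Bool :=
  (s.drop (∑ i ∈ Finset.Iio j, (blockLen ℓ i - g i))).take (blockLen ℓ j - g j)

/-- `IsPossible p s g Y`: for the parity symbols `p` and the received systematic bits `s`,
the guess `g` is a possible case and `Y` is the string decoded in it.  The blocks with
`g j ≠ 0` are erased, and as many of the first parities as there are erased blocks are used to
decode the erasures. -/
structure IsPossible (p : Fin c → AdjoinRoot 𝒞.f) (s : List Bool)
    (g : Fin (numBlocks ℓ) → ℕ) (Y : Fin (numBlocks ℓ) → AdjoinRoot 𝒞.f) : Prop where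
  /-- The guess distributes the missing bits among the blocks. -/
  sum_eq : ∑ j, g j = 2 ^ ℓ - s.length
  le_blockLen : ∀ j, g j ≤ blockLen ℓ j
  /-- The string `Y` is obtained from the unerased symbols by erasure decoding. -/
  unerased : ∀ j, g j = 0 → Y j = 𝒞.symbol (subBlock s g j)
  decoded : ∀ r : Fin c, (r : ℕ) < #{j | g j ≠ 0} → 𝒞.parity Y r = p r
  /-- First criterion: the remaining parities are satisfied. -/
  criterion1 : ∀ r : Fin c, #{j | g j ≠ 0} ≤ (r : ℕ) → 𝒞.parity Y r = p r
  /-- Second criterion: the decoded erasures are supersequences of their sub-blocks. -/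
  criterion2 : ∀ j, g j ≠ 0 → (subBlock s g j).Sublist (𝒞.bits (Y j))

/-- The strings decoded from the received word `y` in the possible cases. -/
def candidates (δ : ℕ) (y : List Bool) : Set (Fin (numBlocks ℓ) → AdjoinRoot 𝒞.f) :=
  let r := readParity δ (c * ℓ) y.reverse
  {Y | ∃ g : Fin (numBlocks ℓ) → ℕ,
    𝒞.IsPossible (fun i => 𝒞.symbol ((r.1.drop (i * ℓ)).take ℓ)) r.2.reverse g Y}

open Classical in
/-- The decoder: if there are possible cases and all of them lead to the same string, output
its bits; otherwise declare a decoding failure (`none`). -/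
def decode (δ : ℕ) (y : List Bool) : Option (List Bool) :=
  if h : ∃! Y, Y ∈ 𝒞.candidates δ y then
    some (((List.ofFn h.choose).flatMap 𝒞.bits).take (2 ^ ℓ))
  else none

/-- The word received when the positions in `D` are deleted from the codeword of `u`. -/
def received (δ : ℕ) (u : Fin (2 ^ ℓ) → Bool) (D : Finset (Fin (gcLength δ c ℓ))) : List Bool :=
  deletePositions D (𝒞.encode δ u)

open Classical in
/-- The probability of a decoding failure when the message bits are independent and uniform and the
set of deleted positions is drawn from the law `μ`, independently of the message. -/
def failureProb (δ : ℕ) (μ : PMF (Finset (Fin (gcLength δ c ℓ)))) : ℝ :=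
  ∑ D, (μ D).toReal *
    ((#{u : Fin (2 ^ ℓ) → Bool | 𝒞.decode δ (𝒞.received δ u D) = none} : ℝ) / 2 ^ (2 ^ ℓ))

/-- The description of the code handed to the encoding and decoding programs: the coefficients
of `f` and the entries of the parity part of the generator matrix, as bit strings. -/
def description : Val :=
  Val.cons (Val.ofBits (List.ofFn fun i : Fin (ℓ + 1) => decide (𝒞.f.coeff (ℓ - (i : ℕ)) = 1)))
    (Val.ofList (List.ofFn fun j => Val.ofList (List.ofFn fun r => Val.ofBits (𝒞.bits (𝒞.G j r)))))

end

end GCCode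

/-! Write k = 2 ^ ℓ, q = 2 ^ ℓ for the order of the field, and K for the number of blocks.

No wrong output. Every parity bit is sent δ + 1 times, so each run keeps at least one bit. Reading a
shortened run may swallow equal bits of its neighbour, but the excess never exceeds the number of
deletions met so far; hence all parity bits are recovered, and at most the last e bits of the
message are lost in addition (`readParity_received`). The string s consists of the message bits at a
fixed list φ = `kept D e` of positions, with at most δ positions missing. The true distribution b of
these losses among the blocks is a possible case with the true symbols (`isPossible_symbols`). A
unique candidate is therefore the message.

Failure. Fix φ and a guess g with z erased blocks. The MDS property enters through one fact,
`eq_zero_of_parity_eq_zero`: a string with zero parities and at most c nonzero symbols is zero. Call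
a block shifted if neither g nor b touches it, but g reads it from a wrong place. On bits, the
difference between what is read and what was sent is u (σ x) + u x, with σ strictly monotone on the
unerased positions and without fixed points in shifted blocks; such differences can be prescribed
freely (`exists_xor_eq`, `exists_readDiff_eq`). If z + #T ≤ c for a set T of shifted blocks, then
translating the bad messages by messages with prescribed differences on T is injective, so a share
of at most q ^ (-#T) of all messages is bad for g (`card_wrongSet_mul_le`). If there are at least c
- z shifted blocks, this gives q ^ (δ - c) for each of at most K ^ δ guesses, which is the main
term. Otherwise the prefix sums of g and b separate only briefly, so g affects only blocks near
those affected by b (`le_card_shifted`), and there are boundedly many such g. For these, a wrong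
string differs from the message in at least c + 1 blocks, all of them erased, damaged or shifted,
whence #T ≥ c + 1 - 2δ and a share of q ^ (2δ - 1 - c) (`le_card_of_nonempty`); the additional
factor 1 / q absorbs ℓ ^ δ. A union bound over e ≤ δ and an average over the law of D finish the
estimate.

Complexity. `InTime` says that a function on encoded data has a program with a given time bound up
to a constant; it is closed under composition, branching and bounded folds, so that programs never
have to be written out. Numbers are kept in unary, as lists used as templates. The encoder makes c
products of cost O(ℓ ^ 2) for each of the K rows, which is O(k ℓ). The decoder replaces erasure
decoding by an enumeration of all supersequences of the erased sub-blocks. A block of full length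
with g missing bits yields at most (2 ℓ + 1) ^ g of them, so a guess that leaves the last block
alone costs O(K ℓ) plus a polynomial in ℓ. If the last block is short and erased, its padding bits
are free as well, and up to 3 ^ ℓ strings may occur; but such a guess spends a deletion on the last
block, so that there are only O(K ^ (δ - 1)) of them, and 3 ^ ℓ times a polynomial in ℓ is O(k ^ 2).
Since k ≤ K ℓ, both kinds add up to O(K ^ δ k ℓ). A potential that tracks both kinds
(`sum_potential_le`) carries out this count along the tree of partial guesses. -/

/-! ### Time-bounded computations on encoded data -/

/-- Started on `v`, the program `p` halts with output `w` after at most `t` steps. -/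
def Computes (p : Prog) (v w : Val) (t : ℕ) : Prop :=
  ∃ (s : ℕ → Val) (t' : ℕ), Runs p (inputStore v) s t' ∧ s 0 = w ∧ t' ≤ t

@[simp] theorem inputStore_zero (v : Val) : inputStore v 0 = v := by simp [inputStore]

theorem Computes.mono {p v w t t'} (h : Computes p v w t) (ht : t ≤ t') : Computes p v w t' := by
  obtain ⟨s, m, h1, h2, h3⟩ := h
  exact ⟨s, m, h1, h2, h3.trans ht⟩

theorem Computes.assign (e : Expr) (v : Val) :
    Computes (.assign 0 e) v (e.eval (inputStore v)) (e.size + 1) :=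
  ⟨_, _, .assign 0 e _, by simp, le_rfl⟩

/-- The call starts `q` in a fresh store, so nothing but the value of variable `0` passes from `p`
to `q`. This is what makes time bounds compose without any account of the other variables. -/
theorem Computes.seq_call {p q v w x t t'} (hp : Computes p v w t) (hq : Computes q w x t') :
    Computes (.seq p (.call 0 q (.var 0))) v x (t + t' + 3) := by
  obtain ⟨s, m, h1, rfl, h3⟩ := hp
  obtain ⟨s', m', h1', rfl, h3'⟩ := hq
  refine ⟨_, _, .seq h1 (.call (e := .var 0) h1'), by simp, ?_⟩
  simp only [Expr.size]; omega

theorem Computes.pair {p q v w x t t'} (hp : Computes p v w t) (hq : Computes q v x t') :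
    Computes (.seq (.call 1 p (.var 0)) (.seq (.call 2 q (.var 0))
      (.assign 0 (.cons (.var 1) (.var 2))))) v (Val.cons w x) (t + t' + 12) := by
  obtain ⟨s, m, h1, rfl, h3⟩ := hp
  obtain ⟨s', m', h1', rfl, h3'⟩ := hq
  refine ⟨_, _, .seq (.call (e := .var 0) (by simpa [Expr.eval] using h1))
    (.seq (.call (e := .var 0) (by simpa [Expr.eval] using h1')) (.assign _ _ _)), ?_, ?_⟩
  · simp [Expr.eval]
  · simp only [Expr.size]; omega

theorem Computes.ite {c p q v b w t t'} (hc : Computes c v b t)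
    (hp : b ≠ Val.nil → Computes p v w t') (hq : b = Val.nil → Computes q v w t') :
    Computes (.seq (.call 1 c (.var 0)) (.ite (.var 1) (.call 0 p (.var 0)) (.call 0 q (.var 0))))
      v w (t + t' + 8) := by
  obtain ⟨s, m, h1, rfl, h3⟩ := hc
  by_cases hb : s 0 = Val.nil
  · obtain ⟨s', m', h1', rfl, h3'⟩ := hq hb
    refine ⟨_, _, .seq (.call (e := .var 0) (by simpa [Expr.eval] using h1))
      (.ite_false (by simpa [Expr.eval] using hb)
        (.call (e := .var 0) (by simpa [Expr.eval] using h1'))), by simp, ?_⟩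
    simp only [Expr.size]; omega
  · obtain ⟨s', m', h1', rfl, h3'⟩ := hp hb
    refine ⟨_, _, .seq (.call (e := .var 0) (by simpa [Expr.eval] using h1))
      (.ite_true (by simpa [Expr.eval] using hb)
        (.call (e := .var 0) (by simpa [Expr.eval] using h1'))), by simp, ?_⟩
    simp only [Expr.size]; omega

/-- Data types with a representation by cons cells. -/
class Enc (α : Type) where
  enc : α → Val

open Enc (enc)

instance : Enc Unit := ⟨fun _ => Val.nil⟩
instance : Enc Bool := ⟨Val.ofBool⟩
instance {α β} [Enc α] [Enc β] : Enc (α × β) := ⟨fun x => Val.cons (enc x.1) (enc x.2)⟩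
instance {α} [Enc α] : Enc (List α) := ⟨fun l => Val.ofList (l.map enc)⟩
instance {α} [Enc α] : Enc (Option α) := ⟨fun
  | none => Val.nil
  | some a => Val.cons Val.nil (enc a)⟩

section
variable {α β γ σ τ : Type} [Enc α] [Enc β] [Enc γ] [Enc σ] [Enc τ]

theorem enc_pair (a : α) (b : β) : enc (a, b) = Val.cons (enc a) (enc b) := rfl
theorem enc_nil : enc ([] : List α) = Val.nil := rfl
theorem enc_cons (a : α) (l : List α) : enc (a :: l) = Val.cons (enc a) (enc l) := rfl
theorem enc_bits (l : List Bool) : enc l = Val.ofBits l := rfl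
theorem enc_option (l : Option (List Bool)) : enc l = Val.ofOptionBits l := by cases l <;> rfl

/-- On arguments `a` with `P a`, the function `f` is computable in time `O(B a + 1)`. -/
def InTime (P : α → Prop) (f : α → β) (B : α → ℕ) : Prop :=
  ∃ (p : Prog) (A : ℕ), ∀ a, P a → Computes p (enc a) (enc (f a)) (A * (B a + 1))

namespace InTime

theorem mono {P Q : α → Prop} {f : α → β} {B B' : α → ℕ} (h : InTime P f B) (A : ℕ)
    (hP : ∀ a, Q a → P a) (hB : ∀ a, Q a → B a ≤ A * (B' a + 1)) : InTime Q f B' := by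
  obtain ⟨p, A', h⟩ := h
  refine ⟨p, A' * (A + 1), fun a ha => (h a (hP a ha)).mono ?_⟩
  have := hB a ha
  calc A' * (B a + 1) ≤ A' * ((A + 1) * (B' a + 1)) := by gcongr; nlinarith
    _ = _ := by ring

theorem congr {P : α → Prop} {f g : α → β} {B : α → ℕ} (h : InTime P f B)
    (hfg : ∀ a, P a → f a = g a) : InTime P g B := by
  obtain ⟨p, A', h⟩ := h
  exact ⟨p, A', fun a ha => hfg a ha ▸ h a ha⟩

theorem id {P : α → Prop} {B : α → ℕ} : InTime P (fun a => a) B :=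
  ⟨.assign 0 (.var 0), 2, fun a _ => (Computes.assign _ _).mono (by simp [Expr.size])⟩

theorem exists_expr (v : Val) : ∃ e : Expr, ∀ s, e.eval s = v := by
  induction v with
  | nil => exact ⟨.nil, fun _ => rfl⟩
  | cons a b iha ihb =>
    obtain ⟨e, he⟩ := iha
    obtain ⟨e', he'⟩ := ihb
    exact ⟨.cons e e', fun s => by simp [Expr.eval, he, he']⟩

theorem const {P : α → Prop} {B : α → ℕ} (b : β) : InTime P (fun _ => b) B := by
  obtain ⟨e, he⟩ := exists_expr (enc b)
  refine ⟨.assign 0 e, e.size + 1, fun a _ => ?_⟩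
  have := Computes.assign e (enc a)
  rw [he] at this
  exact this.mono (Nat.le_mul_of_pos_right _ (by omega))

theorem comp {P : α → Prop} {Q : β → Prop} {f : α → β} {g : β → γ} {B : α → ℕ} {B' : β → ℕ}
    (hg : InTime Q g B') (hf : InTime P f B) (A : ℕ) (hQ : ∀ a, P a → Q (f a))
    (hB : ∀ a, P a → B' (f a) ≤ A * (B a + 1)) : InTime P (fun a => g (f a)) B := by
  obtain ⟨p, C, hp⟩ := hf
  obtain ⟨q, D, hq⟩ := hg
  refine ⟨_, C + D * (A + 1) + 3, fun a ha => ((hp a ha).seq_call (hq _ (hQ a ha))).mono ?_⟩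
  have h1 : D * (B' (f a) + 1) ≤ D * ((A + 1) * (B a + 1)) := by
    have := hB a ha
    gcongr; nlinarith
  nlinarith

theorem pair {P : α → Prop} {f : α → β} {g : α → γ} {B : α → ℕ}
    (hf : InTime P f B) (hg : InTime P g B) : InTime P (fun a => (f a, g a)) B := by
  obtain ⟨p, C, hp⟩ := hf
  obtain ⟨q, D, hq⟩ := hg
  exact ⟨_, C + D + 12, fun a ha => ((hp a ha).pair (hq a ha)).mono (by nlinarith)⟩

theorem of_hd {P : β → Prop} {B : β → ℕ} {g : β → γ}
    (h : ∀ b, P b → enc (g b) = (enc b).hd) : InTime P g B := by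
  refine ⟨.assign 0 (.hd (.var 0)), 3, fun a ha => ?_⟩
  rw [h a ha]
  refine (Computes.assign _ _).mono ?_
  simp only [Expr.size]; omega

theorem of_tl {P : β → Prop} {B : β → ℕ} {g : β → γ}
    (h : ∀ b, P b → enc (g b) = (enc b).tl) : InTime P g B := by
  refine ⟨.assign 0 (.tl (.var 0)), 3, fun a ha => ?_⟩
  rw [h a ha]
  refine (Computes.assign _ _).mono ?_
  simp only [Expr.size]; omega

theorem fst {P : α → Prop} {f : α → β × γ} {B : α → ℕ} (hf : InTime P f B) :
    InTime P (fun a => (f a).1) B :=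
  comp (Q := fun _ => True) (g := Prod.fst) (B' := fun _ => 0)
    (of_hd fun _ _ => rfl) hf 0 (fun _ _ => trivial) (by simp)

theorem snd {P : α → Prop} {f : α → β × γ} {B : α → ℕ} (hf : InTime P f B) :
    InTime P (fun a => (f a).2) B :=
  comp (Q := fun _ => True) (g := Prod.snd) (B' := fun _ => 0)
    (of_tl fun _ _ => rfl) hf 0 (fun _ _ => trivial) (by simp)

theorem tail {P : α → Prop} {f : α → List β} {B : α → ℕ} (hf : InTime P f B) :
    InTime P (fun a => (f a).tail) B :=
  comp (Q := fun _ => True) (g := List.tail) (B' := fun _ => 0)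
    (of_tl fun b _ => by cases b <;> rfl) hf 0 (fun _ _ => trivial) (by simp)

/-- On the empty list the machine returns `nil`, so the default element has to be encoded by `nil`.
-/
theorem headD {P : α → Prop} {f : α → List β} {B : α → ℕ} {d : β} (hd : enc d = Val.nil)
    (hf : InTime P f B) : InTime P (fun a => (f a).headD d) B :=
  comp (Q := fun _ => True) (g := fun l => List.headD l d) (B' := fun _ => 0)
    (of_hd fun b _ => by cases b <;> simp [enc_nil, enc_cons, Val.hd, hd]) hf 0
    (fun _ _ => trivial) (by simp)

theorem cons {P : α → Prop} {f : α → β} {g : α → List β} {B : α → ℕ}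
    (hf : InTime P f B) (hg : InTime P g B) : InTime P (fun a => f a :: g a) B := hf.pair hg

theorem some {P : α → Prop} {f : α → β} {B : α → ℕ}
    (hf : InTime P f B) : InTime P (fun a => Option.some (f a)) B :=
  (const (β := Unit) ()).pair hf

/-- The test is whether an encoded value is `nil`. This covers branching on a bit, `false` being
`nil`, as well as on the emptiness of a list. Each branch has to be computed only on the inputs that
reach it. -/
theorem ite_aux {P : α → Prop} {b : α → β} {f g h : α → γ} {B : α → ℕ} (hb : InTime P b B)
    (hf : InTime (fun a => P a ∧ enc (b a) ≠ Val.nil) f B)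
    (hg : InTime (fun a => P a ∧ enc (b a) = Val.nil) g B)
    (h1 : ∀ a, P a → enc (b a) ≠ Val.nil → h a = f a)
    (h2 : ∀ a, P a → enc (b a) = Val.nil → h a = g a) : InTime P h B := by
  obtain ⟨c, A, hc⟩ := hb
  obtain ⟨p, C, hp⟩ := hf
  obtain ⟨q, D, hq⟩ := hg
  refine ⟨_, A + (C + D) + 8, fun a ha => ((hc a ha).ite (p := p) (q := q) (t' := (C + D) * (B a + 1))
    (fun hn => ?_) (fun hn => ?_)).mono ?_⟩
  · rw [h1 a ha hn]; exact (hp a ⟨ha, hn⟩).mono (Nat.mul_le_mul_right _ (by omega))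
  · rw [h2 a ha hn]; exact (hq a ⟨ha, hn⟩).mono (Nat.mul_le_mul_right _ (by omega))
  · nlinarith

theorem ite {P : α → Prop} {b : α → Bool} {f g : α → γ} {B : α → ℕ} (hb : InTime P b B)
    (hf : InTime (fun a => P a ∧ b a = true) f B) (hg : InTime (fun a => P a ∧ b a = false) g B) :
    InTime P (fun a => if b a then f a else g a) B := by
  refine ite_aux hb (hf.mono (B' := B) 1 (fun a h => ⟨h.1, ?_⟩) (fun _ _ => by omega))
    (hg.mono (B' := B) 1 (fun a h => ⟨h.1, ?_⟩) (fun _ _ => by omega)) ?_ ?_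
  · have := h.2; cases hb : b a <;> simp_all [enc, Val.ofBool]
  · have := h.2; cases hb : b a <;> simp_all [enc, Val.ofBool]
  · intro a _ h; cases hb : b a <;> simp_all [enc, Val.ofBool]
  · intro a _ h; cases hb : b a <;> simp_all [enc, Val.ofBool]

/-- Case distinction on a list. -/
theorem listCase {P : α → Prop} {l : α → List β} {h : α → γ} {f : α → γ} {g : α → β → List β → γ}
    {B : α → ℕ} {B' : α × β × List β → ℕ} (hl : InTime P l B)
    (hf : InTime (fun a => P a ∧ l a = []) f B)
    (hg : InTime (fun q : α × β × List β => P q.1 ∧ l q.1 = q.2.1 :: q.2.2)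
      (fun q => g q.1 q.2.1 q.2.2) B')
    (A : ℕ) (hB : ∀ a x xs, P a → l a = x :: xs → B' (a, x, xs) ≤ A * (B a + 1))
    (h1 : ∀ a, P a → l a = [] → h a = f a)
    (h2 : ∀ a x xs, P a → l a = x :: xs → h a = g a x xs) : InTime P h B := by
  obtain ⟨q, C, hq⟩ := hl
  obtain ⟨p, D, hp⟩ := hg
  have hg' : InTime (fun a => P a ∧ enc (l a) ≠ Val.nil) h B := by
    refine ⟨.seq (.seq (.call 1 (.assign 0 (.var 0)) (.var 0)) (.seq (.call 2 q (.var 0))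
      (.assign 0 (.cons (.var 1) (.var 2))))) (.call 0 p (.var 0)),
      100 * (1 + C + D * (A + 1)), fun a ha => ?_⟩
    obtain ⟨ha, hn⟩ := ha
    obtain ⟨x, xs, hx⟩ : ∃ x xs, l a = x :: xs := by
      cases hla : l a with
      | nil => simp [hla, enc_nil] at hn
      | cons x xs => exact ⟨x, xs, rfl⟩
    rw [h2 a x xs ha hx]
    have k1 : Computes (.assign 0 (.var 0)) (enc a) (enc a) 2 := Computes.assign (.var 0) (enc a)
    have k2 := k1.pair (hq a ha)
    rw [hx] at k2
    refine (k2.seq_call (hp (a, x, xs) ⟨ha, hx⟩)).mono ?_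
    have h1 : D * (B' (a, x, xs) + 1) ≤ D * ((A + 1) * (B a + 1)) := by
      have := hB a x xs ha hx
      gcongr; nlinarith
    nlinarith
  refine ite_aux ⟨q, C, hq⟩ hg' (hf.mono (B' := B) 1 (fun a h => ⟨h.1, ?_⟩) (fun _ _ => by omega)) ?_ ?_
  · have := h.2
    cases hla : l a with
    | nil => rfl
    | cons x xs => simp [hla, enc_cons] at this
  · exact fun _ _ _ => rfl
  · intro a ha h
    refine h1 a ha ?_
    cases hla : l a with
    | nil => rfl
    | cons x xs => simp [hla, enc_cons] at h

/-- The program that folds `p` over a list, started in `(context, state, list)`. -/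
def foldProg (p : Prog) : Prog :=
  .seq (.loop (.tl (.tl (.var 0))) (.call 0 (.seq (.call 1 p (.var 0))
    (.assign 0 (.cons (.hd (.var 0)) (.cons (.var 1) (.tl (.tl (.tl (.var 0)))))))) (.var 0)))
    (.assign 0 (.hd (.tl (.var 0))))

end InTime

/-- Variable `0` holds context, state and remaining list; the loop tests the last of these. The
invariant sees the remaining list together with the state, which is needed for states that grow
during the loop, such as doubled lists or collections of partial guesses. -/
theorem Runs.foldLoop {p : Prog} {c : γ} {step : σ → τ → σ} {b : τ → ℕ} {A : ℕ}
    (Inv : List τ → σ → Prop) (hI : ∀ x xs v, Inv (x :: xs) v → Inv xs (step v x))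
    (h : ∀ x xs v, Inv (x :: xs) v →
      Computes p (enc (c, v, x, xs)) (enc (step v x)) (A * (b x + 1))) :
    ∀ (l : List τ) (v : σ) (s : ℕ → Val), Inv l v → s 0 = enc (c, v, l) →
      ∃ s' t, Runs (.loop (.tl (.tl (.var 0))) (.call 0 (.seq (.call 1 p (.var 0))
        (.assign 0 (.cons (.hd (.var 0)) (.cons (.var 1) (.tl (.tl (.tl (.var 0)))))))) (.var 0)))
        s s' t ∧ s' 0 = enc (c, l.foldl step v, ([] : List τ)) ∧
        t ≤ (A + 25) * (l.map fun x => b x + 1).sum + 4 := by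
  intro l
  induction l with
  | nil =>
    intro v s _ hs
    refine ⟨s, _, .loop_done ?_, by simpa using hs, by simp [Expr.size]⟩
    simp [Expr.eval, hs, enc_pair, enc_nil, Val.tl]
  | cons x xs ih =>
    intro v s hv hs
    obtain ⟨s1, t1, hr, h0, ht⟩ := h x xs v hv
    have hbody : Runs (.call 0 (.seq (.call 1 p (.var 0))
        (.assign 0 (.cons (.hd (.var 0)) (.cons (.var 1) (.tl (.tl (.tl (.var 0)))))))) (.var 0))
        s (Function.update s 0 (enc (c, step v x, xs))) (t1 + 15) := by
      have := Runs.call (x := 0) (e := .var 0) (s := s) (Runs.seq (s := inputStore (s 0))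
        (Runs.call (x := 1) (p := p) (e := .var 0) (s := inputStore (s 0)) (s' := s1) (m := t1)
          (by simpa [Expr.eval, show s 0 = enc (c, v, x, xs) from hs] using hr))
        (Runs.assign 0 (.cons (.hd (.var 0)) (.cons (.var 1) (.tl (.tl (.tl (.var 0)))))) _))
      convert this using 1
      · simp [Expr.eval, hs, enc_pair, enc_cons, Val.hd, Val.tl, h0]
      · simp only [Expr.size]; ring
    obtain ⟨s2, t2, hr2, h2, ht2⟩ := ih (step v x) (Function.update s 0 (enc (c, step v x, xs)))
      (hI _ _ _ hv) (by simp)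
    refine ⟨s2, _, .loop_step ?_ hbody hr2, by simpa using h2, ?_⟩
    · simp [Expr.eval, hs, enc_pair, enc_cons, Val.tl]
    · simp only [Expr.size, List.map_cons, List.sum_cons]
      nlinarith

namespace InTime

/-- The cost `bs` of a step may depend on the current state, whereas `b` bounds it along the run in
terms of the list element alone; only the sum of `b` over the list enters the total. -/
theorem foldl {P : α → Prop} {l : α → List τ} {v : α → σ} {step : α → σ → τ → σ} {B : α → ℕ}
    {bs : α × σ × τ → ℕ} (Inv : α → List τ → σ → Prop) (b : α → τ → ℕ)
    (hstep : InTime (fun q : α × σ × τ => P q.1 ∧ ∃ xs, Inv q.1 (q.2.2 :: xs) q.2.1)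
      (fun q => step q.1 q.2.1 q.2.2) bs)
    (hl : InTime P l B) (hv : InTime P v B) (h0 : ∀ a, P a → Inv a (l a) (v a))
    (hI : ∀ a x xs w, P a → Inv a (x :: xs) w → Inv a xs (step a w x))
    (hb : ∀ a x xs w, P a → Inv a (x :: xs) w → bs (a, w, x) ≤ b a x)
    (A : ℕ) (hB : ∀ a, P a → ((l a).map fun x => b a x + 1).sum ≤ A * (B a + 1)) :
    InTime P (fun a => (l a).foldl (step a) (v a)) B := by
  obtain ⟨p, C, hp⟩ := hstep
  -- rearrange `(a, w, x, xs)` into `(a, w, x)`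
  have hpre : ∀ a x xs w, P a → Inv a (x :: xs) w →
      Computes (.seq (.assign 0 (.cons (.hd (.var 0)) (.cons (.hd (.tl (.var 0)))
        (.hd (.tl (.tl (.var 0))))))) (.call 0 p (.var 0)))
        (enc (a, w, x, xs)) (enc (step a w x)) ((C + 20) * (b a x + 1)) := by
    intro a x xs w ha hw
    have k := (Computes.assign (.cons (.hd (.var 0)) (.cons (.hd (.tl (.var 0)))
        (.hd (.tl (.tl (.var 0)))))) (enc (a, w, x, xs)))
    simp only [Expr.eval, inputStore_zero, enc_pair, Val.hd, Val.tl] at k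
    refine (k.seq_call (hp (a, w, x) ⟨ha, xs, hw⟩)).mono ?_
    have := hb a x xs w ha hw
    simp only [Expr.size]
    have : C * (bs (a, w, x) + 1) ≤ C * (b a x + 1) := by gcongr
    nlinarith
  obtain ⟨q, D, hq⟩ := (id (P := P) (B := B)).pair (hv.pair hl)
  refine ⟨.seq q (.call 0 (foldProg (.seq (.assign 0 (.cons (.hd (.var 0)) (.cons (.hd (.tl (.var 0)))
        (.hd (.tl (.tl (.var 0))))))) (.call 0 p (.var 0)))) (.var 0)),
    D + (C + 45) * A + 20, fun a ha => ?_⟩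
  have key : Computes (foldProg (.seq (.assign 0 (.cons (.hd (.var 0)) (.cons (.hd (.tl (.var 0)))
        (.hd (.tl (.tl (.var 0))))))) (.call 0 p (.var 0)))) (enc (a, v a, l a))
        (enc ((l a).foldl (step a) (v a)))
        ((C + 45) * ((l a).map fun x => b a x + 1).sum + 9) := by
    obtain ⟨s, t, h1, h2, h3⟩ := Runs.foldLoop (c := a) (Inv a) (fun x xs w => hI a x xs w ha)
      (fun x xs w => hpre a x xs w ha) (l a) (v a) (inputStore (enc (a, v a, l a))) (h0 a ha)
      (by simp)
    refine ⟨_, _, .seq h1 (.assign _ _ _), ?_, ?_⟩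
    · simp [Expr.eval, h2, enc_pair, Val.hd, Val.tl]
    · simp only [Expr.size]
      have : C + 20 + 25 = C + 45 := by ring
      rw [this] at h3; omega
  refine ((hq a ha).seq_call key).mono ?_
  have : (C + 45) * ((l a).map fun x => b a x + 1).sum ≤ (C + 45) * (A * (B a + 1)) := by
    gcongr; exact hB a ha
  nlinarith

/-- Folding with a bound for all steps and an invariant of the state. -/
theorem foldl' {P : α → Prop} {l : α → List τ} {v : α → σ} {step : α → σ → τ → σ} {B : α → ℕ}
    {bs : α × σ × τ → ℕ} (Inv : α → σ → Prop) (b : α → ℕ)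
    (hstep : InTime (fun q : α × σ × τ => P q.1 ∧ Inv q.1 q.2.1 ∧ q.2.2 ∈ l q.1)
      (fun q => step q.1 q.2.1 q.2.2) bs)
    (hl : InTime P l B) (hv : InTime P v B) (h0 : ∀ a, P a → Inv a (v a))
    (hI : ∀ a x w, P a → Inv a w → x ∈ l a → Inv a (step a w x))
    (hb : ∀ a x w, P a → Inv a w → x ∈ l a → bs (a, w, x) ≤ b a)
    (A : ℕ) (hB : ∀ a, P a → (l a).length * (b a + 1) ≤ A * (B a + 1)) :
    InTime P (fun a => (l a).foldl (step a) (v a)) B := by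
  refine foldl (fun a xs w => Inv a w ∧ ∀ x ∈ xs, x ∈ l a) (fun a _ => b a)
    (hstep.mono (B' := bs) 1 (fun q h => ?_) (fun _ _ => by omega)) hl hv
    (fun a ha => ⟨h0 a ha, fun _ h => h⟩) (fun a x xs w ha hw => ?_) (fun a x xs w ha hw => ?_) A
    (fun a ha => ?_)
  · obtain ⟨h1, xs, h2, h3⟩ := h
    exact ⟨h1, h2, h3 _ (by simp)⟩
  · exact ⟨hI a x w ha hw.1 (hw.2 x (by simp)), fun y hy => hw.2 y (by simp [hy])⟩
  · exact hb a x w ha hw.1 (hw.2 x (by simp))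
  · simpa using hB a ha

end InTime
end

/-! ### Time bounds for operations on lists -/

namespace InTime
variable {α β γ δ σ τ : Type} [Enc α] [Enc β] [Enc γ] [Enc δ] [Enc σ] [Enc τ]

theorem app₂ {P : α → Prop} {Q : β × γ → Prop} {F : β → γ → δ} {BF : β × γ → ℕ} {B : α → ℕ}
    {f : α → β} {g : α → γ} (hF : InTime Q (fun q => F q.1 q.2) BF)
    (hf : InTime P f B) (hg : InTime P g B) (A : ℕ) (hQ : ∀ a, P a → Q (f a, g a))
    (hB : ∀ a, P a → BF (f a, g a) ≤ A * (B a + 1)) : InTime P (fun a => F (f a) (g a)) B :=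
  comp hF (hf.pair hg) A hQ hB

theorem app₃ {ε : Type} [Enc ε] {P : α → Prop} {Q : β × γ × δ → Prop} {F : β → γ → δ → ε}
    {BF : β × γ × δ → ℕ} {B : α → ℕ}
    {f : α → β} {g : α → γ} {h : α → δ} (hF : InTime Q (fun q => F q.1 q.2.1 q.2.2) BF)
    (hf : InTime P f B) (hg : InTime P g B) (hh : InTime P h B) (A : ℕ)
    (hQ : ∀ a, P a → Q (f a, g a, h a))
    (hB : ∀ a, P a → BF (f a, g a, h a) ≤ A * (B a + 1)) :
    InTime P (fun a => F (f a) (g a) (h a)) B :=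
  comp hF (hf.pair (hg.pair hh)) A hQ hB

theorem app₄ {ε ζ : Type} [Enc ε] [Enc ζ] {P : α → Prop} {Q : β × γ × δ × ε → Prop}
    {F : β → γ → δ → ε → ζ} {BF : β × γ × δ × ε → ℕ} {B : α → ℕ}
    {f : α → β} {g : α → γ} {h : α → δ} {k : α → ε}
    (hF : InTime Q (fun q => F q.1 q.2.1 q.2.2.1 q.2.2.2) BF)
    (hf : InTime P f B) (hg : InTime P g B) (hh : InTime P h B) (hk : InTime P k B) (A : ℕ)
    (hQ : ∀ a, P a → Q (f a, g a, h a, k a))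
    (hB : ∀ a, P a → BF (f a, g a, h a, k a) ≤ A * (B a + 1)) :
    InTime P (fun a => F (f a) (g a) (h a) (k a)) B :=
  comp hF (hf.pair (hg.pair (hh.pair hk))) A hQ hB

theorem weaken {P Q : α → Prop} {f : α → β} {B : α → ℕ} (h : InTime P f B)
    (hP : ∀ a, Q a → P a) : InTime Q f B := h.mono 1 hP (fun _ _ => by omega)

theorem not {P : α → Prop} {b : α → Bool} {B : α → ℕ} (hb : InTime P b B) :
    InTime P (fun a => !b a) B :=
  (hb.ite (f := fun _ => false) (g := fun _ => true) (const _) (const _)).congr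
    (fun a _ => by cases b a <;> rfl)

theorem and {P : α → Prop} {b c : α → Bool} {B : α → ℕ} (hb : InTime P b B) (hc : InTime P c B) :
    InTime P (fun a => b a && c a) B :=
  (hb.ite (g := fun _ => false) (hc.weaken fun _ h => h.1) (const _)).congr
    (fun a _ => by cases b a <;> rfl)

theorem xor {P : α → Prop} {b c : α → Bool} {B : α → ℕ} (hb : InTime P b B) (hc : InTime P c B) :
    InTime P (fun a => Bool.xor (b a) (c a)) B :=
  (hb.ite (f := fun a => !c a) (g := c) (hc.not.weaken fun _ h => h.1)
    (hc.weaken fun _ h => h.1)).congr (fun a _ => by cases b a <;> simp)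

theorem isEmpty {P : α → Prop} {l : α → List β} {B : α → ℕ} (hl : InTime P l B) :
    InTime P (fun a => (l a).isEmpty) B :=
  listCase (f := fun _ => true) (g := fun _ _ _ => false) (B' := fun _ => 0) hl
    (const _) (const _) 0 (by simp) (by simp +contextual) (by simp +contextual)

/-- Folding with a bound that depends on the element. -/
theorem foldSum {P : α → Prop} {l : α → List τ} {v : α → σ} {step : α → σ → τ → σ} {B : α → ℕ}
    {bs : α × σ × τ → ℕ} (b : α → τ → ℕ)
    (hstep : InTime (fun q : α × σ × τ => P q.1 ∧ q.2.2 ∈ l q.1)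
      (fun q => step q.1 q.2.1 q.2.2) bs)
    (hl : InTime P l B) (hv : InTime P v B)
    (hb : ∀ a x w, P a → x ∈ l a → bs (a, w, x) ≤ b a x)
    (A : ℕ) (hB : ∀ a, P a → ((l a).map fun x => b a x + 1).sum ≤ A * (B a + 1)) :
    InTime P (fun a => (l a).foldl (step a) (v a)) B :=
  foldl (fun a xs _ => ∀ x ∈ xs, x ∈ l a) b
    (hstep.weaken fun q ⟨h1, xs, h3⟩ => ⟨h1, h3 _ (by simp)⟩) hl hv
    (fun _ _ _ h => h) (fun a x xs w _ hw y hy => hw y (by simp [hy]))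
    (fun a x xs w ha hw => hb a x w ha (hw x (by simp))) A hB

theorem reverse {P : α → Prop} {l : α → List τ} {B : α → ℕ} (hl : InTime P l B)
    (A : ℕ) (hB : ∀ a, P a → (l a).length ≤ A * (B a + 1)) :
    InTime P (fun a => (l a).reverse) B :=
  (foldSum (fun _ _ => 0) (step := fun _ w x => x :: w) (bs := fun _ => 0)
    (id.snd.snd.cons id.snd.fst) hl (const []) (by simp) A (by simpa using hB)).congr
    (fun a _ => by
      have : ∀ (l w : List τ), l.foldl (fun w x => x :: w) w = l.reverse ++ w := by
        intro l; induction l <;> simp_all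
      simp [this])

theorem append {P : α → Prop} {l m : α → List τ} {B : α → ℕ} (hl : InTime P l B)
    (hm : InTime P m B) (A : ℕ) (hB : ∀ a, P a → (l a).length ≤ A * (B a + 1)) :
    InTime P (fun a => l a ++ m a) B :=
  (foldSum (fun _ _ => 0) (step := fun _ w x => x :: w) (bs := fun _ => 0)
    (id.snd.snd.cons id.snd.fst) (hl.reverse A hB) hm (by simp) A (by simpa using hB)).congr
    (fun a _ => by
      have : ∀ (l w : List τ), l.foldl (fun w x => x :: w) w = l.reverse ++ w := by
        intro l; induction l <;> simp_all
      simp [this])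

/-- The list is traversed from its end and every new piece is put in front of the result. Appending
costs the length of its first argument, so the copying is linear in the output instead of quadratic.
-/
theorem flatMap {P : α → Prop} {l : α → List τ} {f : α → τ → List β} {B : α → ℕ}
    {bf : α × τ → ℕ} (b : α → τ → ℕ)
    (hf : InTime (fun q : α × τ => P q.1 ∧ q.2 ∈ l q.1) (fun q => f q.1 q.2) bf)
    (hl : InTime P l B) (hb : ∀ a x, P a → x ∈ l a → bf (a, x) ≤ b a x)
    (hlen : ∀ a x, P a → x ∈ l a → (f a x).length ≤ b a x)
    (A : ℕ) (hB : ∀ a, P a → ((l a).map fun x => b a x + 1).sum ≤ A * (B a + 1)) :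
    InTime P (fun a => (l a).flatMap (f a)) B := by
  have hlB : ∀ a, P a → (l a).length ≤ A * (B a + 1) := fun a ha => by
    refine le_trans ?_ (hB a ha)
    rw [← List.length_map (f := fun x => b a x + 1)]
    exact List.length_le_sum_of_one_le _ (by simp)
  refine (foldSum (l := fun a => (l a).reverse) (v := fun _ => [])
    (step := fun a w x => f a x ++ w) b
    (bs := fun q => b q.1 q.2.2) ?_ (hl.reverse A hlB) (const []) (by simp) A
    (fun a ha => ?_)).congr (fun a _ => ?_)
  · refine append (comp (g := fun q : α × τ => f q.1 q.2) (f := fun q : α × List β × τ => (q.1, q.2.2)) hf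
      (id.fst.pair id.snd.snd) 1 ?_ ?_) id.snd.fst 1 ?_
    · exact fun q h => ⟨h.1, by simpa using h.2⟩
    · exact fun q h => (hb _ _ h.1 (by simpa using h.2)).trans (by omega)
    · exact fun q h => (hlen _ _ h.1 (by simpa using h.2)).trans (by omega)
  · simpa using hB a ha
  · have : ∀ (l : List τ) (w : List β),
        l.reverse.foldl (fun w x => f a x ++ w) w = l.flatMap (f a) ++ w := by
      intro l; induction l <;> simp_all
    simp only [this, List.append_nil]

theorem map {P : α → Prop} {l : α → List τ} {f : α → τ → β} {B : α → ℕ}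
    {bf : α × τ → ℕ} (b : α → τ → ℕ)
    (hf : InTime (fun q : α × τ => P q.1 ∧ q.2 ∈ l q.1) (fun q => f q.1 q.2) bf)
    (hl : InTime P l B) (hb : ∀ a x, P a → x ∈ l a → bf (a, x) ≤ b a x)
    (A : ℕ) (hB : ∀ a, P a → ((l a).map fun x => b a x + 1).sum ≤ A * (B a + 1)) :
    InTime P (fun a => (l a).map (f a)) B :=
  (flatMap (f := fun a x => [f a x]) (bf := bf) (fun a x => b a x + 1) (hf.cons (const [])) hl
    (fun a x ha hx => (hb a x ha hx).trans (by omega)) (fun a x ha hx => by simp)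
    (2 * A) (fun a ha => by
      have h1 := hB a ha
      have h2 : ((l a).map fun x => b a x + 1 + 1).sum
          ≤ 2 * ((l a).map fun x => b a x + 1).sum := by
        rw [← List.sum_map_mul_left]
        exact List.sum_le_sum (fun x _ => by omega)
      nlinarith)).congr (fun a _ => by
      induction l a <;> simp_all)

theorem filter {P : α → Prop} {l : α → List τ} {f : α → τ → Bool} {B : α → ℕ}
    {bf : α × τ → ℕ} (b : α → τ → ℕ)
    (hf : InTime (fun q : α × τ => P q.1 ∧ q.2 ∈ l q.1) (fun q => f q.1 q.2) bf)
    (hl : InTime P l B) (hb : ∀ a x, P a → x ∈ l a → bf (a, x) ≤ b a x)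
    (A : ℕ) (hB : ∀ a, P a → ((l a).map fun x => b a x + 1).sum ≤ A * (B a + 1)) :
    InTime P (fun a => (l a).filter (f a)) B :=
  (flatMap (f := fun a x => if f a x then [x] else []) (bf := bf) (fun a x => b a x + 1)
    (hf.ite (id.snd.cons (const [])) (const [])) hl
    (fun a x ha hx => (hb a x ha hx).trans (by omega)) (fun a x ha hx => by split <;> simp)
    (2 * A) (fun a ha => by
      have h1 := hB a ha
      have h2 : ((l a).map fun x => b a x + 1 + 1).sum
          ≤ 2 * ((l a).map fun x => b a x + 1).sum := by
        rw [← List.sum_map_mul_left]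
        exact List.sum_le_sum (fun x _ => by omega)
      nlinarith)).congr (fun a _ => by
        induction l a with
        | nil => rfl
        | cons x xs ih => simp only [List.flatMap_cons, ih, List.filter_cons]; split <;> simp)

theorem all {P : α → Prop} {l : α → List τ} {f : α → τ → Bool} {B : α → ℕ}
    {bf : α × τ → ℕ} (b : α → τ → ℕ)
    (hf : InTime (fun q : α × τ => P q.1 ∧ q.2 ∈ l q.1) (fun q => f q.1 q.2) bf)
    (hl : InTime P l B) (hb : ∀ a x, P a → x ∈ l a → bf (a, x) ≤ b a x)
    (A : ℕ) (hB : ∀ a, P a → ((l a).map fun x => b a x + 1).sum ≤ A * (B a + 1)) :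
    InTime P (fun a => (l a).all (f a)) B :=
  (foldSum (v := fun _ => true) (step := fun a w x => w && f a x) (bs := fun q => bf (q.1, q.2.2))
    b (id.snd.fst.and (comp hf (id.fst.pair id.snd.snd) 1 (fun _ h => h)
      (fun _ _ => by omega))) hl (const _) (fun a x _ ha hx => hb a x ha hx) A hB).congr
    (fun a _ => by
      have : ∀ (l : List τ) w, l.foldl (fun w x => w && f a x) w = (w && l.all (f a)) := by
        intro l
        induction l with
        | nil => simp
        | cons x xs ih => intro w; simp only [List.foldl_cons, ih, List.all_cons, Bool.and_assoc]
      simp [this])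

theorem zip {P : α → Prop} {l : α → List τ} {m : α → List β} {B : α → ℕ} (hl : InTime P l B)
    (hm : InTime P m B) (A : ℕ) (hB : ∀ a, P a → (l a).length ≤ A * (B a + 1)) :
    InTime P (fun a => (l a).zip (m a)) B := by
  let step : α → List β × List (τ × β) → τ → List β × List (τ × β) := fun _ w x =>
    match w.1 with
    | [] => w
    | y :: ys => (ys, (x, y) :: w.2)
  have hfold : ∀ (a : α) (l : List τ) (m : List β) (o : List (τ × β)),
      (l.foldl (step a) (m, o)).2 = (l.zip m).reverse ++ o := by
    intro a l
    induction l with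
    | nil => simp
    | cons x xs ih =>
      intro m o
      cases m with
      | nil =>
        simp only [List.foldl_cons, step, ih]
        simp
      | cons y ys => simp [List.foldl_cons, step, ih]
  have key : InTime P (fun a => ((l a).foldl (step a) (m a, [])).2) B := by
    refine (foldSum (fun _ _ => 0) (bs := fun _ => 0) ?_ hl (hm.pair (const []))
      (by simp) A (by simpa using hB)).snd
    refine listCase (l := fun q : α × (List β × List (τ × β)) × τ => q.2.1.1)
      (f := fun q => q.2.1) (g := fun q y ys => (ys, (q.2.2, y) :: q.2.1.2)) (B' := fun _ => 0)
      id.snd.fst.fst id.snd.fst ?_ 0 (by simp) ?_ ?_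
    · exact id.snd.snd.pair ((id.fst.snd.snd.pair id.snd.fst).cons id.fst.snd.fst.snd)
    · intro q _ h; simp only [step, h]
    · intro q y ys _ h; simp only [step, h]
  refine (key.reverse A (fun a ha => ?_)).congr (fun a _ => ?_)
  · rw [hfold a]; simpa using Or.inl (hB a ha)
  · rw [hfold a]; simp

theorem zipWith {P : α → Prop} {l : α → List τ} {m : α → List β} {f : α → τ → β → γ} {B : α → ℕ}
    {bf : α × τ × β → ℕ} (b : α → τ → ℕ)
    (hf : InTime (fun q : α × τ × β => P q.1 ∧ q.2.1 ∈ l q.1 ∧ q.2.2 ∈ m q.1)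
      (fun q => f q.1 q.2.1 q.2.2) bf)
    (hl : InTime P l B) (hm : InTime P m B)
    (hb : ∀ a x y, P a → x ∈ l a → y ∈ m a → bf (a, x, y) ≤ b a x)
    (A : ℕ) (hB : ∀ a, P a → ((l a).map fun x => b a x + 1).sum ≤ A * (B a + 1)) :
    InTime P (fun a => (l a).zipWith (f a) (m a)) B := by
  have hlB : ∀ a, P a → (l a).length ≤ A * (B a + 1) := fun a ha => by
    refine le_trans ?_ (hB a ha)
    rw [← List.length_map (f := fun x => b a x + 1)]
    exact List.length_le_sum_of_one_le _ (by simp)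
  refine (map (l := fun a => (l a).zip (m a)) (f := fun a x => f a x.1 x.2) (bf := bf)
    (fun a x => b a x.1) (hf.weaken ?_) (zip hl hm A hlB) ?_ A ?_).congr (fun a _ => ?_)
  · rintro ⟨a, x, y⟩ ⟨h1, h2⟩
    exact ⟨h1, (List.of_mem_zip h2).1, (List.of_mem_zip h2).2⟩
  · rintro a ⟨x, y⟩ ha h
    exact hb a x y ha (List.of_mem_zip h).1 (List.of_mem_zip h).2
  · intro a ha
    refine le_trans ?_ (hB a ha)
    generalize m a = m'
    induction l a generalizing m' with
    | nil => simp
    | cons x xs ih => cases m' <;> simp_all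
  · rw [List.zip, List.map_zipWith]

/-- Taking as many elements as a template has. -/
theorem take {P : α → Prop} {l : α → List τ} {m : α → List β} {B : α → ℕ} (hl : InTime P l B)
    (hm : InTime P m B) (A : ℕ) (hB : ∀ a, P a → (m a).length ≤ A * (B a + 1)) :
    InTime P (fun a => (l a).take (m a).length) B :=
  (zipWith (f := fun _ _ y => y) (bf := fun _ => 0) (fun _ _ => 0) id.snd.snd hm hl
    (by simp) A (by simpa using hB)).congr (fun a _ => by
      generalize m a = m'
      induction l a generalizing m' with
      | nil => simp
      | cons x xs ih => cases m' <;> simp_all)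

/-- Dropping as many elements as a template has. -/
theorem drop {P : α → Prop} {l : α → List τ} {m : α → List β} {B : α → ℕ} (hl : InTime P l B)
    (hm : InTime P m B) (A : ℕ) (hB : ∀ a, P a → (m a).length ≤ A * (B a + 1)) :
    InTime P (fun a => (l a).drop (m a).length) B :=
  (foldSum (step := fun _ w _ => w.tail) (bs := fun _ => 0) (fun _ _ => 0) id.snd.fst.tail hm hl
    (by simp) A (by simpa using hB)).congr (fun a _ => by
      generalize l a = l'
      induction m a generalizing l' with
      | nil => simp
      | cons x xs ih => simp [ih])

end InTime

/-! ### Field arithmetic on bit strings -/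

/-- The sum of two field elements given by bit strings. -/
def xorBits (a b : List Bool) : List Bool := List.zipWith Bool.xor a b

/-- Multiplication by `X` modulo `X ^ ℓ + f₀`, where `fl` has the coefficients of `f₀`. -/
def mulX (fl a : List Bool) : List Bool :=
  if a.headD false then xorBits (a.tail ++ [false]) fl else a.tail ++ [false]

/-- The product of two field elements given by bit strings (Horner's scheme). -/
def mulBits (fl a b : List Bool) : List Bool :=
  a.foldl (fun v x => if x then xorBits (mulX fl v) b else mulX fl v) (fl.map fun _ => false)

@[simp] theorem length_xorBits (a b : List Bool) :
    (xorBits a b).length = min a.length b.length := by simp [xorBits]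

theorem length_mulX {fl a : List Bool} (h : a.length = fl.length) (h0 : fl ≠ []) :
    (mulX fl a).length = fl.length := by
  have : 0 < fl.length := List.length_pos_iff.2 h0
  unfold mulX; split <;> simp <;> omega

theorem length_mulBits_step {fl v b : List Bool} {x : Bool} (hv : v.length = fl.length)
    (hb : b.length = fl.length) (h0 : fl ≠ []) :
    (if x then xorBits (mulX fl v) b else mulX fl v).length = fl.length := by
  split <;> simp [length_mulX hv h0, hb]

theorem length_mulBits {fl a b : List Bool} (hb : b.length = fl.length) (h0 : fl ≠ []) :
    (mulBits fl a b).length = fl.length := by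
  unfold mulBits
  generalize hv : (fl.map fun _ => false) = v
  replace hv : v.length = fl.length := by simp [← hv]
  induction a generalizing v with
  | nil => simpa
  | cons x xs ih => exact ih _ (length_mulBits_step hv hb h0)

theorem InTime.xorBits {α : Type} [Enc α] {P : α → Prop} {f g : α → List Bool} {B : α → ℕ}
    (hf : InTime P f B) (hg : InTime P g B) (A : ℕ)
    (hB : ∀ a, P a → (f a).length ≤ A * (B a + 1)) :
    InTime P (fun a => xorBits (f a) (g a)) B :=
  InTime.zipWith (f := fun _ x y => Bool.xor x y) (bf := fun _ => 0) (fun _ _ => 0)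
    (InTime.id.snd.fst.xor InTime.id.snd.snd) hf hg (by simp) A (by simpa using hB)

theorem InTime.mulX : InTime (fun q : List Bool × List Bool => q.2.length = q.1.length)
    (fun q => mulX q.1 q.2) (fun q => q.1.length) := by
  have h : InTime (fun q : List Bool × List Bool => q.2.length = q.1.length)
      (fun q => q.2.tail ++ [false]) (fun q => q.1.length) :=
    InTime.id.snd.tail.append (.const _) 1 (fun a h => by simp [h]; omega)
  refine (InTime.id.snd.headD rfl).ite ?_ (h.weaken fun _ h => h.1)
  exact (h.weaken fun _ h => h.1).xorBits InTime.id.fst 2 (fun a h => by simp [h.1]; omega)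

theorem InTime.mulBits :
    InTime (fun q : List Bool × List Bool × List Bool => q.1 ≠ [] ∧ q.2.1.length ≤ q.1.length ∧
      q.2.2.length = q.1.length) (fun q => mulBits q.1 q.2.1 q.2.2) (fun q => q.1.length ^ 2) := by
  have hsq : ∀ l : List Bool, l.length ≤ l.length ^ 2 := fun l => by nlinarith [sq_nonneg l.length]
  refine InTime.foldl' (fun q v => v.length = q.1.length) (fun q => q.1.length)
    (bs := fun q => q.1.1.length) ?_ InTime.id.snd.fst ?_ (by simp) ?_ (by simp) 2 ?_
  · have h : InTime (fun q : (List Bool × List Bool × List Bool) × List Bool × Bool =>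
        (q.1.1 ≠ [] ∧ q.1.2.1.length ≤ q.1.1.length ∧ q.1.2.2.length = q.1.1.length) ∧
        q.2.1.length = q.1.1.length ∧ q.2.2 ∈ q.1.2.1) (fun q => _root_.mulX q.1.1 q.2.1)
        (fun q => q.1.1.length) :=
      InTime.mulX.app₂ InTime.id.fst.fst InTime.id.snd.fst 1 (fun _ h => h.2.1)
        (fun _ _ => by simp only; omega)
    refine InTime.id.snd.snd.ite ?_ (h.weaken fun _ h => h.1)
    exact (h.weaken fun _ h => h.1).xorBits InTime.id.fst.snd.snd 1
      (fun a h => by rw [length_mulX h.1.2.1 h.1.1.1]; omega)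
  · exact InTime.map (fun _ _ => 0) (bf := fun _ => 0) (.const _) InTime.id.fst (by simp) 1
      (fun a _ => by simp only [zero_add, List.map_const', List.sum_replicate, smul_eq_mul]
                     have := hsq a.1; omega)
  · exact fun q x v h hv _ => length_mulBits_step hv h.2.2 h.1
  · intro q h
    have := Nat.mul_le_mul_right (q.1.length + 1) h.2.1
    nlinarith [hsq q.1]

/-! ### Bit strings as elements of the field -/

section
variable {c ℓ : ℕ} (𝒞 : GCCode c ℓ)
namespace GCCode

/-- The coefficients of `f` apart from the leading one, most significant bit first. -/
noncomputable def lowCoeffs : List Bool :=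
  List.ofFn fun i : Fin ℓ => decide (𝒞.f.coeff (ℓ - 1 - (i : ℕ)) = 1)

@[simp] theorem length_lowCoeffs : 𝒞.lowCoeffs.length = ℓ := by simp [lowCoeffs]

@[simp] theorem length_bits (a : AdjoinRoot 𝒞.f) : (𝒞.bits a).length = ℓ := by simp [bits]

theorem ℓ_pos (𝒞 : GCCode c ℓ) : 0 < ℓ := by
  rw [← 𝒞.natDegree_eq]; exact 𝒞.irreducible.natDegree_pos

theorem zmod_two_eq (x : ZMod 2) : x = if x = 1 then 1 else 0 := by
  revert x; decide

/-- The polynomial of a block. -/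
noncomputable def toPoly (ℓ : ℕ) (b : List Bool) : (ZMod 2)[X] :=
  ∑ i : Fin ℓ, if b.getD i false then X ^ (ℓ - 1 - (i : ℕ)) else 0

theorem symbol_eq_mk (b : List Bool) : 𝒞.symbol b = AdjoinRoot.mk 𝒞.f (toPoly ℓ b) := by
  simp only [symbol, toPoly, map_sum]
  refine Finset.sum_congr rfl fun i _ => ?_
  split <;> simp

theorem coeff_toPoly {b : List Bool} (i : Fin ℓ) :
    (toPoly ℓ b).coeff (ℓ - 1 - (i : ℕ)) = if b.getD i false then 1 else 0 := by
  simp only [toPoly, finsetSum_coeff]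
  rw [Finset.sum_eq_single i]
  · split <;> simp
  · intro j _ hj
    have : ℓ - 1 - (i : ℕ) ≠ ℓ - 1 - (j : ℕ) := by
      intro h; apply hj; ext; have := i.2; have := j.2; omega
    split <;> simp [coeff_X_pow, this]
  · simp

theorem degree_toPoly_lt (b : List Bool) : (toPoly ℓ b).degree < ℓ := by
  refine (degree_sum_le _ _).trans_lt ?_
  rw [Finset.sup_lt_iff (by exact WithBot.bot_lt_coe ℓ)]
  intro i _
  have := i.2
  split
  · rw [degree_X_pow]; norm_cast; omega
  · simp

theorem degree_eq : 𝒞.f.degree = ℓ := by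
  rw [degree_eq_natDegree 𝒞.monic.ne_zero, 𝒞.natDegree_eq]

theorem modByMonicHom_symbol (b : List Bool) :
    AdjoinRoot.modByMonicHom 𝒞.monic (𝒞.symbol b) = toPoly ℓ b := by
  rw [symbol_eq_mk, AdjoinRoot.modByMonicHom_mk, modByMonic_eq_self_iff 𝒞.monic, degree_eq]
  exact degree_toPoly_lt b

theorem bits_symbol_getD (b : List Bool) :
    𝒞.bits (𝒞.symbol b) = List.ofFn fun i : Fin ℓ => b.getD i false := by
  simp only [bits, modByMonicHom_symbol, coeff_toPoly]
  congr 1; ext i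
  split <;> simp_all

theorem bits_symbol {b : List Bool} (hb : b.length = ℓ) : 𝒞.bits (𝒞.symbol b) = b := by
  rw [bits_symbol_getD]
  apply List.ext_getElem (by simp [hb])
  intro i h1 h2
  simp [h2]

theorem bits_symbol_of_le {b : List Bool} (hb : b.length ≤ ℓ) :
    𝒞.bits (𝒞.symbol b) = b ++ List.replicate (ℓ - b.length) false := by
  rw [bits_symbol_getD]
  apply List.ext_getElem (by simp; omega)
  intro i h1 h2
  by_cases hi : i < b.length <;> simp [hi, List.getElem_append]

theorem symbol_bits (a : AdjoinRoot 𝒞.f) : 𝒞.symbol (𝒞.bits a) = a := by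
  conv_rhs => rw [← AdjoinRoot.mk_leftInverse 𝒞.monic a]
  rw [symbol_eq_mk]
  congr 1
  set g := AdjoinRoot.modByMonicHom 𝒞.monic a with hg
  have hdeg : g.degree < ℓ := by
    obtain ⟨p, rfl⟩ := AdjoinRoot.mk_surjective a
    rw [hg, AdjoinRoot.modByMonicHom_mk, ← 𝒞.degree_eq]
    exact degree_modByMonic_lt _ 𝒞.monic
  ext n
  by_cases hn : n < ℓ
  · have h := coeff_toPoly (b := 𝒞.bits a) (⟨ℓ - 1 - n, by omega⟩ : Fin ℓ)
    have h2 : ℓ - 1 - (ℓ - 1 - n) = n := by omega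
    simp only [h2] at h
    rw [h, zmod_two_eq (g.coeff n)]
    have h3 : ℓ - 1 - n < ℓ := by omega
    simp [bits, h3, h2, ← hg]
  · rw [coeff_eq_zero_of_degree_lt, coeff_eq_zero_of_degree_lt]
    · exact hdeg.trans_le (by exact_mod_cast not_lt.1 hn)
    · exact (degree_toPoly_lt _).trans_le (by exact_mod_cast not_lt.1 hn)

theorem bits_injective : Function.Injective 𝒞.bits :=
  Function.LeftInverse.injective 𝒞.symbol_bits

theorem symbol_inj {a b : List Bool} (ha : a.length = ℓ) (hb : b.length = ℓ)
    (h : 𝒞.symbol a = 𝒞.symbol b) : a = b := by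
  rw [← 𝒞.bits_symbol ha, h, 𝒞.bits_symbol hb]

theorem symbol_append_zeros (b : List Bool) (n : ℕ) :
    𝒞.symbol (b ++ List.replicate n false) = 𝒞.symbol b := by
  refine Finset.sum_congr rfl fun i _ => ?_
  congr 2
  simp only [List.getD_eq_getElem?_getD, List.getElem?_append]
  split
  · rfl
  · rename_i h
    rw [List.getElem?_eq_none (not_lt.1 h), List.getElem?_replicate]
    split <;> rfl

instance : CharP (AdjoinRoot 𝒞.f) 2 := by
  have : Fact (Irreducible 𝒞.f) := ⟨𝒞.irreducible⟩
  exact charP_of_injective_algebraMap (algebraMap (ZMod 2) (AdjoinRoot 𝒞.f)).injective 2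

/-- Addition is coefficientwise modulo 2. Equal lengths are required because `zipWith` truncates to
the shorter string. -/
theorem symbol_xorBits {a b : List Bool} (hab : a.length = b.length) :
    𝒞.symbol (xorBits a b) = 𝒞.symbol a + 𝒞.symbol b := by
  simp only [symbol, ← Finset.sum_add_distrib]
  refine Finset.sum_congr rfl fun i _ => ?_
  by_cases hi : (i : ℕ) < a.length
  · have hi' : (i : ℕ) < b.length := hab ▸ hi
    simp only [xorBits, List.getD_eq_getElem?_getD, List.getElem?_zipWith,
      List.getElem?_eq_getElem hi, List.getElem?_eq_getElem hi', Option.getD_some]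
    cases a[(i : ℕ)] <;> cases b[(i : ℕ)] <;> simp [CharTwo.add_self_eq_zero]
  · have hi' : ¬ (i : ℕ) < b.length := hab ▸ hi
    simp [xorBits, List.getD_eq_getElem?_getD, List.getElem?_zipWith,
      List.getElem?_eq_none (not_lt.1 hi), List.getElem?_eq_none (not_lt.1 hi')]

theorem symbol_cons {b : Bool} {l : List Bool} (hl : l.length + 1 = ℓ) :
    𝒞.symbol (b :: l) = (if b then AdjoinRoot.root 𝒞.f ^ (ℓ - 1) else 0) +
      𝒞.symbol (false :: l) := by
  obtain ⟨m, rfl⟩ : ∃ m, ℓ = m + 1 := ⟨_, hl.symm⟩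
  simp [symbol, Fin.sum_univ_succ]

theorem symbol_tail_append {l : List Bool} (hl : l.length + 1 = ℓ) :
    𝒞.symbol (l ++ [false]) = AdjoinRoot.root 𝒞.f * 𝒞.symbol (false :: l) := by
  rw [show l ++ [false] = l ++ List.replicate 1 false from rfl, symbol_append_zeros]
  obtain ⟨m, rfl⟩ : ∃ m, ℓ = m + 1 := ⟨_, hl.symm⟩
  obtain rfl : l.length = m := by omega
  rw [symbol, Fin.sum_univ_castSucc]
  simp only [symbol, Fin.sum_univ_succ, mul_add, Finset.mul_sum]
  rw [List.getD_eq_default _ _ (by simp)]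
  simp only [Fin.val_castSucc, Bool.false_eq_true, if_false, add_zero, Fin.val_zero,
    List.getD_cons_zero, mul_zero, zero_add, Fin.val_succ, List.getD_cons_succ, mul_ite]
  refine Finset.sum_congr rfl fun i _ => ?_
  have := i.2
  rw [← pow_succ']
  congr 2; omega

/-- The root annihilates `f`, and in characteristic 2 the lower terms change sides without a sign.
This is the reduction that `mulX` performs when the leading bit is shifted out. -/
theorem symbol_lowCoeffs : 𝒞.symbol 𝒞.lowCoeffs = AdjoinRoot.root 𝒞.f ^ ℓ := by
  have h : toPoly ℓ 𝒞.lowCoeffs + X ^ ℓ = 𝒞.f := by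
    ext n
    rcases lt_trichotomy n ℓ with hn | rfl | hn
    · have h := coeff_toPoly (b := 𝒞.lowCoeffs) (⟨ℓ - 1 - n, by omega⟩ : Fin ℓ)
      have h2 : ℓ - 1 - (ℓ - 1 - n) = n := by omega
      simp only [h2] at h
      have h3 : ℓ - 1 - n < ℓ := by omega
      rw [coeff_add, h, zmod_two_eq (𝒞.f.coeff n)]
      simp [lowCoeffs, h3, h2, coeff_X_pow, hn.ne]
    · rw [coeff_add, coeff_eq_zero_of_degree_lt (degree_toPoly_lt _)]
      have := 𝒞.monic.coeff_natDegree
      rw [𝒞.natDegree_eq] at this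
      simp [this]
    · rw [coeff_add, coeff_eq_zero_of_degree_lt
        ((degree_toPoly_lt _).trans (by exact_mod_cast hn)), coeff_eq_zero_of_degree_lt
        (p := 𝒞.f) (by rw [degree_eq]; exact_mod_cast hn)]
      simp [coeff_X_pow, hn.ne']
  have h2 : AdjoinRoot.mk 𝒞.f (toPoly ℓ 𝒞.lowCoeffs + X ^ ℓ) = 0 := by
    rw [h]; exact AdjoinRoot.mk_self
  rw [map_add, ← symbol_eq_mk, CharTwo.add_eq_zero] at h2
  simpa using h2

theorem symbol_mulX {a : List Bool} (ha : a.length = ℓ) :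
    𝒞.symbol (mulX 𝒞.lowCoeffs a) = 𝒞.symbol a * AdjoinRoot.root 𝒞.f := by
  cases a with
  | nil => have := 𝒞.ℓ_pos; simp at ha; omega
  | cons b l =>
    have hl : l.length + 1 = ℓ := by simpa using ha
    rw [𝒞.symbol_cons hl, add_mul, mul_comm (𝒞.symbol _), ← symbol_tail_append 𝒞 hl]
    cases b
    · simp [mulX]
    · simp only [mulX, List.headD_cons, if_true, List.tail_cons]
      rw [symbol_xorBits _ (by simp [hl]), symbol_lowCoeffs, ← pow_succ, Nat.sub_add_cancel 𝒞.ℓ_pos,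
        add_comm]

theorem symbol_zeros (n : ℕ) : 𝒞.symbol (List.replicate n false) = 0 := by
  have := 𝒞.symbol_append_zeros [] n
  rw [List.nil_append] at this
  rw [this]; simp [symbol]

theorem symbol_eq_foldl {a : List Bool} (ha : a.length = ℓ) : 𝒞.symbol a =
    a.foldl (fun v b => v * AdjoinRoot.root 𝒞.f + if b then 1 else 0) 0 := by
  have key : ∀ (l : List Bool) (v : AdjoinRoot 𝒞.f),
      l.foldl (fun v b => v * AdjoinRoot.root 𝒞.f + if b then 1 else 0) v =
        v * AdjoinRoot.root 𝒞.f ^ l.length +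
        ∑ i : Fin l.length, if l.getD i false then AdjoinRoot.root 𝒞.f ^ (l.length - 1 - (i : ℕ)) else 0 := by
    intro l
    induction l with
    | nil => simp
    | cons b l ih =>
      intro v
      simp only [List.foldl_cons, ih, List.length_cons, Fin.sum_univ_succ]
      simp only [Fin.val_zero, List.getD_cons_zero, Fin.val_succ, List.getD_cons_succ]
      have : ∀ i : Fin l.length, l.length + 1 - 1 - ((i : ℕ) + 1) = l.length - 1 - i := by
        intro i; omega
      simp only [this]
      cases b <;> simp <;> ring
  rw [key]
  subst ha
  simp [symbol]

theorem symbol_mulBits {a b : List Bool} (ha : a.length = ℓ) (hb : b.length = ℓ) :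
    𝒞.symbol (mulBits 𝒞.lowCoeffs a b) = 𝒞.symbol a * 𝒞.symbol b := by
  have h0 : 𝒞.lowCoeffs ≠ [] := by
    rw [← List.length_pos_iff]; simpa using 𝒞.ℓ_pos
  have key : ∀ (l : List Bool) (v : List Bool) (w : AdjoinRoot 𝒞.f), v.length = ℓ →
      𝒞.symbol v = w * 𝒞.symbol b →
      𝒞.symbol (l.foldl (fun v x => if x then xorBits (mulX 𝒞.lowCoeffs v) b
        else mulX 𝒞.lowCoeffs v) v) =
      l.foldl (fun v b => v * AdjoinRoot.root 𝒞.f + if b then 1 else 0) w * 𝒞.symbol b := by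
    intro l
    induction l with
    | nil => intro v w _ h; simpa using h
    | cons x l ih =>
      intro v w hv hw
      simp only [List.foldl_cons]
      apply ih
      · simpa using length_mulBits_step (fl := 𝒞.lowCoeffs) (x := x) (by simpa using hv)
          (by simpa using hb) h0
      · cases x
        · simp only [Bool.false_eq_true, if_false, add_zero]
          rw [symbol_mulX _ hv, hw]; ring
        · simp only [if_true]
          rw [symbol_xorBits _ (by rw [length_mulX (by simpa using hv) h0]; simpa using hb.symm),
            symbol_mulX _ hv, hw]; ring
  rw [mulBits, key _ _ 0 (by simp), ← symbol_eq_foldl _ ha]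
  rw [List.map_const', symbol_zeros, zero_mul]

end GCCode
end

/-! ### The deletion channel and the repeated parity bits -/

/-- `deletePositions` for a string that starts at position `i`. -/
def deleteFrom (S : Finset ℕ) (i : ℕ) (x : List Bool) : List Bool :=
  ((x.zipIdx i).filter fun b => b.2 ∉ S).map Prod.fst

theorem deleteFrom_append (S : Finset ℕ) (i : ℕ) (x y : List Bool) :
    deleteFrom S i (x ++ y) = deleteFrom S i x ++ deleteFrom S (i + x.length) y := by
  simp [deleteFrom, List.zipIdx_append]

theorem deleteFrom_cons (S : Finset ℕ) (i : ℕ) (b : Bool) (x : List Bool) :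
    deleteFrom S i (b :: x) = (if i ∈ S then [] else [b]) ++ deleteFrom S (i + 1) x := by
  by_cases h : i ∈ S <;> simp [deleteFrom, h]

theorem deleteFrom_replicate (S : Finset ℕ) (n i : ℕ) (b : Bool) :
    ∃ r ≤ n, n ≤ r + #{j ∈ S | i ≤ j ∧ j < i + n} ∧
      deleteFrom S i (List.replicate n b) = List.replicate r b := by
  induction n generalizing i with
  | zero => exact ⟨0, le_rfl, by simp, by simp [deleteFrom]⟩
  | succ n ih =>
    obtain ⟨r, h1, h2, h3⟩ := ih (i + 1)
    rw [List.replicate_succ, deleteFrom_cons, h3]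
    by_cases hi : i ∈ S
    · refine ⟨r, by omega, ?_, by simp [hi]⟩
      have : #{j ∈ S | i + 1 ≤ j ∧ j < i + 1 + n} < #{j ∈ S | i ≤ j ∧ j < i + (n + 1)} := by
        apply Finset.card_lt_card
        rw [Finset.ssubset_iff_of_subset (fun j => by grind)]
        exact ⟨i, by simp [hi], by simp⟩
      omega
    · refine ⟨r + 1, by omega, ?_, by simp [hi, List.replicate_succ]⟩
      have : #{j ∈ S | i + 1 ≤ j ∧ j < i + 1 + n} ≤ #{j ∈ S | i ≤ j ∧ j < i + (n + 1)} :=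
        Finset.card_le_card (fun j => by grind)
      omega

/-- Deletions shorten each run of `m` equal bits, and different runs are hit by disjoint sets of
positions, so the shortfalls add up to at most the number of deletions. Neighbouring runs of the
same bit merge in the string; the runs are therefore recorded as data. -/
theorem deleteFrom_flatMap_replicate (S : Finset ℕ) (m i : ℕ) (bs : List Bool) :
    ∃ runs : List (Bool × ℕ), runs.map Prod.fst = bs ∧ (∀ r ∈ runs, r.2 ≤ m) ∧
      (runs.map fun r => m - r.2).sum ≤ #{j ∈ S | i ≤ j} ∧
      deleteFrom S i (bs.flatMap (List.replicate m)) =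
        runs.flatMap fun r => List.replicate r.2 r.1 := by
  induction bs generalizing i with
  | nil => exact ⟨[], by simp [deleteFrom]⟩
  | cons b bs ih =>
    obtain ⟨runs, h1, h2, h3, h4⟩ := ih (i + m)
    obtain ⟨r, k1, k2, k3⟩ := deleteFrom_replicate S m i b
    refine ⟨(b, r) :: runs, by simp [h1], List.forall_mem_cons.2 ⟨k1, h2⟩, ?_, ?_⟩
    · have : #{j ∈ S | i ≤ j ∧ j < i + m} + #{j ∈ S | i + m ≤ j} ≤ #{j ∈ S | i ≤ j} := by
        rw [← Finset.card_union_of_disjoint]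
        · exact Finset.card_le_card (fun j => by grind)
        · rw [Finset.disjoint_filter]; intros; omega
      simp only [List.map_cons, List.sum_cons]
      omega
    · rw [List.flatMap_cons, deleteFrom_append, k3, List.length_replicate, h4, List.flatMap_cons]

theorem takeWhile_replicate_append (b : Bool) (n : ℕ) (w : List Bool) :
    (List.replicate n b ++ w).takeWhile (· == b) =
      List.replicate n b ++ w.takeWhile (· == b) := by
  induction n with
  | zero => simp
  | succ n ih => simp [List.replicate_succ, ih]

/-- Reading repeated bits with few missing repetitions. -/
theorem readParity_runs (δ : ℕ) (runs : List (Bool × ℕ)) (w : List Bool) (e : ℕ)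
    (hle : ∀ r ∈ runs, r.2 ≤ δ + 1)
    (hsum : e + (runs.map fun r => δ + 1 - r.2).sum ≤ δ) :
    ∃ e' ≤ e + (runs.map fun r => δ + 1 - r.2).sum,
      readParity δ runs.length (((runs.flatMap fun r => List.replicate r.2 r.1) ++ w).drop e) =
        ((runs.map Prod.fst).reverse, w.drop e') := by
  induction runs generalizing e with
  | nil => exact ⟨e, by simp [readParity]⟩
  | cons r runs ih =>
    obtain ⟨b, r⟩ := r
    have hr : r ≤ δ + 1 := hle (b, r) (by simp)
    simp only [List.map_cons, List.sum_cons] at hsum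
    -- The bound `hsum` gives `e < r`: the excess reading so far does not use up this run, so its
    -- bit is still the next one to be seen.
    obtain ⟨m, hm⟩ : ∃ m, r = e + m + 1 := ⟨r - e - 1, by omega⟩
    set rest := (runs.flatMap fun r => List.replicate r.2 r.1) ++ w with hrest
    have h1 : ((((b, r) :: runs).flatMap fun r => List.replicate r.2 r.1) ++ w).drop e =
        b :: (List.replicate m b ++ rest) := by
      rw [List.flatMap_cons, List.append_assoc, ← hrest, hm, add_assoc, List.replicate_add,
        List.append_assoc, List.drop_append]
      simp [List.replicate_succ]
    rw [h1, List.length_cons, readParity, takeWhile_replicate_append]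
    simp only [List.length_append, List.length_replicate]
    set t := (rest.takeWhile (· == b)).length
    have h2 : (List.replicate m b ++ rest).drop (min δ (m + t)) =
        rest.drop (min δ (m + t) - m) := by
      rw [List.drop_append, List.drop_eq_nil_of_le (by simp; omega)]
      simp
    rw [h2]
    -- The new excess is at most `δ - m = e + (δ + 1 - r)`, the old one plus the shortfall of this
    -- run.
    obtain ⟨e', he', h⟩ := ih (min δ (m + t) - m) (fun r hr => hle r (by simp [hr])) (by omega)
    refine ⟨e', ?_, ?_⟩
    · simp only [List.map_cons, List.sum_cons]; omega
    · rw [h]; simp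

/-- The message positions that survive when the positions in `D` and then the last `e` positions
are deleted. -/
def kept {n k : ℕ} (D : Finset (Fin n)) (e : ℕ) : List (Fin k) :=
  let l := (List.finRange k).filter fun i => i.val ∉ D.map Fin.valEmbedding
  l.take (l.length - e)

theorem kept_sublist {n k : ℕ} (D : Finset (Fin n)) (e : ℕ) :
    (kept D e : List (Fin k)).Sublist (List.finRange k) :=
  (List.take_sublist _ _).trans List.filter_sublist

theorem deleteFrom_ofFn {k : ℕ} (S : Finset ℕ) (u : Fin k → Bool) :
    deleteFrom S 0 (List.ofFn u) = ((List.finRange k).filter fun i => i.val ∉ S).map u := by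
  have : (List.ofFn u).zipIdx = (List.finRange k).map fun i => (u i, (i : ℕ)) := by
    apply List.ext_getElem <;> simp
  rw [deleteFrom, this, List.filter_map, List.map_map]
  rfl

/-! ### Recovering the parities, and the MDS property -/

section
variable {c ℓ : ℕ} (𝒞 : GCCode c ℓ)
namespace GCCode

/-- The parity bits of a message. -/
noncomputable def parityBits (u : Fin (2 ^ ℓ) → Bool) : List Bool :=
  (List.ofFn (𝒞.parity (𝒞.symbols u))).flatMap 𝒞.bits

theorem length_flatMap_bits (L : List (AdjoinRoot 𝒞.f)) :
    (L.flatMap 𝒞.bits).length = L.length * ℓ := by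
  simp [List.length_flatMap]

@[simp] theorem length_parityBits (u : Fin (2 ^ ℓ) → Bool) :
    (𝒞.parityBits u).length = c * ℓ := by
  rw [parityBits, length_flatMap_bits, List.length_ofFn]

theorem encode_eq (δ : ℕ) (u : Fin (2 ^ ℓ) → Bool) : 𝒞.encode δ u =
    List.ofFn u ++ (𝒞.parityBits u).flatMap (List.replicate (δ + 1)) := rfl

theorem length_encode (δ : ℕ) (u : Fin (2 ^ ℓ) → Bool) :
    (𝒞.encode δ u).length = gcLength δ c ℓ := by
  rw [encode_eq, List.length_append, List.length_flatMap]
  simp [gcLength]; ring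

/-- The parity bits are read correctly, and the rest of the received word is what is left of the
message after the deletion of further bits at the end. -/
theorem readParity_received {δ : ℕ} (u : Fin (2 ^ ℓ) → Bool) (D : Finset (Fin (gcLength δ c ℓ)))
    (hD : #D ≤ δ) : ∃ e ≤ δ, 2 ^ ℓ ≤ (kept D e : List (Fin (2 ^ ℓ))).length + δ ∧
      readParity δ (c * ℓ) (𝒞.received δ u D).reverse =
        (𝒞.parityBits u, ((kept D e).map u).reverse) := by
  set S := D.map Fin.valEmbedding with hS
  have hSc : #S = #D := Finset.card_map _
  obtain ⟨runs, h1, h2, h3, h4⟩ :=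
    deleteFrom_flatMap_replicate S (δ + 1) (2 ^ ℓ) (𝒞.parityBits u)
  set l := (List.finRange (2 ^ ℓ)).filter fun i => i.val ∉ S with hl
  have hsplit : #{j ∈ S | j < 2 ^ ℓ} + #{j ∈ S | 2 ^ ℓ ≤ j} = #S := by
    rw [← Finset.card_filter_add_card_filter_not (s := S) (p := fun j => j < 2 ^ ℓ)]
    simp
  have hlen : 2 ^ ℓ ≤ l.length + #{j ∈ S | j < 2 ^ ℓ} := by
    have h := List.length_eq_length_filter_add (l := List.finRange (2 ^ ℓ))
      (fun i => decide ((i : ℕ) ∉ S))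
    rw [List.length_finRange, ← hl] at h
    have h' : (List.filter (fun i : Fin (2 ^ ℓ) => !decide ((i : ℕ) ∉ S))
        (List.finRange (2 ^ ℓ))).length ≤ #{j ∈ S | j < 2 ^ ℓ} := by
      rw [← List.toFinset_card_of_nodup ((List.nodup_finRange _).filter _)]
      rw [← Finset.card_map Fin.valEmbedding]
      apply Finset.card_le_card
      intro j
      simp only [Finset.mem_map, List.mem_toFinset, List.mem_filter, Finset.mem_filter]
      rintro ⟨i, hi, rfl⟩
      exact ⟨by simpa using hi.2, i.2⟩
    omega
  have hrec : 𝒞.received δ u D = l.map u ++ runs.flatMap fun r => List.replicate r.2 r.1 := by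
    have : 𝒞.received δ u D = deleteFrom S 0 (𝒞.encode δ u) := rfl
    rw [this, encode_eq, deleteFrom_append, deleteFrom_ofFn, List.length_ofFn, zero_add, h4]
  have hrev : (𝒞.received δ u D).reverse =
      (runs.reverse.flatMap fun r => List.replicate r.2 r.1) ++ (l.map u).reverse := by
    rw [hrec, List.reverse_append, List.reverse_flatMap]
    simp [Function.comp_def]
  obtain ⟨e, he, h⟩ := readParity_runs δ runs.reverse (l.map u).reverse 0
    (fun r hr => h2 r (by simpa using hr)) (by rw [List.map_reverse, List.sum_reverse]; omega)
  rw [List.map_reverse, List.sum_reverse] at he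
  have hrl : runs.reverse.length = c * ℓ := by
    rw [← 𝒞.length_parityBits u, ← h1]; simp
  -- The excess `e` is at most the number of deletions among the parity bits. Together with the
  -- deletions among the message bits, this accounts for at most `#D ≤ δ` missing bits.
  refine ⟨e, by omega, ?_, ?_⟩
  · simp only [kept, ← hS, ← hl, List.length_take]; omega
  · rw [hrev, ← hrl]
    rw [List.drop_zero] at h
    rw [h, List.map_reverse, List.reverse_reverse, h1]
    congr 1
    simp only [kept, ← hS, ← hl, List.drop_reverse, List.map_take, List.length_map]

/-- A nonzero string has a codeword of weight at least `c + 1`. If the parities vanish, all of this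
weight lies in the systematic part, for which `S` leaves too little room. Every use of the MDS
property passes through this lemma. -/
theorem eq_zero_of_parity_eq_zero {Z : Fin (numBlocks ℓ) → AdjoinRoot 𝒞.f}
    (hZ : 𝒞.parity Z = 0) (S : Finset (Fin (numBlocks ℓ))) (hS : #S ≤ c)
    (h : ∀ j, j ∉ S → Z j = 0) : Z = 0 := by
  classical
  by_contra hne
  have h1 := 𝒞.mds Z hne
  change Matrix.vecMul Z 𝒞.G = 0 at hZ
  rw [hZ, hammingNorm] at h1
  have h2 : #{i | (Sum.elim Z 0 : Fin (numBlocks ℓ) ⊕ Fin c → AdjoinRoot 𝒞.f) i ≠ 0} ≤ #S := by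
    rw [← Finset.card_map (s := S) Function.Embedding.inl]
    apply Finset.card_le_card
    intro i hi
    rcases i with j | r
    · have hj : Z j ≠ 0 := by simpa using hi
      exact Finset.mem_map_of_mem _ (by by_contra hjS; exact hj (h j hjS))
    · simp at hi
  have h3 : #{i | (Sum.elim Z 0 : Fin (numBlocks ℓ) ⊕ Fin c → AdjoinRoot 𝒞.f) i ≠ 0} =
    _ := rfl
  omega

theorem parity_sub (Z Z' : Fin (numBlocks ℓ) → AdjoinRoot 𝒞.f) :
    𝒞.parity (Z - Z') = 𝒞.parity Z - 𝒞.parity Z' := Matrix.sub_vecMul _ _ _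

end GCCode
end

/-! ### Blocks -/

/-- A subsequence of a concatenation is a concatenation of subsequences of the pieces, and `g i`
counts what is missing in piece `i`. The induction splits off the last piece. -/
theorem exists_chunks {α : Type*} (L : ℕ → ℕ) (m : ℕ) {s u : List α} (h : s.Sublist u)
    (hu : u.length = ∑ i ∈ range m, L i) :
    ∃ g : ℕ → ℕ, (∀ i < m, g i ≤ L i) ∧ s.length = ∑ i ∈ range m, (L i - g i) ∧
      ∀ j < m, ((s.drop (∑ i ∈ range j, (L i - g i))).take (L j - g j)).Sublist
        ((u.drop (∑ i ∈ range j, L i)).take (L j)) := by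
  induction m generalizing s u with
  | zero => exact ⟨0, by simp_all⟩
  | succ m ih =>
    rw [sum_range_succ] at hu
    set p := ∑ i ∈ range m, L i with hp
    rw [← List.take_append_drop p u] at h
    obtain ⟨s1, s2, rfl, h1, h2⟩ := List.sublist_append_iff.1 h
    obtain ⟨g, hg1, hg2, hg3⟩ := ih h1 (by simp; omega)
    have h2l : s2.length ≤ L m := by
      have := h2.length_le; simp at this; omega
    let g' : ℕ → ℕ := fun i => if i < m then g i else L m - s2.length
    have hgs : ∀ j ≤ m, ∑ i ∈ range j, (L i - g' i) = ∑ i ∈ range j, (L i - g i) := fun j hj =>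
      sum_congr rfl fun i hi => by
        have := mem_range.1 hi
        simp [g', show i < m by omega]
    have hgm : L m - g' m = s2.length := by simp [g']; omega
    refine ⟨g', fun i hi => ?_, ?_, fun j hj => ?_⟩
    · by_cases him : i < m
      · simpa [g', him] using hg1 i him
      · obtain rfl : i = m := by omega
        simp [g']
    · rw [sum_range_succ, hgs m le_rfl, hgm, List.length_append, hg2]
    · rw [hgs j (by omega)]
      rcases Nat.lt_succ_iff_lt_or_eq.1 hj with hj | rfl
      · have hle : ∑ i ∈ range (j + 1), L i ≤ p :=
          sum_le_sum_of_subset (range_mono hj)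
        have hle2 : ∑ i ∈ range (j + 1), (L i - g i) ≤ s1.length := by
          rw [hg2]; exact sum_le_sum_of_subset (range_mono hj)
        rw [sum_range_succ] at hle hle2
        have h3 := hg3 j hj
        rw [List.drop_take, List.take_take, min_eq_left (by omega)] at h3
        have hgj : g' j = g j := by simp [g', hj]
        rw [hgj, List.drop_append_of_le_length (by omega), List.take_append_of_le_length
          (by simp; omega)]
        exact h3
      · rw [hgm, ← hg2, List.drop_left, List.take_length]
        rwa [List.take_of_length_le (by simp; omega)]

section
variable {ℓ : ℕ}

theorem sum_Iio_val {K : ℕ} (f : ℕ → ℕ) (j : Fin K) :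
    ∑ i ∈ Finset.Iio j, f i = ∑ i ∈ range j, f i := by
  have := Finset.sum_map (Finset.Iio j) Fin.valEmbedding f
  rw [Fin.map_valEmbedding_Iio] at this
  simp only [Fin.valEmbedding_apply] at this
  rw [← this]
  congr 1; ext; simp

theorem sum_Iio_add_le {K : ℕ} (f : Fin K → ℕ) (j : Fin K) :
    ∑ i ∈ Finset.Iio j, f i + f j ≤ ∑ i, f i := by
  have : f j = ∑ i ∈ {j}, f i := by simp
  rw [this, ← Finset.sum_union (by simp)]
  exact Finset.sum_le_sum_of_subset (Finset.subset_univ _)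

theorem numBlocks_mul_ge (hℓ : 0 < ℓ) : 2 ^ ℓ ≤ numBlocks ℓ * ℓ := by
  rw [mul_comm]
  exact (ceilDiv_le_iff_le_mul hℓ).1 le_rfl

theorem mul_lt_of_lt_numBlocks (hℓ : 0 < ℓ) {j : ℕ} (hj : j < numBlocks ℓ) : j * ℓ < 2 ^ ℓ := by
  by_contra h
  push Not at h
  have : numBlocks ℓ ≤ j := (ceilDiv_le_iff_le_mul hℓ).2 (by rwa [mul_comm] at h)
  omega

theorem sum_blockLen_range (hℓ : 0 < ℓ) {m : ℕ} :
    ∑ i ∈ range m, min ℓ (2 ^ ℓ - i * ℓ) = min (m * ℓ) (2 ^ ℓ) := by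
  induction m with
  | zero => simp
  | succ m ih => rw [sum_range_succ, ih, Nat.succ_mul]; omega

theorem sum_Iio_blockLen (hℓ : 0 < ℓ) (j : Fin (numBlocks ℓ)) :
    ∑ i ∈ Finset.Iio j, blockLen ℓ i = j * ℓ := by
  have := sum_Iio_val (fun i => min ℓ (2 ^ ℓ - i * ℓ)) j
  rw [sum_blockLen_range hℓ, min_eq_left (mul_lt_of_lt_numBlocks hℓ j.2).le] at this
  exact this

theorem sum_blockLen (hℓ : 0 < ℓ) : ∑ i, blockLen ℓ i = 2 ^ ℓ := by
  have := Fin.sum_univ_eq_sum_range (fun i => min ℓ (2 ^ ℓ - i * ℓ)) (numBlocks ℓ)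
  rw [sum_blockLen_range hℓ, min_eq_right (numBlocks_mul_ge hℓ)] at this
  exact this

theorem sum_blockLen_sub (hℓ : 0 < ℓ) {n : ℕ} (hn : n ≤ 2 ^ ℓ) {g : Fin (numBlocks ℓ) → ℕ}
    (hg : ∀ j, g j ≤ blockLen ℓ j) (hs : ∑ j, g j = 2 ^ ℓ - n) :
    ∑ j, (blockLen ℓ j - g j) = n := by
  have h : ∑ j, (blockLen ℓ j - g j) + ∑ j, g j = ∑ j, blockLen ℓ j := by
    rw [← sum_add_distrib]
    exact sum_congr rfl fun j _ => Nat.sub_add_cancel (hg j)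
  rw [sum_blockLen hℓ] at h; omega

/-- The number of deletions in each block, for a string of surviving positions. -/
theorem exists_deletions (hℓ : 0 < ℓ) {φ : List (Fin (2 ^ ℓ))}
    (h : φ.Sublist (List.finRange (2 ^ ℓ))) :
    ∃ b : Fin (numBlocks ℓ) → ℕ, (∀ j, b j ≤ blockLen ℓ j) ∧ ∑ j, b j = 2 ^ ℓ - φ.length ∧
      ∀ j, ((φ.drop (∑ i ∈ Finset.Iio j, (blockLen ℓ i - b i))).take
        (blockLen ℓ j - b j)).Sublist (((List.finRange (2 ^ ℓ)).drop (j * ℓ)).take ℓ) := by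
  obtain ⟨g, h1, h2, h3⟩ := exists_chunks (fun i => min ℓ (2 ^ ℓ - i * ℓ)) (numBlocks ℓ) h
    (by rw [sum_blockLen_range hℓ, min_eq_right (numBlocks_mul_ge hℓ), List.length_finRange])
  refine ⟨fun j => g j, fun j => h1 j j.2, ?_, fun j => ?_⟩
  · have h4 : ∑ j : Fin (numBlocks ℓ), (blockLen ℓ j - g j) + ∑ j : Fin (numBlocks ℓ), g j =
        ∑ j, blockLen ℓ j := by
      rw [← sum_add_distrib]
      exact sum_congr rfl fun j _ => Nat.sub_add_cancel (h1 j j.2)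
    have h5 := Fin.sum_univ_eq_sum_range (fun i => min ℓ (2 ^ ℓ - i * ℓ) - g i) (numBlocks ℓ)
    rw [← h2] at h5
    change ∑ j : Fin (numBlocks ℓ), (blockLen ℓ j - g j) = _ at h5
    rw [sum_blockLen hℓ] at h4
    change ∑ j : Fin (numBlocks ℓ), g j = _
    omega
  · have h4 := h3 j j.2
    rw [sum_blockLen_range hℓ, min_eq_left (mul_lt_of_lt_numBlocks hℓ j.2).le] at h4
    have h5 := sum_Iio_val (fun i => min ℓ (2 ^ ℓ - i * ℓ) - g i) j
    rw [← h5] at h4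
    refine h4.trans ?_
    exact List.take_sublist_take_left (min_le_left _ _)

/-- Cutting a string into padded blocks and joining them. -/
theorem take_flatMap_blocks (ℓ m : ℕ) (u : List Bool) (h : u.length ≤ m * ℓ) :
    ((List.ofFn fun j : Fin m => (u.drop (j * ℓ)).take ℓ ++
      List.replicate (ℓ - ((u.drop (j * ℓ)).take ℓ).length) false).flatten).take u.length = u := by
  induction m generalizing u with
  | zero => simp at h; simp [h]
  | succ m ih =>
    have ih' := ih (u.drop ℓ) (by rw [Nat.succ_mul] at h; simp; omega)
    simp only [List.drop_drop] at ih'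
    rw [List.ofFn_succ, List.flatten_cons]
    simp only [Fin.val_zero, zero_mul, List.drop_zero, Fin.val_succ]
    have h1 : ∀ i : Fin m, ((i : ℕ) + 1) * ℓ = ℓ + i * ℓ := fun i => by ring
    simp only [h1]
    by_cases hu : u.length ≤ ℓ
    · rw [List.take_of_length_le hu, List.append_assoc, List.take_left]
    · have h2 : ((u.take ℓ).length) = ℓ := by simp; omega
      rw [h2, Nat.sub_self, List.replicate_zero, List.append_nil]
      rw [List.take_append, h2, List.take_of_length_le (by omega)]
      rw [List.length_drop] at ih'
      rw [ih', List.take_append_drop]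

end

/-! ### The true deletion pattern as a possible case -/

section
variable {c ℓ : ℕ} (𝒞 : GCCode c ℓ)
namespace GCCode

theorem length_subBlock {s : List Bool} {g : Fin (numBlocks ℓ) → ℕ} (hℓ : 0 < ℓ)
    (hs : s.length ≤ 2 ^ ℓ) (hg : ∀ j, g j ≤ blockLen ℓ j) (hsum : ∑ j, g j = 2 ^ ℓ - s.length)
    (j : Fin (numBlocks ℓ)) : (subBlock s g j).length = blockLen ℓ j - g j := by
  have h1 := sum_blockLen_sub hℓ hs hg hsum
  have h2 := sum_Iio_add_le (fun i => blockLen ℓ i - g i) j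
  simp only [subBlock, List.length_take, List.length_drop]
  omega

theorem drop_take_ofFn_eq {k : ℕ} (u : Fin k → Bool) (a b : ℕ) :
    ((List.ofFn u).drop a).take b = (((List.finRange k).drop a).take b).map u := by
  rw [List.ofFn_eq_map, List.map_take, List.map_drop]

theorem subBlock_map {φ : List (Fin (2 ^ ℓ))} (u : Fin (2 ^ ℓ) → Bool)
    (g : Fin (numBlocks ℓ) → ℕ) (j : Fin (numBlocks ℓ)) : subBlock (φ.map u) g j =
      ((φ.drop (∑ i ∈ Finset.Iio j, (blockLen ℓ i - g i))).take (blockLen ℓ j - g j)).map u := by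
  rw [subBlock, List.map_take, List.map_drop]

theorem length_block (u : Fin (2 ^ ℓ) → Bool) (j : Fin (numBlocks ℓ)) :
    (((List.ofFn u).drop (j * ℓ)).take ℓ).length = blockLen ℓ j := by
  simp [blockLen]

/-- The message is among the decoded strings. -/
theorem isPossible_symbols {φ : List (Fin (2 ^ ℓ))} (h : φ.Sublist (List.finRange (2 ^ ℓ)))
    (u : Fin (2 ^ ℓ) → Bool) :
    ∃ g, 𝒞.IsPossible (𝒞.parity (𝒞.symbols u)) (φ.map u) g (𝒞.symbols u) := by
  obtain ⟨b, h1, h2, h3⟩ := exists_deletions 𝒞.ℓ_pos h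
  have hs : (φ.map u).length ≤ 2 ^ ℓ := by simpa using h.length_le
  have hsub : ∀ j, (subBlock (φ.map u) b j).Sublist (((List.ofFn u).drop (j * ℓ)).take ℓ) := by
    intro j
    rw [subBlock_map, drop_take_ofFn_eq]
    exact (h3 j).map _
  have h2' : ∑ j, b j = 2 ^ ℓ - (φ.map u).length := by simpa using h2
  refine ⟨b, h2', h1, fun j hj => ?_, fun _ _ => rfl, fun _ _ => rfl, fun j _ => ?_⟩
  -- Where nothing is deleted, the sub-block is a subsequence of full length and thus the block
  -- itself.
  · rw [symbols, (hsub j).eq_of_length]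
    rw [length_subBlock 𝒞.ℓ_pos hs h1 h2', length_block, hj, Nat.sub_zero]
  · rw [symbols, bits_symbol_of_le _ (by simp)]
    exact (hsub j).trans (List.sublist_append_left _ _)

theorem take_flatMap_symbols (u : Fin (2 ^ ℓ) → Bool) :
    ((List.ofFn (𝒞.symbols u)).flatMap 𝒞.bits).take (2 ^ ℓ) = List.ofFn u := by
  have := take_flatMap_blocks ℓ (numBlocks ℓ) (List.ofFn u)
    (by simpa using numBlocks_mul_ge 𝒞.ℓ_pos)
  rw [List.length_ofFn] at this
  conv_rhs => rw [← this]
  rw [List.flatMap, List.map_ofFn]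
  congr 3
  funext j
  rw [Function.comp_apply, symbols, bits_symbol_of_le _ (by simp)]

theorem drop_take_flatMap_bits {n : ℕ} (p : Fin n → AdjoinRoot 𝒞.f) (i : Fin n) :
    (((List.ofFn p).flatMap 𝒞.bits).drop (i * ℓ)).take ℓ = 𝒞.bits (p i) := by
  have key : ∀ (L : List (AdjoinRoot 𝒞.f)) (i : ℕ) (hi : i < L.length),
      ((L.flatMap 𝒞.bits).drop (i * ℓ)).take ℓ = 𝒞.bits L[i] := by
    intro L
    induction L with
    | nil => simp
    | cons a L ih =>
      intro i hi
      cases i with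
      | zero =>
        rw [List.flatMap_cons, zero_mul, List.drop_zero, List.take_left' (by simp)]; rfl
      | succ i =>
        rw [List.flatMap_cons, List.drop_append, List.drop_eq_nil_of_le
          (by simp [Nat.succ_mul]), List.nil_append, length_bits, Nat.succ_mul,
          Nat.add_sub_cancel]
        exact ih i (by simpa using hi)
  have := key (List.ofFn p) i (by simp)
  simpa using this

/-- The strings decoded from a received word, in terms of the surviving positions. -/
theorem mem_candidates_received {δ : ℕ} {u : Fin (2 ^ ℓ) → Bool}
    {D : Finset (Fin (gcLength δ c ℓ))} {φ : List (Fin (2 ^ ℓ))}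
    (h : readParity δ (c * ℓ) (𝒞.received δ u D).reverse =
      (𝒞.parityBits u, (φ.map u).reverse)) (Y : Fin (numBlocks ℓ) → AdjoinRoot 𝒞.f) :
    Y ∈ 𝒞.candidates δ (𝒞.received δ u D) ↔
      ∃ g, 𝒞.IsPossible (𝒞.parity (𝒞.symbols u)) (φ.map u) g Y := by
  have hp : (fun i : Fin c => 𝒞.symbol (((𝒞.parityBits u).drop (i * ℓ)).take ℓ)) =
      𝒞.parity (𝒞.symbols u) := by
    funext i
    rw [parityBits, drop_take_flatMap_bits, symbol_bits]
  simp only [candidates, h, List.reverse_reverse, hp, Set.mem_ofPred_eq]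

theorem symbols_mem_candidates {δ : ℕ} (u : Fin (2 ^ ℓ) → Bool)
    (D : Finset (Fin (gcLength δ c ℓ))) (hD : #D ≤ δ) :
    𝒞.symbols u ∈ 𝒞.candidates δ (𝒞.received δ u D) := by
  obtain ⟨e, _, _, h⟩ := 𝒞.readParity_received u D hD
  exact (𝒞.mem_candidates_received h _).2 (𝒞.isPossible_symbols (kept_sublist D e) u)

/-- The symbols of the message are always a candidate, so a unique candidate has to be this one.
Cutting its bits to the message length removes the padding. -/
theorem decode_received {δ : ℕ} (u : Fin (2 ^ ℓ) → Bool)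
    (D : Finset (Fin (gcLength δ c ℓ))) (hD : #D ≤ δ) :
    𝒞.decode δ (𝒞.received δ u D) = none ∨
      𝒞.decode δ (𝒞.received δ u D) = some (List.ofFn u) := by
  unfold decode
  split
  · rename_i h
    right
    rw [h.unique h.choose_spec.1 (𝒞.symbols_mem_candidates u D hD), take_flatMap_symbols]
  · exact Or.inl rfl

end GCCode
end

/-! ### The number of messages with a wrong possible case -/

/-- Differences along a strictly monotone partial map without fixed points can be prescribed. -/
theorem exists_xor_eq {k : ℕ} (X : Set (Fin k)) (σ : Fin k → Fin k) (hσ : StrictMonoOn σ X)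
    (w : Fin k → Bool) (hw : ∀ x ∈ X, σ x = x → w x = false) :
    ∃ u : Fin k → Bool, ∀ x ∈ X, Bool.xor (u (σ x)) (u x) = w x := by
  classical
  -- The constraints are edges between `x` and `σ x`, and `u` is defined by recursion on the
  -- position. Each `y` is the larger end of at most one edge: injectivity of `σ` leaves at most one
  -- `x < y` with `σ x = y`, and if such an `x` exists, monotonicity excludes `σ y < y`. A position
  -- that is the larger end of no edge may take any value; `false` is chosen.
  let F : ∀ y : Fin k, (∀ z, z < y → Bool) → Bool := fun y rec =>
    if h : ∃ x, x ∈ X ∧ σ x = y ∧ x < y then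
      Bool.xor (rec h.choose h.choose_spec.2.2) (w h.choose)
    else if h : y ∈ X ∧ σ y < y then Bool.xor (rec (σ y) h.2) (w y) else false
  let u : Fin k → Bool := (wellFounded_lt (α := Fin k)).fix F
  have hu : ∀ y, u y = F y fun z _ => u z := fun y => WellFounded.fix_eq _ F y
  refine ⟨u, fun x hx => ?_⟩
  rcases lt_trichotomy (σ x) x with h | h | h
  · have h1 : ¬ ∃ z, z ∈ X ∧ σ z = x ∧ z < x := by
      rintro ⟨z, hz, hzx, hlt⟩
      have := hσ hz hx hlt
      rw [hzx] at this
      exact absurd h this.not_gt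
    rw [hu x]
    simp only [F, h1, dif_neg, not_false_eq_true, dif_pos (And.intro hx h)]
    cases u (σ x) <;> cases w x <;> rfl
  · rw [hw x hx h, h, Bool.xor_self]
  · have h1 : ∃ z, z ∈ X ∧ σ z = σ x ∧ z < σ x := ⟨x, hx, rfl, h⟩
    have h2 : h1.choose = x := hσ.injOn h1.choose_spec.1 hx h1.choose_spec.2.1
    rw [hu (σ x)]
    simp only [F, dif_pos h1]
    rw [h2]
    cases u x <;> cases w x <;> rfl

/-! ### Positions read under a guess -/

section
variable {ℓ : ℕ}

/-- Where block `j` starts in the received string under the guess `g`. -/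
def blockStart (g : Fin (numBlocks ℓ) → ℕ) (j : Fin (numBlocks ℓ)) : ℕ :=
  ∑ i ∈ Finset.Iio j, (blockLen ℓ i - g i)

/-- The guessed (or true) deletion patterns `g` with `d` deletions. -/
structure IsPattern (d : ℕ) (g : Fin (numBlocks ℓ) → ℕ) : Prop where
  sum_eq : ∑ j, g j = d
  le : ∀ j, g j ≤ blockLen ℓ j

theorem blockStart_add (hℓ : 0 < ℓ) {g : Fin (numBlocks ℓ) → ℕ} (hg : ∀ j, g j ≤ blockLen ℓ j)
    (j : Fin (numBlocks ℓ)) : blockStart g j + ∑ i ∈ Finset.Iio j, g i = j * ℓ := by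
  rw [blockStart, ← sum_add_distrib, ← sum_Iio_blockLen hℓ]
  exact sum_congr rfl fun i _ => Nat.sub_add_cancel (hg i)

theorem blockStart_add_le_of_lt (g : Fin (numBlocks ℓ) → ℕ) {i j : Fin (numBlocks ℓ)} (h : i < j) :
    blockStart g i + (blockLen ℓ i - g i) ≤ blockStart g j := by
  have : blockLen ℓ i - g i = ∑ i ∈ {i}, (blockLen ℓ i - g i) := by simp
  rw [blockStart, blockStart, this, ← Finset.sum_union (by simp)]
  refine Finset.sum_le_sum_of_subset fun x hx => ?_
  simp only [mem_union, mem_Iio, mem_singleton] at hx ⊢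
  rcases hx with hx | rfl
  · exact hx.trans h
  · exact h

theorem blockStart_add_le (hℓ : 0 < ℓ) {n : ℕ} (hn : n ≤ 2 ^ ℓ) {g : Fin (numBlocks ℓ) → ℕ}
    (hg : IsPattern (2 ^ ℓ - n) g) (j : Fin (numBlocks ℓ)) :
    blockStart g j + (blockLen ℓ j - g j) ≤ n :=
  (sum_Iio_add_le (fun i => blockLen ℓ i - g i) j).trans
    (sum_blockLen_sub hℓ hn hg.le hg.sum_eq).le

/-- The block of a position. -/
def blockOf (hℓ : 0 < ℓ) (x : Fin (2 ^ ℓ)) : Fin (numBlocks ℓ) :=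
  ⟨x / ℓ, by
    rw [Nat.div_lt_iff_lt_mul hℓ]; exact x.2.trans_le (numBlocks_mul_ge hℓ)⟩

theorem mod_lt_blockLen (hℓ : 0 < ℓ) (x : Fin (2 ^ ℓ)) :
    (x : ℕ) % ℓ < blockLen ℓ (blockOf hℓ x) := by
  have h1 := Nat.mod_lt (x : ℕ) hℓ
  have h2 := Nat.div_add_mod' (x : ℕ) ℓ
  have := x.2
  simp only [blockLen, blockOf]
  omega

/-- The position read for position `x` under the guess `g`. -/
def readPos (hℓ : 0 < ℓ) (φ : List (Fin (2 ^ ℓ))) (g : Fin (numBlocks ℓ) → ℕ) (x : Fin (2 ^ ℓ)) :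
    Fin (2 ^ ℓ) :=
  (φ[blockStart g (blockOf hℓ x) + (x : ℕ) % ℓ]?).getD x

variable {φ : List (Fin (2 ^ ℓ))} {g b : Fin (numBlocks ℓ) → ℕ}

/-- The blocks are read from consecutive disjoint segments of `φ`, and `φ` is increasing since
deletions preserve the order. In the blocks considered here the segment has full length, so the
default value in `readPos` does not occur. -/
theorem strictMonoOn_readPos (hℓ : 0 < ℓ) (hφ : φ.Sublist (List.finRange (2 ^ ℓ)))
    (hg : IsPattern (2 ^ ℓ - φ.length) g) :
    StrictMonoOn (readPos hℓ φ g) {x | g (blockOf hℓ x) = 0} := by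
  have hn : φ.length ≤ 2 ^ ℓ := by simpa using hφ.length_le
  have hlt : ∀ x : Fin (2 ^ ℓ), g (blockOf hℓ x) = 0 →
      blockStart g (blockOf hℓ x) + (x : ℕ) % ℓ < φ.length := fun x hx => by
    have h1 := blockStart_add_le hℓ hn hg (blockOf hℓ x)
    have h2 := mod_lt_blockLen hℓ x
    rw [hx] at h1; omega
  have hsorted : φ.Pairwise (· < ·) := (List.pairwise_lt_finRange _).sublist hφ
  intro x hx y hy hxy
  simp only [Set.mem_ofPred_eq] at hx hy
  have h1 := hlt x hx
  have h2 := hlt y hy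
  rw [readPos, readPos, List.getElem?_eq_getElem h1, List.getElem?_eq_getElem h2]
  simp only [Option.getD_some]
  refine (List.pairwise_iff_getElem.1 hsorted) _ _ h1 h2 ?_
  have hxy' : (x : ℕ) < y := hxy
  have hle : blockOf hℓ x ≤ blockOf hℓ y := Nat.div_le_div_right hxy'.le
  rcases hle.lt_or_eq with h | h
  · have h3 := blockStart_add_le_of_lt g h
    have h4 := mod_lt_blockLen hℓ x
    rw [hx] at h3; omega
  · have h3 : (x : ℕ) / ℓ = y / ℓ := congrArg Fin.val h
    have h4 := Nat.div_add_mod' (x : ℕ) ℓ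
    have h5 := Nat.div_add_mod' (y : ℕ) ℓ
    rw [h]; rw [h3] at h4; omega

/-- The positions of an unaffected block are where they should be. -/
theorem getElem_of_unaffected (hℓ : 0 < ℓ)
    (hφ : φ.Sublist (List.finRange (2 ^ ℓ))) (hb : IsPattern (2 ^ ℓ - φ.length) b)
    (hsub : ∀ j, ((φ.drop (blockStart b j)).take
        (blockLen ℓ j - b j)).Sublist (((List.finRange (2 ^ ℓ)).drop (j * ℓ)).take ℓ))
    (x : Fin (2 ^ ℓ)) (hx : b (blockOf hℓ x) = 0) :
    φ[blockStart b (blockOf hℓ x) + (x : ℕ) % ℓ]? = some x := by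
  have hn : φ.length ≤ 2 ^ ℓ := by simpa using hφ.length_le
  set j := blockOf hℓ x with hj
  have h1 := blockStart_add_le hℓ hn hb j
  have h2 := mod_lt_blockLen hℓ x
  rw [← hj] at h2
  have h3 := (hsub j).eq_of_length (by
    simp only [List.length_take, List.length_drop, List.length_finRange]
    rw [hx] at h1 ⊢
    have : blockLen ℓ j = min ℓ (2 ^ ℓ - j * ℓ) := rfl
    omega)
  have h4 := congrArg (fun l => l[(x : ℕ) % ℓ]?) h3
  simp only [hx, Nat.sub_zero] at h4
  rw [List.getElem?_take_of_lt h2, List.getElem?_drop,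
    List.getElem?_take_of_lt (Nat.mod_lt _ hℓ), List.getElem?_drop] at h4
  rw [h4]
  have h5 : (j : ℕ) * ℓ + (x : ℕ) % ℓ = x := Nat.div_add_mod' (x : ℕ) ℓ
  rw [h5, List.getElem?_eq_getElem (by simp)]
  simp

/-- Block `j` is unaffected and not guessed to be affected, but it is read from a wrong place. -/
def IsShifted (g b : Fin (numBlocks ℓ) → ℕ) (j : Fin (numBlocks ℓ)) : Prop :=
  g j = 0 ∧ b j = 0 ∧ ∑ i ∈ Finset.Iio j, g i ≠ ∑ i ∈ Finset.Iio j, b i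

/-- Position `x` survives at the index computed from `b`. The guess `g` looks at a different index,
because the block starts differ, and `φ` has no repetitions. -/
theorem readPos_ne (hℓ : 0 < ℓ)
    (hφ : φ.Sublist (List.finRange (2 ^ ℓ))) (hg : IsPattern (2 ^ ℓ - φ.length) g)
    (hb : IsPattern (2 ^ ℓ - φ.length) b)
    (hsub : ∀ j, ((φ.drop (blockStart b j)).take
        (blockLen ℓ j - b j)).Sublist (((List.finRange (2 ^ ℓ)).drop (j * ℓ)).take ℓ))
    (x : Fin (2 ^ ℓ)) (hx : IsShifted g b (blockOf hℓ x)) : readPos hℓ φ g x ≠ x := by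
  have hn : φ.length ≤ 2 ^ ℓ := by simpa using hφ.length_le
  obtain ⟨hgx, hbx, hne⟩ := hx
  have h1 := getElem_of_unaffected hℓ hφ hb hsub x hbx
  have hlt : blockStart g (blockOf hℓ x) + (x : ℕ) % ℓ < φ.length := by
    have h1 := blockStart_add_le hℓ hn hg (blockOf hℓ x)
    have h2 := mod_lt_blockLen hℓ x
    rw [hgx] at h1; omega
  intro h
  rw [readPos, List.getElem?_eq_getElem hlt, Option.getD_some] at h
  obtain ⟨hlt', h2⟩ := List.getElem?_eq_some_iff.1 h1
  have h3 := (((List.nodup_finRange _).sublist hφ).getElem_inj_iff (hi := hlt) (hj := hlt')).1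
    (h.trans h2.symm)
  have h4 := blockStart_add hℓ hg.le (blockOf hℓ x)
  have h5 := blockStart_add hℓ hb.le (blockOf hℓ x)
  omega

/-- A block shorter than `ℓ` is the last one. If both patterns leave it alone, all `d` deletions
precede it in both, so it is not shifted. Consequently every element of the field can be prescribed
as a difference in a shifted block. -/
theorem IsShifted.blockLen_eq (hℓ : 0 < ℓ) {d : ℕ} (hg : IsPattern d g) (hb : IsPattern d b)
    {j : Fin (numBlocks ℓ)} (h : IsShifted g b j) : blockLen ℓ j = ℓ := by
  by_contra hne
  have h1 : 2 ^ ℓ < (j + 1) * ℓ := by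
    have : blockLen ℓ j = min ℓ (2 ^ ℓ - j * ℓ) := rfl
    rw [Nat.succ_mul]; omega
  have hlast : ∀ i : Fin (numBlocks ℓ), i ≤ j := fun i => by
    by_contra hi
    push Not at hi
    have h2 := mul_lt_of_lt_numBlocks hℓ i.2
    have h3 : ((j : ℕ) + 1) * ℓ ≤ i * ℓ := Nat.mul_le_mul_right _ hi
    omega
  have huniv : (Finset.univ : Finset (Fin (numBlocks ℓ))) = Finset.Iio j ∪ {j} := by
    ext i
    have := hlast i
    simpa using this
  have hs : ∀ f : Fin (numBlocks ℓ) → ℕ, f j = 0 → ∑ i, f i = ∑ i ∈ Finset.Iio j, f i := by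
    intro f hf
    rw [huniv, Finset.sum_union (by simp)]; simp [hf]
  apply h.2.2
  rw [← hs g h.1, ← hs b h.2.1, hg.sum_eq, hb.sum_eq]

end

/-! ### Counting bad messages for a fixed guess -/

section
variable {c ℓ : ℕ} (𝒞 : GCCode c ℓ)
namespace GCCode
variable {φ : List (Fin (2 ^ ℓ))} {g b : Fin (numBlocks ℓ) → ℕ}

/-- The difference between the symbol read in block `j` and the true one. -/
noncomputable def readDiff (φ : List (Fin (2 ^ ℓ))) (g : Fin (numBlocks ℓ) → ℕ)
    (j : Fin (numBlocks ℓ)) (u : Fin (2 ^ ℓ) → Bool) : AdjoinRoot 𝒞.f :=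
  𝒞.symbol (subBlock (φ.map u) g j) + 𝒞.symbols u j

theorem xorBits_map {α : Type*} (L : List α) (u v : α → Bool) :
    xorBits (L.map u) (L.map v) = L.map fun x => Bool.xor (u x) (v x) := by
  simp [xorBits, List.zipWith_map]

theorem readDiff_xor (j : Fin (numBlocks ℓ)) (u v : Fin (2 ^ ℓ) → Bool) :
    𝒞.readDiff φ g j (fun x => Bool.xor (u x) (v x)) =
      𝒞.readDiff φ g j u + 𝒞.readDiff φ g j v := by
  simp only [readDiff, symbols, drop_take_ofFn_eq, subBlock_map]
  rw [← xorBits_map, ← xorBits_map, symbol_xorBits _ (by simp), symbol_xorBits _ (by simp)]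
  ring

theorem readDiff_eq (hφ : φ.Sublist (List.finRange (2 ^ ℓ))) (hg : IsPattern (2 ^ ℓ - φ.length) g)
    (j : Fin (numBlocks ℓ)) (hj : g j = 0) (u : Fin (2 ^ ℓ) → Bool) (t : List Bool)
    (ht : t.length = blockLen ℓ j)
    (h : ∀ x, blockOf 𝒞.ℓ_pos x = j →
      Bool.xor (u (readPos 𝒞.ℓ_pos φ g x)) (u x) = t.getD ((x : ℕ) % ℓ) false) :
    𝒞.readDiff φ g j u = 𝒞.symbol t := by
  have hn : φ.length ≤ 2 ^ ℓ := by simpa using hφ.length_le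
  have hl1 : (subBlock (φ.map u) g j).length = blockLen ℓ j := by
    rw [length_subBlock 𝒞.ℓ_pos (by simpa using hn) hg.le (by simpa using hg.sum_eq), hj,
      Nat.sub_zero]
  rw [readDiff, symbols, ← symbol_xorBits _ (by rw [hl1, length_block])]
  congr 1
  apply List.ext_getElem (by rw [length_xorBits, hl1, length_block, ht, min_self])
  intro i h1 h2
  have hi : i < blockLen ℓ j := by omega
  have hiℓ : i < ℓ := hi.trans_le (min_le_left _ _)
  have hik : (j : ℕ) * ℓ + i < 2 ^ ℓ := by
    have : blockLen ℓ j = min ℓ (2 ^ ℓ - j * ℓ) := rfl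
    omega
  have hdiv : ((j : ℕ) * ℓ + i) / ℓ = j := by
    rw [mul_comm, Nat.mul_add_div 𝒞.ℓ_pos, Nat.div_eq_of_lt hiℓ, add_zero]
  have hmod : ((j : ℕ) * ℓ + i) % ℓ = i := by
    rw [mul_comm, Nat.mul_add_mod, Nat.mod_eq_of_lt hiℓ]
  have hblk : blockOf 𝒞.ℓ_pos ⟨(j : ℕ) * ℓ + i, hik⟩ = j := Fin.ext hdiv
  have hx := h ⟨(j : ℕ) * ℓ + i, hik⟩ hblk
  have hlt : blockStart g j + i < φ.length := by
    have h1 := blockStart_add_le 𝒞.ℓ_pos hn hg j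
    rw [hj] at h1; omega
  rw [readPos, hblk] at hx
  simp only [hmod] at hx
  rw [List.getElem?_eq_getElem hlt, Option.getD_some, List.getD_eq_getElem _ _ h2] at hx
  rw [← hx]
  simp only [xorBits, List.getElem_zipWith]
  congr 1
  · simp [subBlock, blockStart]
  · simp

/-- On bits the requirement reads `u (σ x) + u x = w' x` with `σ = readPos`. It is solvable by
`exists_xor_eq`: fixed points of `σ` lie outside the shifted blocks, and there `w'` vanishes. -/
theorem exists_readDiff_eq (hφ : φ.Sublist (List.finRange (2 ^ ℓ)))
    (hg : IsPattern (2 ^ ℓ - φ.length) g) (hb : IsPattern (2 ^ ℓ - φ.length) b)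
    (hsub : ∀ j, ((φ.drop (blockStart b j)).take
        (blockLen ℓ j - b j)).Sublist (((List.finRange (2 ^ ℓ)).drop (j * ℓ)).take ℓ))
    (w : Fin (numBlocks ℓ) → AdjoinRoot 𝒞.f) (hw : ∀ j, ¬ IsShifted g b j → w j = 0) :
    ∃ u, ∀ j, g j = 0 → 𝒞.readDiff φ g j u = w j := by
  classical
  let w' : Fin (2 ^ ℓ) → Bool := fun x => if IsShifted g b (blockOf 𝒞.ℓ_pos x) then
    (𝒞.bits (w (blockOf 𝒞.ℓ_pos x))).getD ((x : ℕ) % ℓ) false else false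
  obtain ⟨u, hu⟩ := exists_xor_eq {x | g (blockOf 𝒞.ℓ_pos x) = 0} (readPos 𝒞.ℓ_pos φ g)
    (strictMonoOn_readPos 𝒞.ℓ_pos hφ hg) w' (fun x _ h => by
      have : ¬ IsShifted g b (blockOf 𝒞.ℓ_pos x) := fun h' =>
        readPos_ne 𝒞.ℓ_pos hφ hg hb hsub x h' h
      simp [w', this])
  refine ⟨u, fun j hj => ?_⟩
  by_cases hs : IsShifted g b j
  · rw [𝒞.readDiff_eq hφ hg j hj u (𝒞.bits (w j))
      (by rw [length_bits, hs.blockLen_eq 𝒞.ℓ_pos hg hb]), symbol_bits]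
    intro x hx
    rw [hu x (by simp [hx, hj])]
    simp [w', hx, hs]
  · rw [𝒞.readDiff_eq hφ hg j hj u (List.replicate (blockLen ℓ j) false) (by simp), symbol_zeros,
      hw j hs]
    intro x hx
    rw [hu x (by simp [hx, hj])]
    simp [w', hx, hs]

/-- The messages for which the guess `g` is a possible case that leads to a wrong string. -/
noncomputable def wrongSet (φ : List (Fin (2 ^ ℓ))) (g : Fin (numBlocks ℓ) → ℕ) :
    Finset (Fin (2 ^ ℓ) → Bool) := by
  classical
  exact {u | ∃ Y, Y ≠ 𝒞.symbols u ∧ 𝒞.IsPossible (𝒞.parity (𝒞.symbols u)) (φ.map u) g Y}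

theorem mem_wrongSet {u : Fin (2 ^ ℓ) → Bool} : u ∈ 𝒞.wrongSet φ g ↔
    ∃ Y, Y ≠ 𝒞.symbols u ∧ 𝒞.IsPossible (𝒞.parity (𝒞.symbols u)) (φ.map u) g Y := by
  simp [wrongSet]

theorem IsPossible.parity_eq {p : Fin c → AdjoinRoot 𝒞.f} {s : List Bool}
    {Y : Fin (numBlocks ℓ) → AdjoinRoot 𝒞.f} (h : 𝒞.IsPossible p s g Y) : 𝒞.parity Y = p :=
  funext fun r => (lt_or_ge (r : ℕ) _).elim (h.decoded r) (h.criterion1 r)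

/-- For every choice `t` of values on `T` there is a message `v t` whose reading differences are `t`
on `T` and zero in the other unerased blocks. Adding `v t` to bad messages is injective in both
arguments: if `u + v t = u' + v t'`, then the vectors `Y - symbols u` and `Y' - symbols u'`, both
with zero parities, agree outside `T` and the erased blocks. These are at most `c` places, so the
vectors coincide; their values on `T` yield `t = t'`, and then `u = u'`. -/
theorem card_wrongSet_mul_le (hφ : φ.Sublist (List.finRange (2 ^ ℓ)))
    (hg : IsPattern (2 ^ ℓ - φ.length) g) (hb : IsPattern (2 ^ ℓ - φ.length) b)
    (hsub : ∀ j, ((φ.drop (blockStart b j)).take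
        (blockLen ℓ j - b j)).Sublist (((List.finRange (2 ^ ℓ)).drop (j * ℓ)).take ℓ))
    (T : Finset (Fin (numBlocks ℓ))) (hT : ∀ j ∈ T, IsShifted g b j)
    (hc : #{j | g j ≠ 0} + #T ≤ c) :
    #(𝒞.wrongSet φ g) * 2 ^ (ℓ * #T) ≤ 2 ^ 2 ^ ℓ := by
  classical
  let w : (T → Fin ℓ → Bool) → Fin (numBlocks ℓ) → AdjoinRoot 𝒞.f := fun t j =>
    if h : j ∈ T then 𝒞.symbol (List.ofFn (t ⟨j, h⟩)) else 0
  have hex : ∀ t, ∃ u, ∀ j, g j = 0 → 𝒞.readDiff φ g j u = w t j := fun t =>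
    𝒞.exists_readDiff_eq hφ hg hb hsub (w t) (fun j hj => by
      have : j ∉ T := fun h => hj (hT j h)
      simp [w, this])
  choose v hv using hex
  have hinj : Function.Injective fun q : 𝒞.wrongSet φ g × (T → Fin ℓ → Bool) =>
      fun x => Bool.xor (q.1.1 x) (v q.2 x) := by
    rintro ⟨⟨u, hu⟩, t⟩ ⟨⟨u', hu'⟩, t'⟩ h
    obtain ⟨Y, -, hY⟩ := 𝒞.mem_wrongSet.1 hu
    obtain ⟨Y', -, hY'⟩ := 𝒞.mem_wrongSet.1 hu'
    have hdiff : ∀ j, g j = 0 → 𝒞.readDiff φ g j u + w t j = 𝒞.readDiff φ g j u' + w t' j := by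
      intro j hj
      rw [← hv t j hj, ← hv t' j hj, ← readDiff_xor, ← readDiff_xor]
      exact congrArg _ h
    have hYr : ∀ j, g j = 0 → (Y - 𝒞.symbols u) j = 𝒞.readDiff φ g j u := fun j hj => by
      rw [Pi.sub_apply, hY.unerased j hj, readDiff, CharTwo.sub_eq_add]
    have hYr' : ∀ j, g j = 0 → (Y' - 𝒞.symbols u') j = 𝒞.readDiff φ g j u' := fun j hj => by
      rw [Pi.sub_apply, hY'.unerased j hj, readDiff, CharTwo.sub_eq_add]
    have hZ := 𝒞.eq_zero_of_parity_eq_zero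
      (Z := (Y - 𝒞.symbols u) - (Y' - 𝒞.symbols u'))
      (by rw [parity_sub, parity_sub, parity_sub, hY.parity_eq, hY'.parity_eq]; simp)
      (({j | g j ≠ 0} : Finset _) ∪ T) ((Finset.card_union_le _ _).trans hc) (fun j hj => by
        simp only [Finset.mem_union, Finset.mem_filter, Finset.mem_univ, true_and, not_or,
          not_not] at hj
        have := hdiff j hj.1
        simp only [w, hj.2, dif_neg, not_false_eq_true, add_zero] at this
        rw [Pi.sub_apply, hYr j hj.1, hYr' j hj.1, this, sub_self])
    have hw : ∀ j (hj : j ∈ T), t ⟨j, hj⟩ = t' ⟨j, hj⟩ := by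
      intro j hj
      have hgj := (hT j hj).1
      have h1 := congrFun hZ j
      rw [Pi.sub_apply, hYr j hgj, hYr' j hgj, Pi.zero_apply, sub_eq_zero] at h1
      have h2 := hdiff j hgj
      rw [h1] at h2
      have h3 := add_left_cancel h2
      simp only [w, hj, dif_pos] at h3
      exact List.ofFn_injective (𝒞.symbol_inj (by simp) (by simp) h3)
    obtain rfl : t = t' := funext fun j => hw j.1 j.2
    have : u = u' := by
      funext x
      have := congrFun h x
      simpa using this
    subst this; rfl
  have hcard := Fintype.card_le_of_injective _ hinj
  simpa [pow_mul] using hcard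

/-- A block that is neither erased, nor damaged, nor shifted is read correctly. The nonzero vector
`Y - symbols u` with zero parities therefore lives on blocks of these three kinds, and it has more
than `c` nonzero entries. -/
theorem le_card_of_nonempty (hφ : φ.Sublist (List.finRange (2 ^ ℓ)))
    (hg : IsPattern (2 ^ ℓ - φ.length) g) (hb : IsPattern (2 ^ ℓ - φ.length) b)
    (hsub : ∀ j, ((φ.drop (blockStart b j)).take
        (blockLen ℓ j - b j)).Sublist (((List.finRange (2 ^ ℓ)).drop (j * ℓ)).take ℓ))
    (T : Finset (Fin (numBlocks ℓ))) (hT : ∀ j, IsShifted g b j → j ∈ T)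
    (hne : (𝒞.wrongSet φ g).Nonempty) :
    c + 1 ≤ #{j | g j ≠ 0} + #{j | b j ≠ 0} + #T := by
  classical
  obtain ⟨u, hu⟩ := hne
  obtain ⟨Y, hne, hY⟩ := 𝒞.mem_wrongSet.1 hu
  by_contra hlt
  apply hne
  rw [← sub_eq_zero]
  refine 𝒞.eq_zero_of_parity_eq_zero (by rw [parity_sub, hY.parity_eq, sub_self])
    ((({j | g j ≠ 0} : Finset _) ∪ ({j | b j ≠ 0} : Finset _)) ∪ T) ?_ ?_
  · have h1 := Finset.card_union_le (({j | g j ≠ 0} : Finset (Fin (numBlocks ℓ))) ∪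
      ({j | b j ≠ 0} : Finset _)) T
    have h2 := Finset.card_union_le ({j | g j ≠ 0} : Finset (Fin (numBlocks ℓ)))
      ({j | b j ≠ 0} : Finset _)
    omega
  · intro j hj
    simp only [Finset.mem_union, Finset.mem_filter, Finset.mem_univ, true_and, not_or,
      not_not] at hj
    obtain ⟨⟨hgj, hbj⟩, hjT⟩ := hj
    have hs : ∑ i ∈ Finset.Iio j, g i = ∑ i ∈ Finset.Iio j, b i := by
      by_contra h; exact hjT (hT j ⟨hgj, hbj, h⟩)
    have hst : blockStart g j = blockStart b j := by
      have h4 := blockStart_add 𝒞.ℓ_pos hg.le j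
      have h5 := blockStart_add 𝒞.ℓ_pos hb.le j
      omega
    rw [Pi.sub_apply, hY.unerased j hgj, CharTwo.sub_eq_add]
    change 𝒞.readDiff φ g j u = 0
    rw [𝒞.readDiff_eq hφ hg j hgj u (List.replicate (blockLen ℓ j) false) (by simp), symbol_zeros]
    intro x hx
    have h1 := getElem_of_unaffected 𝒞.ℓ_pos hφ hb hsub x (by rw [hx, hbj])
    rw [readPos, hx, hst, ← hx, h1]
    simp

end GCCode
end

/-! ### The probability of a decoding failure -/

/-- If the pattern `g` affects a place far from the places that `b` affects, then the prefix sums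
differ on a long interval. -/
theorem le_card_shifted (g b : ℕ → ℕ) (K R j : ℕ)
    (hsum : ∑ i ∈ range K, g i = ∑ i ∈ range K, b i) (hj : j < K) (hgj : g j ≠ 0)
    (hfar : ∀ i < K, j ≤ i + R → i ≤ j + R → b i = 0) :
    R ≤ #{i ∈ range K | g i ≠ 0} +
      #{i ∈ range K | g i = 0 ∧ b i = 0 ∧ ∑ i ∈ range i, g i ≠ ∑ i ∈ range i, b i} := by
  set G := fun i => ∑ i ∈ range i, g i with hG
  set B := fun i => ∑ i ∈ range i, b i with hB
  have hGs : ∀ i, G (i + 1) = G i + g i := fun i => sum_range_succ _ _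
  have hBs : ∀ i, B (i + 1) = B i + b i := fun i => sum_range_succ _ _
  have hGm : Monotone G := monotone_nat_of_le_succ fun i => by rw [hGs]; omega
  -- it suffices to find an interval with different prefix sums and without deletions
  have hfinal : ∀ a, a + R ≤ K → (∀ i, a ≤ i → i < a + R → b i = 0 ∧ G i ≠ B i) →
      R ≤ #{i ∈ range K | g i ≠ 0} + #{i ∈ range K | g i = 0 ∧ b i = 0 ∧ G i ≠ B i} := by
    intro a ha h
    have h1 : Finset.Ico a (a + R) ⊆ {i ∈ range K | g i ≠ 0} ∪
        {i ∈ range K | g i = 0 ∧ b i = 0 ∧ G i ≠ B i} := by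
      intro i hi
      rw [Finset.mem_Ico] at hi
      have := h i hi.1 hi.2
      simp only [Finset.mem_union, Finset.mem_filter, Finset.mem_range]
      by_cases hg : g i = 0
      · exact Or.inr ⟨by omega, hg, this⟩
      · exact Or.inl ⟨by omega, hg⟩
    have h2 := (Finset.card_le_card h1).trans (Finset.card_union_le _ _)
    simpa using h2
  -- Near `j` the sum `B` is constant while `G` is monotone. If `G` is ahead after `j`, it stays
  -- ahead on the next `R` places, and equality of the totals forces these to fit below `K`.
  -- Otherwise `G j < B j`, since `g j ≠ 0` and `b j = 0`, and `G` is behind on the previous `R`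
  -- places; these fit because both sums start from zero.
  by_cases hcase : B (j + 1) < G (j + 1)
  · have h1 : ∀ i, j + 1 ≤ i → i ≤ j + 1 + R → i ≤ K → B i = B (j + 1) := by
      intro i hi
      induction i, hi using Nat.le_induction with
      | base => simp
      | succ i hi ih =>
        intro h2 h3
        rw [hBs, ih (by omega) (by omega), hfar i (by omega) (by omega) (by omega), add_zero]
    have hK : j + 1 + R ≤ K := by
      by_contra hK
      have := h1 K (by omega) (by omega) le_rfl
      have h2 := hGm (show j + 1 ≤ K by omega)
      change G K = B K at hsum
      omega
    refine hfinal (j + 1) hK fun i hi1 hi2 => ⟨hfar i (by omega) (by omega) (by omega), ?_⟩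
    have := h1 i hi1 (by omega) (by omega)
    have h2 := hGm hi1
    omega
  · have h0 := hGs j
    have h0' := hBs j
    have hbj := hfar j hj (by omega) (by omega)
    have h1 : ∀ m, m ≤ R → m ≤ j → B (j - m) = B j := by
      intro m
      induction m with
      | zero => simp
      | succ m ih =>
        intro h2 h3
        have h4 := hBs (j - (m + 1))
        rw [show j - (m + 1) + 1 = j - m by omega, ih (by omega) (by omega),
          hfar (j - (m + 1)) (by omega) (by omega) (by omega)] at h4
        omega
    have hR : R ≤ j := by
      by_contra hR
      have := h1 j (by omega) le_rfl
      simp [hB] at this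
      simp only [hB, hG] at *
      omega
    refine hfinal (j - R) (by omega) fun i hi1 hi2 => ⟨hfar i (by omega) (by omega) (by omega), ?_⟩
    have h2 := h1 (j - i) (by omega) (by omega)
    rw [show j - (j - i) = i by omega] at h2
    have h3 := hGm (show i ≤ j by omega)
    omega

/-! ### Counting patterns of deletions -/

section
variable {ℓ : ℕ}

/-- Extension of a function on `Fin K` by zero. -/
def extendZero {K : ℕ} (g : Fin K → ℕ) (i : ℕ) : ℕ := if h : i < K then g ⟨i, h⟩ else 0

@[simp] theorem extendZero_val {K : ℕ} (g : Fin K → ℕ) (i : Fin K) : extendZero g i = g i := by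
  simp [extendZero]

theorem card_filter_range {K : ℕ} (p : ℕ → Prop) [DecidablePred p] :
    #{i ∈ range K | p i} = #{i : Fin K | p i} := by
  rw [← Finset.card_map Fin.valEmbedding]
  congr 1
  ext i
  simp only [Finset.mem_filter, Finset.mem_range, Finset.mem_map, Finset.mem_univ, true_and,
    Fin.valEmbedding_apply]
  constructor
  · rintro ⟨h1, h2⟩; exact ⟨⟨i, h1⟩, h2, rfl⟩
  · rintro ⟨j, h1, rfl⟩; exact ⟨j.2, h1⟩

-- Contrapositive of `le_card_shifted`: an affected block far from all true deletions would force at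
-- least `R` erased or shifted blocks.
open Classical in
theorem exists_near {d : ℕ} {g b : Fin (numBlocks ℓ) → ℕ} (hg : IsPattern d g)
    (hb : IsPattern d b) (R : ℕ) (hlt : #{j | g j ≠ 0} + #{j | IsShifted g b j} < R)
    (j : Fin (numBlocks ℓ)) (hj : g j ≠ 0) :
    ∃ i, b i ≠ 0 ∧ (j : ℕ) ≤ i + R ∧ (i : ℕ) ≤ j + R := by
  by_contra hcon
  push Not at hcon
  have h := le_card_shifted (extendZero g) (extendZero b) (numBlocks ℓ) R j
    (by
      rw [← Fin.sum_univ_eq_sum_range, ← Fin.sum_univ_eq_sum_range]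
      simp only [extendZero_val, hg.sum_eq, hb.sum_eq]) j.2 (by simpa using hj)
    (fun i hi h1 h2 => by
      by_contra h3
      have h4 := hcon ⟨i, hi⟩ (by simpa [extendZero, hi] using h3) h1
      simp only at h4
      omega)
  refine absurd hlt (not_lt.2 (h.trans (add_le_add (le_of_eq ?_) ?_)))
  · rw [card_filter_range]; simp only [extendZero_val]
  · rw [← Finset.card_map (s := {j | IsShifted g b j}) Fin.valEmbedding]
    refine Finset.card_le_card fun i hi => ?_
    rw [Finset.mem_filter, Finset.mem_range] at hi
    obtain ⟨hi, h1, h2, h3⟩ := hi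
    refine Finset.mem_map.2 ⟨⟨i, hi⟩, Finset.mem_filter.2 ⟨Finset.mem_univ _, ?_, ?_, ?_⟩, rfl⟩
    · simpa [extendZero, hi] using h1
    · simpa [extendZero, hi] using h2
    · intro h4
      apply h3
      have e := sum_Iio_val (extendZero g) ⟨i, hi⟩
      have e' := sum_Iio_val (extendZero b) ⟨i, hi⟩
      simp only [extendZero_val] at e e'
      rw [← e, ← e', h4]

/-- The patterns with `d` deletions. -/
def patterns (K d : ℕ) : Finset (Fin K → ℕ) := Finset.piAntidiag Finset.univ d

theorem mem_patterns {K d : ℕ} {g : Fin K → ℕ} : g ∈ patterns K d ↔ ∑ j, g j = d := by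
  simp [patterns, Finset.mem_piAntidiag]

/-- The deletions are placed one after another, with `K` choices for each. -/
theorem card_patterns_le (K d : ℕ) : #(patterns K d) ≤ K ^ d := by
  induction d with
  | zero =>
    rw [pow_zero, Finset.card_le_one]
    intro a ha b hb
    rw [mem_patterns, Finset.sum_eq_zero_iff] at ha hb
    funext j
    rw [ha j (by simp), hb j (by simp)]
  | succ d ih =>
    have h : patterns K (d + 1) ⊆ (Finset.univ ×ˢ patterns K d).image
        fun q : Fin K × (Fin K → ℕ) => Function.update q.2 q.1 (q.2 q.1 + 1) := by
      intro g hg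
      rw [mem_patterns] at hg
      obtain ⟨j, -, hj⟩ := Finset.exists_ne_zero_of_sum_ne_zero (by rw [hg]; omega)
      rw [Finset.mem_image]
      refine ⟨(j, Function.update g j (g j - 1)), ?_, ?_⟩
      · rw [Finset.mem_product, mem_patterns]
        refine ⟨Finset.mem_univ _, ?_⟩
        have h1 := Finset.sum_update_of_mem (Finset.mem_univ j) g (g j - 1)
        have h2 := Finset.add_sum_erase Finset.univ g (Finset.mem_univ j)
        rw [Finset.sdiff_singleton_eq_erase] at h1
        simp only at h1 ⊢
        omega
      · simp only [Function.update_self, Function.update_idem]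
        rw [Nat.sub_add_cancel (by omega), Function.update_eq_self]
    refine (Finset.card_le_card h).trans (Finset.card_image_le.trans ?_)
    rw [Finset.card_product, Finset.card_univ, Fintype.card_fin, pow_succ']
    exact Nat.mul_le_mul_left _ ih

theorem card_support_le {K d : ℕ} {b : Fin K → ℕ} (hb : ∑ j, b j = d) : #{j | b j ≠ 0} ≤ d := by
  rw [← hb, Finset.card_filter]
  exact Finset.sum_le_sum fun j _ => by split <;> omega

/-- There are few patterns that are near to a given one. -/
theorem card_near_le {K d δ R : ℕ} (hd : d ≤ δ) (b : Fin K → ℕ) (hb : ∑ j, b j = d)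
    (s : Finset (Fin K → ℕ)) (hs : ∀ g ∈ s, ∑ j, g j = d ∧ ∀ j : Fin K, g j ≠ 0 →
      ∃ i : Fin K, b i ≠ 0 ∧ (j : ℕ) ≤ i + R ∧ (i : ℕ) ≤ j + R) :
    #s ≤ (δ + 1) ^ (δ * (2 * R + 1)) := by
  let S : Finset (Fin K) := {j | ∃ i : Fin K, b i ≠ 0 ∧ (j : ℕ) ≤ i + R ∧ (i : ℕ) ≤ j + R}
  have hS : #S ≤ δ * (2 * R + 1) := by
    have h1 : S.map Fin.valEmbedding ⊆ ({i | b i ≠ 0} : Finset (Fin K)).biUnion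
        fun i => Finset.Icc ((i : ℕ) - R) (i + R) := by
      intro x hx
      obtain ⟨j, hj, rfl⟩ := Finset.mem_map.1 hx
      obtain ⟨i, h1, h2, h3⟩ := (Finset.mem_filter.1 hj).2
      rw [Finset.mem_biUnion]
      refine ⟨i, by simpa using h1, ?_⟩
      simp only [Fin.valEmbedding_apply, Finset.mem_Icc]; omega
    rw [← Finset.card_map Fin.valEmbedding]
    refine (Finset.card_le_card h1).trans ((Finset.card_biUnion_le_card_mul _ _ (2 * R + 1)
      (fun i _ => by simp; omega)).trans ?_)
    exact Nat.mul_le_mul_right _ ((card_support_le hb).trans hd)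
  -- A near pattern vanishes outside `S` and has values at most `δ` on `S`.
  have hsub : s ⊆ Fintype.piFinset fun j => if j ∈ S then range (δ + 1) else {0} := by
    intro g hg
    obtain ⟨h1, h2⟩ := hs g hg
    rw [Fintype.mem_piFinset]
    intro j
    split
    · have := Finset.single_le_sum (fun i _ => Nat.zero_le (g i)) (Finset.mem_univ j)
      rw [Finset.mem_range]; omega
    · rename_i hj
      by_contra h
      exact hj (Finset.mem_filter.2 ⟨Finset.mem_univ _, h2 j (by simpa using h)⟩)
  refine (Finset.card_le_card hsub).trans ?_
  rw [Fintype.card_piFinset]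
  have : ∀ j : Fin K, #(if j ∈ S then range (δ + 1) else {0}) = if j ∈ S then δ + 1 else 1 := by
    intro j; split <;> simp
  simp only [this, Finset.prod_ite_mem, Finset.univ_inter, Finset.prod_const]
  exact Nat.pow_le_pow_right (by omega) hS

/-- Powers of `ℓ` are dominated by `2 ^ ℓ`. -/
theorem exists_pow_le_two_pow (n : ℕ) : ∃ A, ∀ ℓ : ℕ, ℓ ^ n ≤ A * 2 ^ ℓ := by
  obtain ⟨B, hB⟩ := (tendsto_pow_const_div_const_pow_of_one_lt n
    (one_lt_two (α := ℝ))).bddAbove_range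
  refine ⟨⌈B⌉₊, fun ℓ => ?_⟩
  have h := hB ⟨ℓ, rfl⟩
  rw [div_le_iff₀ (by positivity)] at h
  have h2 : (ℓ : ℝ) ^ n ≤ ⌈B⌉₊ * 2 ^ ℓ :=
    h.trans (mul_le_mul_of_nonneg_right (Nat.le_ceil B) (by positivity))
  exact_mod_cast h2

theorem numBlocks_pos (hℓ : 0 < ℓ) : 0 < numBlocks ℓ := by
  by_contra h
  have := numBlocks_mul_ge hℓ
  rw [show numBlocks ℓ = 0 by omega, zero_mul] at this
  exact absurd this (by simp)

theorem numBlocks_mul_le (hℓ : 0 < ℓ) : numBlocks ℓ * ℓ ≤ 2 * 2 ^ ℓ := by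
  have h1 := mul_lt_of_lt_numBlocks hℓ (Nat.sub_lt (numBlocks_pos hℓ) one_pos)
  have h2 : numBlocks ℓ * ℓ = (numBlocks ℓ - 1) * ℓ + ℓ := by
    rw [← Nat.succ_mul, Nat.succ_eq_add_one, Nat.sub_add_cancel (numBlocks_pos hℓ)]
  have h3 : ℓ < 2 ^ ℓ := Nat.lt_two_pow_self
  omega

theorem cast_le_mul_zpow {x k t : ℕ} {m : ℤ} (h : x * 2 ^ (ℓ * t) ≤ 2 ^ k) (hm : -(t : ℤ) ≤ m) :
    (x : ℝ) ≤ 2 ^ k * (2 ^ ℓ : ℝ) ^ m := by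
  have h1 : (x : ℝ) * (2 ^ ℓ) ^ t ≤ 2 ^ k := by rw [← pow_mul]; exact_mod_cast h
  have h2 : (x : ℝ) ≤ 2 ^ k * (2 ^ ℓ : ℝ) ^ (-(t : ℤ)) := by
    rw [zpow_neg, zpow_natCast, ← div_eq_mul_inv, le_div_iff₀ (by positivity)]
    exact h1
  refine h2.trans (mul_le_mul_of_nonneg_left ?_ (by positivity))
  exact zpow_le_zpow_right₀ (one_le_pow₀ (by norm_num)) hm

end

/-! ### Union bound over the guesses -/

section
variable {c ℓ : ℕ} (𝒞 : GCCode c ℓ)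
namespace GCCode

-- The first summand bounds the guesses with at least `c` erased or shifted blocks: at most
-- `numBlocks ℓ ^ δ` many, each with at most `δ` erasures. The second one belongs to the guesses
-- near the true pattern `b`, whose number depends on `δ` and `c` only and for which
-- `le_card_of_nonempty` supplies enough shifted blocks.
open Classical in
theorem sum_card_wrongSet_le {δ : ℕ} (hδ : δ < c) {φ : List (Fin (2 ^ ℓ))}
    (hφ : φ.Sublist (List.finRange (2 ^ ℓ))) (hlen : 2 ^ ℓ ≤ φ.length + δ) :
    ∑ g ∈ patterns (numBlocks ℓ) (2 ^ ℓ - φ.length) with ∀ j, g j ≤ blockLen ℓ j,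
      (#(𝒞.wrongSet φ g) : ℝ) ≤
    2 ^ 2 ^ ℓ * (numBlocks ℓ ^ δ * (2 ^ ℓ : ℝ) ^ ((δ : ℤ) - c) +
      (δ + 1) ^ (δ * (2 * c + 1)) * (2 ^ ℓ : ℝ) ^ (2 * (δ : ℤ) - 1 - c)) := by
  set d := 2 ^ ℓ - φ.length with hd
  have hdδ : d ≤ δ := by omega
  obtain ⟨b, hb1, hb2, hsub⟩ := exists_deletions 𝒞.ℓ_pos hφ
  have hb : IsPattern d b := ⟨hb2, hb1⟩
  set P := ({g ∈ patterns (numBlocks ℓ) d | ∀ j, g j ≤ blockLen ℓ j} :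
    Finset (Fin (numBlocks ℓ) → ℕ)) with hP
  have hpat : ∀ g ∈ P, IsPattern d g := fun g hg => by
    rw [hP, Finset.mem_filter, mem_patterns] at hg
    exact ⟨hg.1, hg.2⟩
  let near : (Fin (numBlocks ℓ) → ℕ) → Prop := fun g => ∀ j : Fin (numBlocks ℓ), g j ≠ 0 →
      ∃ i : Fin (numBlocks ℓ), b i ≠ 0 ∧ (j : ℕ) ≤ i + c ∧ (i : ℕ) ≤ j + c
  have hone : ∀ g ∈ P, (#(𝒞.wrongSet φ g) : ℝ) ≤ 2 ^ 2 ^ ℓ * (2 ^ ℓ : ℝ) ^ ((δ : ℤ) - c) +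
      if near g then 2 ^ 2 ^ ℓ * (2 ^ ℓ : ℝ) ^ (2 * (δ : ℤ) - 1 - c) else 0 := by
    intro g hg
    have hgp := hpat g hg
    have hz := (card_support_le hgp.sum_eq).trans hdδ
    have hzb := (card_support_le hb.sum_eq).trans hdδ
    set T : Finset (Fin (numBlocks ℓ)) := {j | IsShifted g b j} with hT
    by_cases hfar : c ≤ #{j | g j ≠ 0} + #T
    -- Exactly `c` minus the number of erasures are used, the largest size that
    -- `card_wrongSet_mul_le` admits; this is at least `c - δ`.
    · obtain ⟨T', hT', hcard⟩ := Finset.exists_subset_card_eq (s := T)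
        (n := c - #{j | g j ≠ 0}) (by omega)
      have h1 := 𝒞.card_wrongSet_mul_le hφ hgp hb hsub T'
        (fun j hj => (Finset.mem_filter.1 (hT' hj)).2) (by omega)
      refine (cast_le_mul_zpow (m := (δ : ℤ) - c) h1 (by omega)).trans ?_
      refine le_add_of_nonneg_right ?_
      split <;> positivity
    · have hfar' := hfar
      rw [hT] at hfar'
      have hnear : near g := exists_near hgp hb c (not_le.1 hfar')
      rw [if_pos hnear]
      refine le_trans ?_ (le_add_of_nonneg_left (by positivity))
      rcases (𝒞.wrongSet φ g).eq_empty_or_nonempty with he | hne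
      · rw [he]; simp only [Finset.card_empty, Nat.cast_zero]; positivity
      · have h1 := 𝒞.card_wrongSet_mul_le hφ hgp hb hsub T
          (fun j hj => (Finset.mem_filter.1 hj).2) (by omega)
        have h2 := 𝒞.le_card_of_nonempty hφ hgp hb hsub T
          (fun j hj => Finset.mem_filter.2 ⟨Finset.mem_univ _, hj⟩) hne
        exact cast_le_mul_zpow h1 (by omega)
  refine (Finset.sum_le_sum hone).trans ?_
  rw [Finset.sum_add_distrib, Finset.sum_const, ← Finset.sum_filter, Finset.sum_const,
    nsmul_eq_mul, nsmul_eq_mul]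
  have hc1 : #P ≤ numBlocks ℓ ^ δ := (Finset.card_filter_le _ _).trans ((card_patterns_le _ _).trans
    (Nat.pow_le_pow_right (numBlocks_pos 𝒞.ℓ_pos) hdδ))
  have hc2 : #{g ∈ P | near g} ≤ (δ + 1) ^ (δ * (2 * c + 1)) :=
    card_near_le hdδ b hb.sum_eq _ (fun g hg => by
      rw [Finset.mem_filter] at hg
      exact ⟨(hpat g hg.1).sum_eq, hg.2⟩)
  have hc1' : (#P : ℝ) ≤ (numBlocks ℓ : ℝ) ^ δ := by exact_mod_cast hc1
  have hc2' : (#{g ∈ P | near g} : ℝ) ≤ ((δ : ℝ) + 1) ^ (δ * (2 * c + 1)) := by exact_mod_cast hc2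
  rw [mul_add]
  refine add_le_add ?_ ?_
  · calc _ ≤ (numBlocks ℓ : ℝ) ^ δ * (2 ^ 2 ^ ℓ * (2 ^ ℓ : ℝ) ^ ((δ : ℤ) - c)) := by gcongr
      _ = _ := by ring
  · calc _ ≤ ((δ : ℝ) + 1) ^ (δ * (2 * c + 1)) *
          (2 ^ 2 ^ ℓ * (2 ^ ℓ : ℝ) ^ (2 * (δ : ℤ) - 1 - c)) := by gcongr
      _ = _ := by ring

-- The number `e` of message bits swallowed while the parities are read depends on the message,
-- whereas counting bad messages requires a fixed list of survivors. The failures are therefore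
-- covered by the cases `e = 0, …, δ`, at the price of a factor `δ + 1`.
open Classical in
theorem card_failures_le {δ : ℕ} (hδ : δ < c) (D : Finset (Fin (gcLength δ c ℓ))) (hD : #D ≤ δ) :
    (#{u : Fin (2 ^ ℓ) → Bool | 𝒞.decode δ (𝒞.received δ u D) = none} : ℝ) ≤
    (δ + 1) * (2 ^ 2 ^ ℓ * (numBlocks ℓ ^ δ * (2 ^ ℓ : ℝ) ^ ((δ : ℤ) - c) +
      (δ + 1) ^ (δ * (2 * c + 1)) * (2 ^ ℓ : ℝ) ^ (2 * (δ : ℤ) - 1 - c))) := by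
  let E := {e ∈ range (δ + 1) | 2 ^ ℓ ≤ (kept D e : List (Fin (2 ^ ℓ))).length + δ}
  let W : ℕ → Finset (Fin (2 ^ ℓ) → Bool) := fun e =>
    ({g ∈ patterns (numBlocks ℓ) (2 ^ ℓ - (kept D e : List (Fin (2 ^ ℓ))).length) |
      ∀ j, g j ≤ blockLen ℓ j} : Finset _).biUnion (𝒞.wrongSet (kept D e))
  have hsub : ({u : Fin (2 ^ ℓ) → Bool | 𝒞.decode δ (𝒞.received δ u D) = none} : Finset _) ⊆
      E.biUnion W := by
    intro u hu
    have hu' : 𝒞.decode δ (𝒞.received δ u D) = none := by simpa using hu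
    obtain ⟨e, he, hlen, h⟩ := 𝒞.readParity_received u D hD
    have hnot : ¬ ∃! Y, Y ∈ 𝒞.candidates δ (𝒞.received δ u D) := by
      intro hex
      unfold decode at hu'
      rw [dif_pos hex] at hu'
      simp at hu'
    obtain ⟨Y, hY, hne⟩ : ∃ Y, Y ∈ 𝒞.candidates δ (𝒞.received δ u D) ∧ Y ≠ 𝒞.symbols u := by
      by_contra hcon
      push Not at hcon
      exact hnot ⟨_, 𝒞.symbols_mem_candidates u D hD, hcon⟩
    obtain ⟨g, hg⟩ := (𝒞.mem_candidates_received h Y).1 hY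
    refine Finset.mem_biUnion.2 ⟨e, ?_, Finset.mem_biUnion.2 ⟨g, ?_, ?_⟩⟩
    · exact Finset.mem_filter.2 ⟨Finset.mem_range.2 (by omega), hlen⟩
    · rw [Finset.mem_filter, mem_patterns]
      exact ⟨by simpa using hg.sum_eq, hg.le_blockLen⟩
    · exact 𝒞.mem_wrongSet.2 ⟨Y, hne, hg⟩
  have h1 : (#{u : Fin (2 ^ ℓ) → Bool | 𝒞.decode δ (𝒞.received δ u D) = none} : ℝ) ≤
      ∑ e ∈ E, (#(W e) : ℝ) := by
    exact_mod_cast (Finset.card_le_card hsub).trans Finset.card_biUnion_le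
  refine h1.trans ((Finset.sum_le_card_nsmul E _ (2 ^ 2 ^ ℓ * (numBlocks ℓ ^ δ *
    (2 ^ ℓ : ℝ) ^ ((δ : ℤ) - c) + (δ + 1) ^ (δ * (2 * c + 1)) *
      (2 ^ ℓ : ℝ) ^ (2 * (δ : ℤ) - 1 - c))) (fun e he => ?_)).trans ?_)
  · refine le_trans ?_ (𝒞.sum_card_wrongSet_le hδ (kept_sublist D e) (Finset.mem_filter.1 he).2)
    exact_mod_cast Finset.card_biUnion_le
  · rw [nsmul_eq_mul]
    refine mul_le_mul_of_nonneg_right ?_ (by positivity)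
    have : #E ≤ δ + 1 := (Finset.card_filter_le _ _).trans (by simp)
    exact_mod_cast this

end GCCode
end

/-- The bound for a fixed set of deletions does not depend on that set, so it survives averaging
over `μ`. The power of `ℓ` in the denominator comes from `numBlocks ℓ ≤ 2 * 2 ^ ℓ / ℓ`. -/
theorem exists_failureProb_le (δ c : ℕ) (hδ : δ < c) : ∃ C : ℝ, 0 ≤ C ∧ ∀ (ℓ : ℕ) (𝒞 : GCCode c ℓ)
    (μ : PMF (Finset (Fin (gcLength δ c ℓ)))), (∀ D ∈ μ.support, #D ≤ δ) →
      𝒞.failureProb δ μ ≤ C * ((2 ^ ℓ : ℝ) ^ (2 * (δ : ℤ) - c) / (ℓ : ℝ) ^ δ) := by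
  classical
  obtain ⟨A, hA⟩ := exists_pow_le_two_pow δ
  refine ⟨(δ + 1) * (2 ^ δ + (δ + 1) ^ (δ * (2 * c + 1)) * A), by positivity,
    fun ℓ 𝒞 μ hμ => ?_⟩
  have hℓ : (0 : ℝ) < ℓ := by exact_mod_cast 𝒞.ℓ_pos
  set q : ℝ := 2 ^ ℓ with hq
  have hq0 : 0 < q := by positivity
  set B : ℝ := (δ + 1) * (numBlocks ℓ ^ δ * q ^ ((δ : ℤ) - c) +
      (δ + 1) ^ (δ * (2 * c + 1)) * q ^ (2 * (δ : ℤ) - 1 - c)) with hBdef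
  have hB0 : 0 ≤ B := by positivity
  have h1 : 𝒞.failureProb δ μ ≤ B := by
    have hone : ∀ D, (μ D).toReal *
        ((#{u : Fin (2 ^ ℓ) → Bool | 𝒞.decode δ (𝒞.received δ u D) = none} : ℝ) / 2 ^ (2 ^ ℓ)) ≤
        (μ D).toReal * B := by
      intro D
      by_cases hD : D ∈ μ.support
      · refine mul_le_mul_of_nonneg_left ?_ ENNReal.toReal_nonneg
        rw [div_le_iff₀ (by positivity)]
        refine (𝒞.card_failures_le hδ D (hμ D hD)).trans (le_of_eq ?_)
        rw [hBdef]; ring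
      · rw [PMF.mem_support_iff, not_not] at hD
        simp [hD]
    refine (Finset.sum_le_sum fun D _ => hone D).trans ?_
    rw [← Finset.sum_mul]
    have h2 : ∑ D, (μ D).toReal = 1 := by
      rw [← ENNReal.toReal_sum (fun D _ => μ.apply_ne_top D), ← tsum_fintype (L := .unconditional _), μ.tsum_coe]; rfl
    rw [h2, one_mul]
  refine h1.trans ?_
  have hK : (numBlocks ℓ : ℝ) ^ δ ≤ 2 ^ δ * (q ^ δ / ℓ ^ δ) := by
    have h2 : (numBlocks ℓ : ℝ) * ℓ ≤ 2 * q := by rw [hq]; exact_mod_cast numBlocks_mul_le 𝒞.ℓ_pos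
    have h3 := pow_le_pow_left₀ (by positivity) h2 δ
    rw [mul_pow, mul_pow] at h3
    rw [← mul_div_assoc, le_div_iff₀ (by positivity)]
    exact h3
  -- The near guesses gain a factor `1 / q` over the claimed bound but lack `1 / ℓ ^ δ`; one pays
  -- for the other since `ℓ ^ δ ≤ A * q`.
  have hA' : 1 ≤ A * q / (ℓ : ℝ) ^ δ := by
    rw [one_le_div (by positivity), hq]; exact_mod_cast hA ℓ
  have e1 : q ^ δ * q ^ ((δ : ℤ) - c) = q ^ (2 * (δ : ℤ) - c) := by
    rw [← zpow_natCast, ← zpow_add₀ hq0.ne']; congr 1; ring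
  have e2 : q * q ^ (2 * (δ : ℤ) - 1 - c) = q ^ (2 * (δ : ℤ) - c) := by
    rw [← zpow_one_add₀ hq0.ne']; congr 1; ring
  calc B ≤ (δ + 1) * (2 ^ δ * (q ^ δ / ℓ ^ δ) * q ^ ((δ : ℤ) - c) +
        (δ + 1) ^ (δ * (2 * c + 1)) * (q ^ (2 * (δ : ℤ) - 1 - c) * (A * q / (ℓ : ℝ) ^ δ))) := by
        rw [hBdef]
        gcongr
        exact le_mul_of_one_le_right (by positivity) hA'
    _ = (δ + 1) * (2 ^ δ * ((q ^ δ * q ^ ((δ : ℤ) - c)) / ℓ ^ δ) +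
        (δ + 1) ^ (δ * (2 * c + 1)) * A * ((q * q ^ (2 * (δ : ℤ) - 1 - c)) / (ℓ : ℝ) ^ δ)) := by ring
    _ = _ := by rw [e1, e2]; ring

/-! ### The encoding and decoding algorithms -/

/-- Padding with zeros to the length of the template `fl`. -/
def padTo (fl b : List Bool) : List Bool := b ++ (fl.drop b.length).map fun _ => false

/-- Adding `b` times the vector `row` to the vector `acc`. -/
def axpy (fl b : List Bool) (row acc : List (List Bool)) : List (List Bool) :=
  List.zipWith (fun x y => xorBits x (mulBits fl b y)) acc row

/-- The parity symbols of the message `u`. -/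
def paritySymbols (c : ℕ) (fl : List Bool) (rows : List (List (List Bool))) (u : List Bool) :
    List (List Bool) :=
  (rows.foldl (fun st row => (st.1.drop fl.length,
    axpy fl (padTo fl (st.1.take fl.length)) row st.2))
    (u, (List.replicate c ()).map fun _ => fl.map fun _ => false)).2

/-- The encoding algorithm. -/
def encodeAlg (δ c : ℕ) (fl : List Bool) (rows : List (List (List Bool))) (u : List Bool) :
    List Bool :=
  u ++ ((paritySymbols c fl rows u).flatMap fun x => x).flatMap (List.replicate (δ + 1))

/-- A block in a guess: the missing bits (in unary), the known bits and, for an erased block, the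
row of the generator matrix. -/
abbrev Entry := List Bool × List Bool × List (List Bool)

/-- A partial guess: the remaining string, the number of remaining deletions (in unary), the
parities of the known blocks and the blocks so far, the last one first. -/
abbrev Guess := List Bool × List Bool × List (List Bool) × List Entry

/-- The extension of a partial guess by a block of the length of `Lt` without deletions. -/
def extendKnown (fl : List Bool) (row : List (List Bool)) (Lt : List Bool) (it : Guess) : Guess :=
  (it.1.drop Lt.length, it.2.1, axpy fl (padTo fl (it.1.take Lt.length)) row it.2.2.1,
    ([], padTo fl (it.1.take Lt.length), []) :: it.2.2.2)

/-- The extension of a partial guess by an erased block with as many bits as `q.2` left,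
`q.1` being the remaining deletions. -/
def extendErased (fl : List Bool) (row : List (List Bool)) (it : Guess)
    (q : List Bool × List Bool) : Guess :=
  (it.1.drop q.2.length, q.1, it.2.2.1, (fl.drop q.2.length, it.1.take q.2.length, row) :: it.2.2.2)

/-- All extensions of a partial guess. -/
def extendGuess (fl : List Bool) (row : List (List Bool)) (Lt : List Bool) (it : Guess) :
    List Guess :=
  extendKnown fl row Lt it :: (it.2.1.tails.tail.zip Lt.tails.tail).map (extendErased fl row it)

/-- All guesses, together with the unread part of the template. -/
def guessFold (fl : List Bool) (rows : List (List (List Bool))) (st : List Bool × List Guess) :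
    List Bool × List Guess :=
  rows.foldl (fun st row => (st.1.drop fl.length,
    st.2.flatMap (extendGuess fl row (st.1.take fl.length)))) st

/-- One step in the enumeration of the supersequences: `q` consists of the reversed string so far,
the bits that have to follow, and the number of additional bits (in unary). -/
def superStep (q : List Bool × List Bool × List Bool) : List (List Bool × List Bool × List Bool) :=
  (if q.2.1.isEmpty then [] else [(q.2.1.headD false :: q.1, q.2.1.tail, q.2.2)]) ++
    (if q.2.2.isEmpty then [] else
      [(false :: q.1, q.2.1, q.2.2.tail), (true :: q.1, q.2.1, q.2.2.tail)])

def superFold (l : List Bool) (qs : List (List Bool × List Bool × List Bool)) :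
    List (List Bool × List Bool × List Bool) :=
  l.foldl (fun qs _ => qs.flatMap superStep) qs

/-- The supersequences of `e.2.1` with as many additional bits as `e.1`. -/
def superseqs (e : Entry) : List (List Bool) :=
  (superFold (e.2.1 ++ e.1) [([], e.2.1, e.1)]).map fun q => q.1.reverse

/-- All choices for the erased blocks, with the resulting parities. -/
def fillErased (fl : List Bool) (es : List Entry) (ps : List (List (List Bool) × List (List Bool))) :
    List (List (List Bool) × List (List Bool)) :=
  es.foldl (fun ps e => ps.flatMap fun p =>
    (superseqs e).map fun y => (axpy fl y e.2.2 p.1, y :: p.2)) ps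

/-- Joining the known blocks in `es` and the chosen blocks (both in reverse order). -/
def assemble (es : List Entry) (st : List (List Bool) × List Bool) : List (List Bool) × List Bool :=
  es.foldl (fun st e => if e.1.isEmpty then (st.1, e.2.1 ++ st.2)
    else (st.1.tail, st.1.headD [] ++ st.2)) st

def isZero (t : List (List Bool)) : Bool := t.all fun x => x.all fun b => !b

/-- The string decoded from a complete guess, if there is one. -/
def decodeGuess (fl : List Bool) (it : Guess) : List (List Bool) :=
  if it.2.1.isEmpty then
    (((fillErased fl (it.2.2.2.reverse.filter fun e => !e.1.isEmpty)
      [(it.2.2.1, [])]).filter fun p => isZero p.1).take 1).map fun p =>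
        (assemble it.2.2.2 (p.2, [])).2
  else []

/-- A unary representation of `2 ^ ℓ`. -/
def unaryTwoPow (fl : List Bool) : List Bool := fl.foldl (fun t _ => t ++ t) [false]

/-- Removing the bit `b` up to `δ` times. -/
def skipEqual (δ : ℕ) (b : Bool) (w : List Bool) : List Bool :=
  (List.replicate δ ()).foldl
    (fun w _ => if !w.isEmpty && !(Bool.xor (w.headD false) b) then w.tail else w) w

/-- Reading as many parity bits as `l` has. -/
def readBits (δ : ℕ) (l : List Bool) (st : List Bool × List Bool) : List Bool × List Bool :=
  l.foldl (fun st _ => if st.1.isEmpty then st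
    else (skipEqual δ (st.1.headD false) st.1.tail, st.1.headD false :: st.2)) st

/-- Cutting a string into `c` pieces of the length of `fl`. -/
def cutPieces (c : ℕ) (fl w : List Bool) : List (List Bool) :=
  ((List.replicate c ()).foldl (fun st _ => (st.1.drop fl.length, st.1.take fl.length :: st.2))
    (w, ([] : List (List Bool)))).2.reverse

/-- The strings decoded in the possible cases, from the received message bits `s` and the received
parity bits `p`, where `T` is a unary representation of the message length. -/
def decodedStrings (c : ℕ) (fl : List Bool) (rows : List (List (List Bool))) (T s p : List Bool) :
    List (List Bool) :=
  (guessFold fl rows (T, [(s, T.drop s.length, cutPieces c fl p, [])])).2.flatMap (decodeGuess fl)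

/-- The common element of a list, shortened to the length of `T`. -/
def commonElement (T : List Bool) (l : List (List Bool)) : Option (List Bool) :=
  if !l.isEmpty && l.tail.all fun y => (xorBits (l.headD []) y).all fun b => !b then
    some ((l.headD []).take T.length) else none

/-- The decoding algorithm. -/
def decodeAlg (δ c : ℕ) (fl : List Bool) (rows : List (List (List Bool))) (y : List Bool) :
    Option (List Bool) :=
  let T := unaryTwoPow fl
  let r := readBits δ ((List.replicate c ()).flatMap fun _ => fl) (y.reverse, [])
  commonElement T (decodedStrings c fl rows T r.1.reverse r.2)

/-! ### Correctness of the algorithms -/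

@[simp] theorem length_unaryTwoPow (fl : List Bool) : (unaryTwoPow fl).length = 2 ^ fl.length := by
  have : ∀ (t : List Bool), (fl.foldl (fun t _ => t ++ t) t).length = t.length * 2 ^ fl.length := by
    induction fl with
    | nil => simp
    | cons b l ih => intro t; rw [List.foldl_cons, ih]; simp [pow_succ]; ring
  simp [unaryTwoPow, this]

theorem skipEqual_eq (δ : ℕ) (b : Bool) (w : List Bool) :
    skipEqual δ b w = w.drop (min δ (w.takeWhile (· == b)).length) := by
  unfold skipEqual
  induction δ generalizing w with
  | zero => simp
  | succ δ ih =>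
    rw [List.replicate_succ, List.foldl_cons, ih]
    cases w with
    | nil => simp
    | cons x w =>
      by_cases hx : x = b
      · subst hx; simp [Nat.succ_min_succ]
      · have : (x == b) = false := by simpa using hx
        have h2 : Bool.xor x b = true := by cases x <;> cases b <;> simp_all
        simp [this, h2]

theorem readBits_eq (δ : ℕ) (l w o : List Bool) : readBits δ l (w, o) =
    ((readParity δ l.length w).2, (readParity δ l.length w).1 ++ o) := by
  induction l generalizing w o with
  | nil => simp [readBits, readParity]
  | cons x l ih =>
    rw [readBits, List.foldl_cons, ← readBits]
    cases w with
    | nil =>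
      simp only [List.isEmpty_nil, if_true, ih]
      cases l <;> simp [readParity]
    | cons b w =>
      simp only [List.isEmpty_cons, Bool.false_eq_true, if_false, List.headD_cons, List.tail_cons,
        ih, skipEqual_eq, List.length_cons, readParity, List.append_assoc, List.singleton_append]

/-- Taking `g` elements off the unary counter of deletions and off the template of the block at the
same time expresses the choice of `g` deletions in this block without arithmetic. Passing to `tail`
excludes `g = 0`. -/
theorem mem_tails_zip {α : Type*} {r l : List α} {q : List α × List α} :
    q ∈ r.tails.tail.zip l.tails.tail ↔
      ∃ g, 0 < g ∧ g ≤ r.length ∧ g ≤ l.length ∧ q = (r.drop g, l.drop g) := by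
  rw [List.mem_iff_getElem]
  constructor
  · rintro ⟨i, hi, rfl⟩
    simp only [List.length_zip, List.length_tail, List.length_tails] at hi
    exact ⟨i + 1, by omega, by omega, by omega, by simp [List.getElem_tails]⟩
  · rintro ⟨g, h0, h1, h2, rfl⟩
    refine ⟨g - 1, by simp; omega, ?_⟩
    simp [List.getElem_tails, Nat.sub_add_cancel h0]

/-- Each step writes either the next required bit or a free bit paid for by one of the additional
bits; when all steps are done, nothing is left of either. A supersequence may be produced in several
ways, so only membership is described. -/
theorem mem_superFold {l pre b sl : List Bool} (h : b.length + sl.length = l.length)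
    (q : List Bool × List Bool × List Bool) : q ∈ superFold l [(pre, b, sl)] ↔
      ∃ y : List Bool, y.length = l.length ∧ b.Sublist y ∧ q = (y.reverse ++ pre, [], []) := by
  have hflat : ∀ (l : List Bool) (qs : List (List Bool × List Bool × List Bool)),
      superFold l qs = qs.flatMap fun q => superFold l [q] := by
    intro l
    induction l with
    | nil => intro qs; simp [superFold]
    | cons x l ih =>
      intro qs
      have e : ∀ qs, superFold (x :: l) qs = superFold l (qs.flatMap superStep) := fun _ => rfl
      rw [e, ih]
      simp only [e]
      rw [List.flatMap_assoc]
      congr 1; funext q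
      rw [ih]; simp
  induction l generalizing pre b sl with
  | nil =>
    have hb : b = [] := List.length_eq_zero_iff.1 (by simp at h; simp [h])
    have hs : sl = [] := List.length_eq_zero_iff.1 (by simp at h; simp [h])
    subst hb hs
    simp [superFold]
  | cons x l ih =>
    have e : superFold (x :: l) [(pre, b, sl)] = superFold l (superStep (pre, b, sl)) := by
      simp [superFold]
    rw [e, hflat, List.mem_flatMap]
    simp only [List.length_cons] at h ⊢
    constructor
    · rintro ⟨q', hq', hq⟩
      simp only [superStep, List.mem_append] at hq'
      rcases hq' with hq' | hq'
      · cases b with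
        | nil => simp at hq'
        | cons b0 b =>
          simp only [List.isEmpty_cons, Bool.false_eq_true, if_false, List.headD_cons,
            List.tail_cons, List.mem_singleton] at hq'
          subst hq'
          obtain ⟨y, h1, h2, rfl⟩ := (ih (by simp at h; omega)).1 hq
          exact ⟨b0 :: y, by simp [h1], h2.cons_cons _, by simp⟩
      · cases sl with
        | nil => simp at hq'
        | cons s0 sl =>
          simp only [List.isEmpty_cons, Bool.false_eq_true, if_false, List.tail_cons,
            List.mem_cons, List.not_mem_nil, or_false] at hq'
          rcases hq' with rfl | rfl
          · obtain ⟨y, h1, h2, rfl⟩ := (ih (by simp at h; omega)).1 hq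
            exact ⟨false :: y, by simp [h1], h2.cons _, by simp⟩
          · obtain ⟨y, h1, h2, rfl⟩ := (ih (by simp at h; omega)).1 hq
            exact ⟨true :: y, by simp [h1], h2.cons _, by simp⟩
    · rintro ⟨y, h1, h2, rfl⟩
      cases y with
      | nil => simp at h1
      | cons y0 y =>
        simp only [List.length_cons, Nat.add_right_cancel_iff] at h1
        have hcase : (∃ r, b = y0 :: r ∧ r.Sublist y) ∨ (b.Sublist y ∧ sl ≠ []) := by
          rcases List.sublist_cons_iff.1 h2 with h3 | h3
          · refine Or.inr ⟨h3, fun hs => ?_⟩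
            have := h3.length_le
            simp [hs] at h; omega
          · exact Or.inl h3
        rcases hcase with ⟨b', rfl, h3⟩ | ⟨h3, hs⟩
        · refine ⟨(y0 :: pre, b', sl), by simp [superStep], ?_⟩
          exact (ih (by simp at h; omega)).2 ⟨y, h1, h3, by simp⟩
        · refine ⟨(y0 :: pre, b, sl.tail), ?_, ?_⟩
          · have : sl.isEmpty = false := by simpa using hs
            cases y0 <;> simp [superStep, this]
          · refine (ih ?_).2 ⟨y, h1, h3, by simp⟩
            have := List.length_pos_iff.2 hs
            simp; omega

theorem mem_superseqs (e : Entry) (y : List Bool) :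
    y ∈ superseqs e ↔ y.length = e.2.1.length + e.1.length ∧ e.2.1.Sublist y := by
  simp only [superseqs, List.mem_map]
  constructor
  · rintro ⟨q, hq, rfl⟩
    obtain ⟨y, h1, h2, rfl⟩ := (mem_superFold (by simp) q).1 hq
    exact ⟨by simpa using h1, by simpa using h2⟩
  · rintro ⟨h1, h2⟩
    exact ⟨_, (mem_superFold (by simp) _).2 ⟨y, by simpa using h1, h2, rfl⟩, by simp⟩

/-! ### Representations of symbols, and the enumeration of guesses -/

section
variable {c ℓ : ℕ} (𝒞 : GCCode c ℓ)
namespace GCCode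

/-- The representation of a vector of symbols. -/
noncomputable def vecBits {n : ℕ} (v : Fin n → AdjoinRoot 𝒞.f) : List (List Bool) :=
  List.ofFn fun r => 𝒞.bits (v r)

/-- The rows of the generator matrix. -/
noncomputable def rowVec (j : ℕ) : Fin c → AdjoinRoot 𝒞.f :=
  if h : j < numBlocks ℓ then 𝒞.G ⟨j, h⟩ else 0

/-- The rows of the generator matrix as bit strings. -/
noncomputable def rowBits : List (List (List Bool)) :=
  (List.range (numBlocks ℓ)).map fun j => 𝒞.vecBits (𝒞.rowVec j)

/-- Since `f` is monic, its description starts with the bit `true`. The algorithms work with the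
remaining bits, which also serve as a unary template for `ℓ`. -/
theorem description_eq :
    𝒞.description = enc (true :: 𝒞.lowCoeffs, 𝒞.rowBits) := by
  rw [description, enc_pair]
  congr 1
  · rw [enc_bits, lowCoeffs, List.ofFn_succ]
    have h := 𝒞.monic.coeff_natDegree
    rw [𝒞.natDegree_eq] at h
    congr 2
    · simp [h]
    · congr 1; funext i; simp only [Fin.val_succ]; congr 3; omega
  · rw [rowBits]
    have : (List.range (numBlocks ℓ)).map (fun j => 𝒞.vecBits (𝒞.rowVec j)) =
        List.ofFn fun j => 𝒞.vecBits (𝒞.G j) := by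
      apply List.ext_getElem <;> simp +contextual [rowVec]
    rw [this]
    change Val.ofList _ = Val.ofList _
    congr 1
    rw [List.map_ofFn]
    congr 1
    funext j
    simp only [Function.comp_apply, vecBits]
    change Val.ofList _ = Val.ofList _
    rw [List.map_ofFn]
    rfl

theorem padTo_eq {b : List Bool} (hb : b.length ≤ ℓ) :
    padTo 𝒞.lowCoeffs b = 𝒞.bits (𝒞.symbol b) := by
  rw [bits_symbol_of_le _ hb, padTo]
  simp

theorem axpy_vecBits {n : ℕ} (y : AdjoinRoot 𝒞.f) (v w : Fin n → AdjoinRoot 𝒞.f) :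
    axpy 𝒞.lowCoeffs (𝒞.bits y) (𝒞.vecBits w) (𝒞.vecBits v) = 𝒞.vecBits (v + y • w) := by
  have h0 : 𝒞.lowCoeffs ≠ [] := by
    rw [← List.length_pos_iff]; simpa using 𝒞.ℓ_pos
  have hl : ∀ r, (mulBits 𝒞.lowCoeffs (𝒞.bits y) (𝒞.bits (w r))).length = ℓ := fun r => by
    rw [length_mulBits (by simp) h0, length_lowCoeffs]
  apply List.ext_getElem (by simp [axpy, vecBits])
  intro i h1 h2
  simp only [axpy, vecBits, List.getElem_zipWith, List.getElem_ofFn]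
  rw [← 𝒞.bits_symbol (b := xorBits _ _) (by simp [hl]), symbol_xorBits _ (by simp [hl]),
    symbol_mulBits _ (by simp) (by simp), symbol_bits, symbol_bits, symbol_bits]
  rfl

theorem parity_eq_sum (Y : Fin (numBlocks ℓ) → AdjoinRoot 𝒞.f) :
    𝒞.parity Y = ∑ j, Y j • 𝒞.G j := Matrix.vecMul_eq_sum _ _

theorem sum_range_rowVec (F : ℕ → AdjoinRoot 𝒞.f) :
    ∑ j ∈ range (numBlocks ℓ), F j • 𝒞.rowVec j = ∑ j : Fin (numBlocks ℓ), F j • 𝒞.G j := by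
  rw [← Fin.sum_univ_eq_sum_range (fun j => F j • 𝒞.rowVec j)]
  exact Finset.sum_congr rfl fun j _ => by simp [rowVec]

theorem paritySymbols_eq (u : Fin (2 ^ ℓ) → Bool) :
    paritySymbols c 𝒞.lowCoeffs 𝒞.rowBits (List.ofFn u) =
      𝒞.vecBits (𝒞.parity (𝒞.symbols u)) := by
  have h0 : ((List.replicate c ()).map fun _ => 𝒞.lowCoeffs.map fun _ => false) =
      𝒞.vecBits (0 : Fin c → AdjoinRoot 𝒞.f) := by
    apply List.ext_getElem (by simp [vecBits])
    intro i h1 h2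
    rw [List.getElem_map]
    simp only [vecBits, List.getElem_ofFn, Pi.zero_apply]
    rw [List.map_const', length_lowCoeffs, ← 𝒞.symbol_zeros ℓ, bits_symbol _ (by simp)]
  have key : ∀ n, ((List.range n).map fun j => 𝒞.vecBits (𝒞.rowVec j)).foldl
      (fun st row => (st.1.drop 𝒞.lowCoeffs.length,
        axpy 𝒞.lowCoeffs (padTo 𝒞.lowCoeffs (st.1.take 𝒞.lowCoeffs.length)) row st.2))
      (List.ofFn u, 𝒞.vecBits (0 : Fin c → AdjoinRoot 𝒞.f)) = ((List.ofFn u).drop (n * ℓ),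
        𝒞.vecBits (∑ j ∈ range n,
          𝒞.symbol (((List.ofFn u).drop (j * ℓ)).take ℓ) • 𝒞.rowVec j)) := by
    intro n
    induction n with
    | zero => simp
    | succ n ih =>
      rw [List.range_succ, List.map_append, List.foldl_append, ih]
      simp only [List.map_cons, List.map_nil, List.foldl_cons, List.foldl_nil, length_lowCoeffs,
        List.drop_drop]
      rw [padTo_eq _ (by simp), axpy_vecBits, sum_range_succ, Nat.succ_mul]
  rw [paritySymbols, h0, rowBits, key, sum_range_rowVec, parity_eq_sum]
  rfl

theorem encodeAlg_eq (δ : ℕ) (u : Fin (2 ^ ℓ) → Bool) :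
    encodeAlg δ c 𝒞.lowCoeffs 𝒞.rowBits (List.ofFn u) = 𝒞.encode δ u := by
  rw [encodeAlg, paritySymbols_eq, encode_eq, parityBits, vecBits, List.flatMap_def (f := 𝒞.bits),
    List.map_ofFn]
  simp [List.flatMap_def, Function.comp_def]

theorem cutPieces_eq (p : Fin c → AdjoinRoot 𝒞.f) :
    cutPieces c 𝒞.lowCoeffs ((List.ofFn p).flatMap 𝒞.bits) = 𝒞.vecBits p := by
  have key : ∀ (L : List (AdjoinRoot 𝒞.f)) (o : List (List Bool)),
      ((List.replicate L.length ()).foldl (fun st _ => (st.1.drop 𝒞.lowCoeffs.length,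
        st.1.take 𝒞.lowCoeffs.length :: st.2)) (L.flatMap 𝒞.bits, o)).2 =
      (L.map 𝒞.bits).reverse ++ o := by
    intro L
    induction L with
    | nil => simp
    | cons a L ih =>
      intro o
      rw [List.length_cons, List.replicate_succ, List.foldl_cons, List.flatMap_cons]
      simp only [length_lowCoeffs] at ih ⊢
      rw [List.drop_left' (by simp), List.take_left' (by simp), ih]
      simp
  have := key (List.ofFn p) []
  rw [List.length_ofFn] at this
  rw [cutPieces, this, vecBits, List.append_nil, List.reverse_reverse, List.map_ofFn]
  rfl

/-! The guesses of the algorithm, with patterns of deletions indexed by the natural numbers. -/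

/-- The length of block `j`. -/
def len (ℓ j : ℕ) : ℕ := min ℓ (2 ^ ℓ - j * ℓ)

/-- The sub-block of block `j`. -/
def chunk (ℓ : ℕ) (s : List Bool) (g : ℕ → ℕ) (j : ℕ) : List Bool :=
  (s.drop (∑ i ∈ range j, (len ℓ i - g i))).take (len ℓ j - g j)

theorem chunk_congr {s : List Bool} {g g' : ℕ → ℕ} {j : ℕ} (h : ∀ i ≤ j, g i = g' i) :
    chunk ℓ s g j = chunk ℓ s g' j := by
  rw [chunk, chunk, h j le_rfl]
  congr 2
  exact sum_congr rfl fun i hi => by rw [h i (mem_range.1 hi).le]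

theorem length_chunk_le (s : List Bool) (g : ℕ → ℕ) (j : ℕ) : (chunk ℓ s g j).length ≤ ℓ := by
  simp [chunk, len]

/-- The entry of block `j`. -/
noncomputable def entry (s : List Bool) (g : ℕ → ℕ) (j : ℕ) : Entry :=
  if g j = 0 then ([], 𝒞.bits (𝒞.symbol (chunk ℓ s g j)), [])
  else (𝒞.lowCoeffs.drop (len ℓ j - g j), chunk ℓ s g j, 𝒞.vecBits (𝒞.rowVec j))

/-- The contribution of block `j` to the parities of the known blocks. -/
noncomputable def known (s : List Bool) (g : ℕ → ℕ) (j : ℕ) : Fin c → AdjoinRoot 𝒞.f :=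
  if g j = 0 then 𝒞.symbol (chunk ℓ s g j) • 𝒞.rowVec j else 0

theorem entry_congr {s : List Bool} {g g' : ℕ → ℕ} {j : ℕ} (h : ∀ i ≤ j, g i = g' i) :
    𝒞.entry s g j = 𝒞.entry s g' j := by
  rw [entry, entry, chunk_congr h, h j le_rfl]

theorem known_congr {s : List Bool} {g g' : ℕ → ℕ} {j : ℕ} (h : ∀ i ≤ j, g i = g' i) :
    𝒞.known s g j = 𝒞.known s g' j := by
  rw [known, known, chunk_congr h, h j le_rfl]

/-- The guess with the deletions `g` in the first `n` blocks. -/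
noncomputable def guess (s r : List Bool) (v : Fin c → AdjoinRoot 𝒞.f) (g : ℕ → ℕ) (n : ℕ) :
    Guess :=
  (s.drop (∑ i ∈ range n, (len ℓ i - g i)), r.drop (∑ i ∈ range n, g i),
    𝒞.vecBits (v + ∑ j ∈ range n, 𝒞.known s g j), ((List.range n).map (𝒞.entry s g)).reverse)

theorem guess_congr {s r : List Bool} {v : Fin c → AdjoinRoot 𝒞.f} {g g' : ℕ → ℕ} {n : ℕ}
    (h : ∀ i < n, g i = g' i) : 𝒞.guess s r v g n = 𝒞.guess s r v g' n := by
  unfold guess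
  congr 2
  · exact sum_congr rfl fun i hi => by rw [h i (mem_range.1 hi)]
  · congr 1
    exact sum_congr rfl fun i hi => by rw [h i (mem_range.1 hi)]
  · congr 1
    · congr 2
      exact sum_congr rfl fun i hi => 𝒞.known_congr fun k hk =>
        h k (hk.trans_lt (mem_range.1 hi))
    · congr 1
      exact List.map_congr_left fun i hi => 𝒞.entry_congr fun k hk =>
        h k (hk.trans_lt (List.mem_range.1 hi))

/-- A partial guess depends only on the values of `g` below `n`, so an extension amounts to the
choice of the value at `n`: zero for `extendKnown`, positive for `extendErased`. -/
theorem extendGuess_guess (s r : List Bool) (v : Fin c → AdjoinRoot 𝒞.f) (g : ℕ → ℕ) (n : ℕ)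
    {Lt : List Bool} (hLt : Lt.length = len ℓ n) (hr : ∑ i ∈ range n, g i ≤ r.length) (x : Guess) :
    x ∈ extendGuess 𝒞.lowCoeffs (𝒞.vecBits (𝒞.rowVec n)) Lt (𝒞.guess s r v g n) ↔
      ∃ g', (∀ i < n, g' i = g i) ∧ g' n ≤ len ℓ n ∧ ∑ i ∈ range (n + 1), g' i ≤ r.length ∧
        x = 𝒞.guess s r v g' (n + 1) := by
  have hupd : ∀ a, ∀ i < n, Function.update g n a i = g i := fun a i hi => by
    simp [hi.ne]
  have h1 : ∀ g' : ℕ → ℕ, (∀ i < n, g' i = g i) → g' n = 0 →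
      extendKnown 𝒞.lowCoeffs (𝒞.vecBits (𝒞.rowVec n)) Lt (𝒞.guess s r v g n) =
        𝒞.guess s r v g' (n + 1) := by
    intro g' hg' h0
    rw [← 𝒞.guess_congr hg']
    have hc : chunk ℓ s g' n = (s.drop (∑ i ∈ range n, (len ℓ i - g' i))).take Lt.length := by
      rw [chunk, h0, hLt, Nat.sub_zero]
    simp only [extendKnown, guess, ← hc]
    rw [padTo_eq _ (length_chunk_le _ _ _), axpy_vecBits]
    simp only [sum_range_succ, List.range_succ, List.map_append, List.map_cons, List.map_nil,
      List.reverse_append, List.reverse_cons, List.reverse_nil, List.nil_append, List.singleton_append,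
      h0, hLt, List.drop_drop, Nat.sub_zero, add_zero]
    rw [entry, known, if_pos h0, if_pos h0, add_assoc]
  have h2 : ∀ g' : ℕ → ℕ, (∀ i < n, g' i = g i) → g' n ≠ 0 → g' n ≤ len ℓ n →
      extendErased 𝒞.lowCoeffs (𝒞.vecBits (𝒞.rowVec n)) (𝒞.guess s r v g n)
        ((𝒞.guess s r v g n).2.1.drop (g' n), Lt.drop (g' n)) = 𝒞.guess s r v g' (n + 1) := by
    intro g' hg' h0 hle
    rw [← 𝒞.guess_congr hg']
    have hl : (Lt.drop (g' n)).length = len ℓ n - g' n := by rw [List.length_drop, hLt]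
    simp only [extendErased, guess, hl]
    simp only [sum_range_succ, List.range_succ, List.map_append, List.map_cons, List.map_nil,
      List.reverse_append, List.reverse_cons, List.reverse_nil, List.nil_append, List.singleton_append,
      List.drop_drop]
    rw [entry, known, if_neg h0, if_neg h0, add_zero, chunk]
  have hlen : (𝒞.guess s r v g n).2.1.length = r.length - ∑ i ∈ range n, g i := by simp [guess]
  rw [extendGuess, List.mem_cons, List.mem_map]
  constructor
  · rintro (rfl | ⟨q, hq, rfl⟩)
    · refine ⟨Function.update g n 0, hupd 0, by simp, ?_, h1 _ (hupd 0) (by simp)⟩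
      rw [sum_range_succ, sum_congr rfl fun i hi => hupd 0 i (mem_range.1 hi)]
      simpa using hr
    · obtain ⟨a, ha0, ha1, ha2, rfl⟩ := mem_tails_zip.1 hq
      have h3 := h2 (Function.update g n a) (hupd a) (by simp; omega) (by simp; omega)
      rw [Function.update_self] at h3
      refine ⟨Function.update g n a, hupd a, by simp; omega, ?_, h3⟩
      have hs : ∑ i ∈ range n, Function.update g n a i = ∑ i ∈ range n, g i :=
        sum_congr rfl fun i hi => hupd a i (mem_range.1 hi)
      rw [sum_range_succ, hs, Function.update_self]
      omega
  · rintro ⟨g', hg', h3, h4, rfl⟩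
    have hs : ∑ i ∈ range n, g' i = ∑ i ∈ range n, g i :=
      sum_congr rfl fun i hi => hg' i (mem_range.1 hi)
    rw [sum_range_succ, hs] at h4
    by_cases h0 : g' n = 0
    · exact Or.inl (h1 g' hg' h0).symm
    · exact Or.inr ⟨_, mem_tails_zip.2 ⟨g' n, by omega, by omega, by omega, rfl⟩, h2 g' hg' h0 h3⟩

/-- Partial guesses need not use up the available deletions, hence the inequality for the sum;
guesses with deletions left over at the end are discarded by `decodeGuess`. -/
theorem mem_guessFold (T s r : List Bool) (hT : T.length = 2 ^ ℓ) (v : Fin c → AdjoinRoot 𝒞.f)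
    (n : ℕ) :
    (guessFold 𝒞.lowCoeffs ((List.range n).map fun j => 𝒞.vecBits (𝒞.rowVec j))
      (T, [(s, r, 𝒞.vecBits v, [])])).1 = T.drop (n * ℓ) ∧
    ∀ x, x ∈ (guessFold 𝒞.lowCoeffs ((List.range n).map fun j => 𝒞.vecBits (𝒞.rowVec j))
      (T, [(s, r, 𝒞.vecBits v, [])])).2 ↔
        ∃ g, (∀ i < n, g i ≤ len ℓ i) ∧ ∑ i ∈ range n, g i ≤ r.length ∧
          x = 𝒞.guess s r v g n := by
  induction n with
  | zero => simp [guessFold, guess]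
  | succ n ih =>
    obtain ⟨ih1, ih2⟩ := ih
    have e : guessFold 𝒞.lowCoeffs ((List.range (n + 1)).map fun j => 𝒞.vecBits (𝒞.rowVec j))
      (T, [(s, r, 𝒞.vecBits v, [])]) = guessFold 𝒞.lowCoeffs [𝒞.vecBits (𝒞.rowVec n)]
        (guessFold 𝒞.lowCoeffs ((List.range n).map fun j => 𝒞.vecBits (𝒞.rowVec j))
      (T, [(s, r, 𝒞.vecBits v, [])])) := by
      rw [List.range_succ, List.map_append, guessFold, List.foldl_append]
      rfl
    rw [e]
    set st := guessFold 𝒞.lowCoeffs ((List.range n).map fun j => 𝒞.vecBits (𝒞.rowVec j))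
      (T, [(s, r, 𝒞.vecBits v, [])]) with hst
    simp only [guessFold, List.foldl_cons, List.foldl_nil, length_lowCoeffs, ih1]
    refine ⟨by rw [List.drop_drop, Nat.succ_mul], fun x => ?_⟩
    have hLt : ((T.drop (n * ℓ)).take ℓ).length = len ℓ n := by simp [hT, len]
    rw [List.mem_flatMap]
    constructor
    · rintro ⟨it, hit, hx⟩
      obtain ⟨g, h1, h2, rfl⟩ := (ih2 it).1 hit
      obtain ⟨g', h3, h4, h5, rfl⟩ := (𝒞.extendGuess_guess s r v g n hLt h2 x).1 hx
      refine ⟨g', fun i hi => ?_, h5, rfl⟩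
      rcases Nat.lt_succ_iff_lt_or_eq.1 hi with h | rfl
      · rw [h3 i h]; exact h1 i h
      · exact h4
    · rintro ⟨g, h1, h2, rfl⟩
      have h3 : ∑ i ∈ range n, g i ≤ r.length := by rw [sum_range_succ] at h2; omega
      exact ⟨_, (ih2 _).2 ⟨g, fun i hi => h1 i (by omega), h3, rfl⟩,
        (𝒞.extendGuess_guess s r v g n hLt h3 _).2 ⟨g, fun _ _ => rfl, h1 n (by omega), h2, rfl⟩⟩

end GCCode
end

/-! ### Decoding a complete guess by enumeration -/

section
variable {c ℓ : ℕ} (𝒞 : GCCode c ℓ)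
namespace GCCode

theorem isEmpty_entry_fst (s : List Bool) (g : ℕ → ℕ) (j : ℕ) :
    (𝒞.entry s g j).1.isEmpty = decide (g j = 0) := by
  have := 𝒞.ℓ_pos
  by_cases h : g j = 0
  · simp [entry, h]
  · have h1 : ((𝒞.lowCoeffs.drop (len ℓ j - g j)).isEmpty) = false := by
      rw [List.isEmpty_eq_false_iff, ← List.length_pos_iff]
      simp [len]; omega
    simp [entry, h, h1]

theorem fillErased_append (fl : List Bool) (es es' : List Entry)
    (ps : List (List (List Bool) × List (List Bool))) :
    fillErased fl (es ++ es') ps = fillErased fl es' (fillErased fl es ps) :=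
  List.foldl_append

theorem mem_fillErased_singleton (fl : List Bool) (e : Entry)
    (ps : List (List (List Bool) × List (List Bool))) (x : List (List Bool) × List (List Bool)) :
    x ∈ fillErased fl [e] ps ↔ ∃ p ∈ ps, ∃ y ∈ superseqs e, (axpy fl y e.2.2 p.1, y :: p.2) = x := by
  simp [fillErased]

theorem mem_fillErased {s : List Bool} {g : ℕ → ℕ} (v : Fin c → AdjoinRoot 𝒞.f) {n : ℕ}
    (hlen : ∀ j < n, g j ≠ 0 → (chunk ℓ s g j).length = len ℓ j - g j)
    (x : List (List Bool) × List (List Bool)) :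
    x ∈ fillErased 𝒞.lowCoeffs (((List.range n).map (𝒞.entry s g)).filter fun e => !e.1.isEmpty)
      [(𝒞.vecBits v, [])] ↔ ∃ Y : ℕ → AdjoinRoot 𝒞.f,
        (∀ j < n, g j ≠ 0 → (chunk ℓ s g j).Sublist (𝒞.bits (Y j))) ∧
        x = (𝒞.vecBits (v + ∑ j ∈ range n, if g j = 0 then 0 else Y j • 𝒞.rowVec j),
          (((List.range n).filter fun j => g j ≠ 0).map fun j => 𝒞.bits (Y j)).reverse) := by
  induction n generalizing x with
  | zero => simp [fillErased]
  | succ n ih =>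
    have ih := ih fun j hj => hlen j (by omega)
    rw [List.range_succ, List.map_append, List.filter_append, fillErased_append,
      List.filter_append]
    simp only [List.map_cons, List.map_nil, List.filter_cons, List.filter_nil, isEmpty_entry_fst]
    by_cases h0 : g n = 0
    · have hn : ∀ ps, fillErased 𝒞.lowCoeffs [] ps = ps := fun _ => rfl
      simp only [h0, decide_true, Bool.not_true, Bool.false_eq_true, if_false, hn, ih,
        ne_eq, not_true, decide_false, List.append_nil, sum_range_succ, if_true, add_zero]
      refine exists_congr fun Y => and_congr_left fun _ => ⟨fun h j hj hg => ?_,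
        fun h j hj => h j (by omega)⟩
      rcases Nat.lt_succ_iff_lt_or_eq.1 hj with h' | rfl
      · exact h j h' hg
      · exact absurd h0 hg
    · have he : 𝒞.entry s g n =
          (𝒞.lowCoeffs.drop (len ℓ n - g n), chunk ℓ s g n, 𝒞.vecBits (𝒞.rowVec n)) := if_neg h0
      have hl : (chunk ℓ s g n).length + (𝒞.lowCoeffs.drop (len ℓ n - g n)).length = ℓ := by
        rw [hlen n (by omega) h0]
        simp [len]
      simp only [h0, decide_false, Bool.not_false, if_true, mem_fillErased_singleton, mem_superseqs, he, hl, ih, ne_eq, not_false_eq_true,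
        decide_true, sum_range_succ, if_false, List.map_append, List.reverse_append, List.map_cons,
        List.map_nil, List.reverse_cons, List.reverse_nil, List.nil_append, List.singleton_append]
      constructor
      · rintro ⟨p, ⟨Y, hY, rfl⟩, y, ⟨hy1, hy2⟩, rfl⟩
        obtain ⟨a, rfl⟩ : ∃ a, 𝒞.bits a = y := ⟨_, 𝒞.bits_symbol hy1⟩
        have hu : ∀ j < n, Function.update Y n a j = Y j := fun j hj => by simp [hj.ne]
        refine ⟨Function.update Y n a, fun j hj hg => ?_, ?_⟩
        · rcases Nat.lt_succ_iff_lt_or_eq.1 hj with h' | rfl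
          · rw [hu j h']; exact hY j h' hg
          · simpa using hy2
        · dsimp only
          rw [axpy_vecBits, add_assoc, Function.update_self]
          have e1 : ∑ j ∈ range n, (if g j = 0 then 0 else Y j • 𝒞.rowVec j) =
              ∑ j ∈ range n, if g j = 0 then 0 else Function.update Y n a j • 𝒞.rowVec j :=
            sum_congr rfl fun j hj => by rw [hu j (mem_range.1 hj)]
          have e2 : ((List.range n).filter fun j => !decide (g j = 0)).map (fun j => 𝒞.bits (Y j)) =
              ((List.range n).filter fun j => !decide (g j = 0)).map
                fun j => 𝒞.bits (Function.update Y n a j) :=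
            List.map_congr_left fun j hj => by
              rw [hu j (List.mem_range.1 (List.mem_of_mem_filter hj))]
          simp only [decide_not, e1, e2]
      · rintro ⟨Y, hY, rfl⟩
        refine ⟨_, ⟨Y, fun j hj => hY j (by omega), rfl⟩, 𝒞.bits (Y n),
          ⟨by simp, hY n (by omega) h0⟩, ?_⟩
        dsimp only
        rw [axpy_vecBits, add_assoc]

theorem assemble_entries {s : List Bool} {g : ℕ → ℕ} {Y : ℕ → AdjoinRoot 𝒞.f} {n : ℕ}
    (h : ∀ j < n, g j = 0 → Y j = 𝒞.symbol (chunk ℓ s g j)) (tl : List (List Bool))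
    (out : List Bool) :
    assemble ((List.range n).map (𝒞.entry s g)).reverse
      ((((List.range n).filter fun j => g j ≠ 0).map fun j => 𝒞.bits (Y j)).reverse ++ tl, out) =
      (tl, (List.range n).flatMap (fun j => 𝒞.bits (Y j)) ++ out) := by
  induction n generalizing out with
  | zero => simp [assemble]
  | succ n ih =>
    have ih := ih fun j hj => h j (by omega)
    rw [List.range_succ, List.map_append, List.reverse_append, List.filter_append, List.map_append,
      List.reverse_append, List.flatMap_append]
    simp only [List.map_cons, List.map_nil, List.reverse_cons, List.reverse_nil, List.nil_append,
      List.singleton_append, List.filter_cons, List.filter_nil, List.flatMap_cons, List.flatMap_nil]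
    rw [assemble, List.foldl_cons, ← assemble, isEmpty_entry_fst]
    by_cases h0 : g n = 0
    · have : (𝒞.entry s g n).2.1 = 𝒞.bits (Y n) := by rw [h n (by omega) h0]; simp [entry, h0]
      simp only [h0, decide_true, if_true, ne_eq, not_true, decide_false, Bool.false_eq_true,
        if_false, List.map_nil, List.reverse_nil, List.nil_append, this]
      rw [ih]; simp
    · simp only [h0, decide_false, Bool.false_eq_true, if_false, ne_eq, not_false_eq_true,
        decide_true, if_true, List.map_cons, List.map_nil, List.reverse_cons, List.reverse_nil,
        List.nil_append, List.cons_append, List.tail_cons, List.headD_cons]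
      rw [ih]; simp

theorem isZero_vecBits {n : ℕ} (v : Fin n → AdjoinRoot 𝒞.f) :
    isZero (𝒞.vecBits v) = true ↔ v = 0 := by
  have key : ∀ a, ((𝒞.bits a).all fun b => !b) = true ↔ a = 0 := by
    intro a
    have : ((𝒞.bits a).all fun b => !b) = true ↔ 𝒞.bits a = List.replicate ℓ false := by
      rw [List.eq_replicate_iff, List.all_eq_true]
      simp
    rw [this, ← 𝒞.symbol_zeros ℓ]
    constructor
    · intro h; rw [← h, symbol_bits]
    · rintro rfl; exact 𝒞.bits_symbol (by simp)
  simp only [isZero, vecBits, List.all_eq_true (l := List.ofFn _), List.forall_mem_ofFn_iff, key]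
  exact funext_iff.symm

/-- Starting from the vector `v` of received parities, a filling of the erased blocks succeeds if
the sum with all contributions vanishes, characteristic 2 making this the equality of parities. At
most `δ < c` blocks are erased, so the solution is unique by the MDS property; keeping only the
first filling found loses nothing and removes repetitions. -/
theorem mem_decodeGuess {δ : ℕ} (hc : δ < c) {s r : List Bool} {g : ℕ → ℕ}
    (v : Fin c → AdjoinRoot 𝒞.f) (hr : ∑ j ∈ range (numBlocks ℓ), g j = r.length)
    (hrδ : r.length ≤ δ)
    (hlen : ∀ j < numBlocks ℓ, g j ≠ 0 → (chunk ℓ s g j).length = len ℓ j - g j)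
    (x : List Bool) :
    x ∈ decodeGuess 𝒞.lowCoeffs (𝒞.guess s r v g (numBlocks ℓ)) ↔ ∃ Y : ℕ → AdjoinRoot 𝒞.f,
      (∀ j < numBlocks ℓ, g j = 0 → Y j = 𝒞.symbol (chunk ℓ s g j)) ∧
      (∀ j < numBlocks ℓ, g j ≠ 0 → (chunk ℓ s g j).Sublist (𝒞.bits (Y j))) ∧
      v + ∑ j ∈ range (numBlocks ℓ), Y j • 𝒞.rowVec j = 0 ∧
      x = (List.range (numBlocks ℓ)).flatMap fun j => 𝒞.bits (Y j) := by
  set K := numBlocks ℓ with hK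
  have hsplit : ∀ Y : ℕ → AdjoinRoot 𝒞.f, (∀ j < K, g j = 0 → Y j = 𝒞.symbol (chunk ℓ s g j)) →
      v + ∑ j ∈ range K, 𝒞.known s g j + ∑ j ∈ range K, (if g j = 0 then 0 else Y j • 𝒞.rowVec j) =
        v + ∑ j ∈ range K, Y j • 𝒞.rowVec j := by
    intro Y hY
    rw [add_assoc, ← sum_add_distrib]
    congr 1
    refine sum_congr rfl fun j hj => ?_
    by_cases h0 : g j = 0
    · simp [known, h0, hY j (mem_range.1 hj) h0]
    · simp [known, h0]
  set P := (fillErased 𝒞.lowCoeffs (((List.range K).map (𝒞.entry s g)).filter fun e => !e.1.isEmpty)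
      [(𝒞.vecBits (v + ∑ j ∈ range K, 𝒞.known s g j), [])]).filter fun p => isZero p.1 with hP
  have hdec : decodeGuess 𝒞.lowCoeffs (𝒞.guess s r v g K) = (P.take 1).map fun p =>
      (assemble ((List.range K).map (𝒞.entry s g)).reverse (p.2, [])).2 := by
    have : (𝒞.guess s r v g K).2.1.isEmpty = true := by simp [guess, hr]
    rw [decodeGuess, if_pos this]
    simp only [guess, List.reverse_reverse]
    rfl
  -- the elements of `P` are the solutions
  have hmem : ∀ p, p ∈ P → ∃ Y : ℕ → AdjoinRoot 𝒞.f,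
      (∀ j < K, g j = 0 → Y j = 𝒞.symbol (chunk ℓ s g j)) ∧
      (∀ j < K, g j ≠ 0 → (chunk ℓ s g j).Sublist (𝒞.bits (Y j))) ∧
      v + ∑ j ∈ range K, Y j • 𝒞.rowVec j = 0 ∧
      (assemble ((List.range K).map (𝒞.entry s g)).reverse (p.2, [])).2 =
        (List.range K).flatMap fun j => 𝒞.bits (Y j) := by
    intro p hp
    obtain ⟨hp1, hp2⟩ := List.mem_filter.1 hp
    obtain ⟨Y, hY, rfl⟩ := (𝒞.mem_fillErased _ hlen p).1 hp1
    have hYY : ∀ j, g j ≠ 0 → (if g j = 0 then 𝒞.symbol (chunk ℓ s g j) else Y j) = Y j :=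
      fun j hj => if_neg hj
    have h1 : ∀ j < K, g j = 0 → (if g j = 0 then 𝒞.symbol (chunk ℓ s g j) else Y j) =
        𝒞.symbol (chunk ℓ s g j) := fun j _ hj => if_pos hj
    refine ⟨fun j => if g j = 0 then 𝒞.symbol (chunk ℓ s g j) else Y j, h1,
      fun j hj hg => ?_, ?_, ?_⟩
    · simpa only [hYY j hg] using hY j hj hg
    · rw [← hsplit _ h1]
      refine Eq.trans ?_ ((𝒞.isZero_vecBits _).1 hp2)
      congr 1
      exact sum_congr rfl fun j _ => by split <;> rfl
    · have := 𝒞.assemble_entries (n := K) h1 [] []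
      rw [List.append_nil, List.append_nil] at this
      refine Eq.trans ?_ (congrArg Prod.snd this)
      dsimp only
      congr 4
      refine List.map_congr_left fun j hj => ?_
      rw [hYY j (by simpa using (List.mem_filter.1 hj).2)]
  rw [hdec]
  constructor
  · intro hx
    obtain ⟨p, hp, rfl⟩ := List.mem_map.1 hx
    obtain ⟨Y, h1, h2, h3, h4⟩ := hmem p (List.mem_of_mem_take hp)
    exact ⟨Y, h1, h2, h3, h4⟩
  · rintro ⟨Y, h1, h2, h3, rfl⟩
    have hne : P ≠ [] := by
      refine List.ne_nil_of_mem (a := _) (List.mem_filter.2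
        ⟨(𝒞.mem_fillErased _ hlen _).2 ⟨Y, h2, rfl⟩, ?_⟩)
      rw [hsplit Y h1]
      exact (𝒞.isZero_vecBits _).2 h3
    obtain ⟨p, P', hPP⟩ := List.exists_cons_of_ne_nil hne
    obtain ⟨Y', h1', h2', h3', h4'⟩ := hmem p (by rw [hPP]; simp)
    rw [hPP]
    simp only [List.take_succ_cons, List.take_zero, List.map_cons, List.map_nil,
      List.mem_singleton]
    rw [h4']
    -- Two solutions for the same guess agree in the unerased blocks, and their parities are equal.
    have hz := 𝒞.eq_zero_of_parity_eq_zero (Z := fun j : Fin K => Y j - Y' j) ?_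
      {j : Fin K | g j ≠ 0} ?_ ?_
    · rw [List.flatMap_def, List.flatMap_def]
      congr 1
      refine List.map_congr_left fun j hj => ?_
      have := congrFun hz ⟨j, List.mem_range.1 hj⟩
      rw [sub_eq_zero.1 this]
    · have e : (fun j : Fin K => Y j - Y' j) = (fun j : Fin K => Y j) - fun j : Fin K => Y' j := rfl
      rw [e, parity_sub, parity_eq_sum, parity_eq_sum, ← sum_range_rowVec, ← sum_range_rowVec]
      rw [← add_sub_add_left_eq_sub _ _ v, ← hK, h3, h3', sub_zero]
    · refine le_trans ?_ (hrδ.trans hc.le)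
      rw [← hr, ← Fin.sum_univ_eq_sum_range (fun j => g j), Finset.card_filter]
      exact sum_le_sum fun j _ => by split <;> omega
    · intro j hj
      have h0 : g j = 0 := by simpa using hj
      rw [h1 j j.2 h0, h1' j j.2 h0, sub_self]

end GCCode
end

theorem all_not_xorBits {a b : List Bool} (h : a.length = b.length) :
    ((xorBits a b).all fun x => !x) = true ↔ a = b := by
  induction a generalizing b with
  | nil => cases b <;> simp_all [xorBits]
  | cons x a ih =>
    cases b with
    | nil => simp at h
    | cons y b =>
      have := ih (b := b) (by simpa using h)
      simp only [xorBits] at this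
      simp only [xorBits, List.zipWith_cons_cons, List.all_cons, Bool.and_eq_true, this,
        List.cons.injEq]
      cases x <;> cases y <;> simp

/-! ### The decoding algorithm computes the decoder -/

section
variable {c ℓ : ℕ} (𝒞 : GCCode c ℓ)
namespace GCCode

theorem subBlock_eq_chunk (s : List Bool) (g : ℕ → ℕ) (j : Fin (numBlocks ℓ)) :
    subBlock s (fun i => g i) j = chunk ℓ s g j := by
  have := sum_Iio_val (fun i => len ℓ i - g i) j
  rw [chunk, ← this]
  rfl

theorem mem_decodedStrings {δ : ℕ} (hc : δ < c) {T s : List Bool} (hT : T.length = 2 ^ ℓ)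
    (hs : s.length ≤ 2 ^ ℓ) (hsδ : 2 ^ ℓ ≤ s.length + δ) (p : Fin c → AdjoinRoot 𝒞.f)
    (x : List Bool) :
    x ∈ decodedStrings c 𝒞.lowCoeffs 𝒞.rowBits T s ((List.ofFn p).flatMap 𝒞.bits) ↔
      ∃ Y, (∃ g, 𝒞.IsPossible p s g Y) ∧ (List.ofFn Y).flatMap 𝒞.bits = x := by
  set r := T.drop s.length with hr
  have hrl : r.length = 2 ^ ℓ - s.length := by simp [hr, hT]
  have hlen : ∀ g : ℕ → ℕ, (∀ i < numBlocks ℓ, g i ≤ len ℓ i) →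
      ∑ i ∈ range (numBlocks ℓ), g i = r.length → ∀ j < numBlocks ℓ, g j ≠ 0 →
      (chunk ℓ s g j).length = len ℓ j - g j := by
    intro g h1 h2 j hj _
    have := length_subBlock 𝒞.ℓ_pos hs (g := fun i => g i) (fun i => h1 i i.2)
      (by rw [Fin.sum_univ_eq_sum_range (fun i => g i), h2, hrl]) ⟨j, hj⟩
    rw [subBlock_eq_chunk] at this
    exact this
  have hflat : ∀ Y : ℕ → AdjoinRoot 𝒞.f, (List.ofFn fun j : Fin (numBlocks ℓ) => Y j).flatMap 𝒞.bits =
      (List.range (numBlocks ℓ)).flatMap fun j => 𝒞.bits (Y j) := by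
    intro Y
    rw [List.flatMap_def, List.flatMap_def, List.map_ofFn]
    congr 1
    apply List.ext_getElem <;> simp
  have hpar : ∀ Y : ℕ → AdjoinRoot 𝒞.f, p + ∑ j ∈ range (numBlocks ℓ), Y j • 𝒞.rowVec j = 0 ↔
      𝒞.parity (fun j => Y j) = p := by
    intro Y
    rw [sum_range_rowVec, ← parity_eq_sum, add_comm, funext_iff, funext_iff]
    exact forall_congr' fun r => CharTwo.add_eq_zero
  rw [decodedStrings, cutPieces_eq, List.mem_flatMap, rowBits]
  constructor
  · rintro ⟨it, hit, hx⟩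
    obtain ⟨g, h1, h2, rfl⟩ := ((𝒞.mem_guessFold T s r hT p (numBlocks ℓ)).2 it).1 hit
    rcases h2.lt_or_eq with h2 | h2
    · have : (𝒞.guess s r p g (numBlocks ℓ)).2.1.isEmpty = false := by
        rw [List.isEmpty_eq_false_iff, ← List.length_pos_iff]
        simp [guess]; omega
      simp [decodeGuess, this] at hx
    · obtain ⟨Y, h3, h4, h5, rfl⟩ := (𝒞.mem_decodeGuess hc p h2 (by omega) (hlen g h1 h2) x).1 hx
      have hp := (hpar Y).1 h5
      refine ⟨fun j => Y j, ⟨fun j => g j, ?_, fun j => h1 j j.2, fun j hj => ?_,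
        fun r _ => congrFun hp r, fun r _ => congrFun hp r, fun j hj => ?_⟩, hflat Y⟩
      · rw [Fin.sum_univ_eq_sum_range (fun i => g i), h2, hrl]
      · rw [subBlock_eq_chunk]; exact h3 j j.2 hj
      · rw [subBlock_eq_chunk]; exact h4 j j.2 hj
  · rintro ⟨Y', ⟨g', hg⟩, rfl⟩
    obtain ⟨g, rfl⟩ : ∃ g : ℕ → ℕ, (fun j : Fin (numBlocks ℓ) => g j) = g' :=
      ⟨extendZero g', funext fun j => extendZero_val g' j⟩
    obtain ⟨Y, rfl⟩ : ∃ Y : ℕ → AdjoinRoot 𝒞.f, (fun j : Fin (numBlocks ℓ) => Y j) = Y' :=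
      ⟨fun j => if h : j < numBlocks ℓ then Y' ⟨j, h⟩ else 0, by simp⟩
    have h1 : ∀ i < numBlocks ℓ, g i ≤ len ℓ i := fun i hi => hg.le_blockLen ⟨i, hi⟩
    have h2 : ∑ i ∈ range (numBlocks ℓ), g i = r.length := by
      rw [← Fin.sum_univ_eq_sum_range (fun i => g i), hg.sum_eq, hrl]
    refine ⟨_, ((𝒞.mem_guessFold T s r hT p (numBlocks ℓ)).2 _).2 ⟨g, h1, h2.le, rfl⟩,
      (𝒞.mem_decodeGuess hc p h2 (by omega) (hlen g h1 h2) _).2 ⟨Y, fun j hj h0 => ?_,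
        fun j hj h0 => ?_, (hpar Y).2 hg.parity_eq, hflat Y⟩⟩
    · have := hg.unerased ⟨j, hj⟩ h0
      rwa [subBlock_eq_chunk] at this
    · have := hg.criterion2 ⟨j, hj⟩ h0
      rwa [subBlock_eq_chunk] at this

theorem flatMap_bits_injective {n : ℕ} :
    Function.Injective fun Y : Fin n → AdjoinRoot 𝒞.f => (List.ofFn Y).flatMap 𝒞.bits := by
  intro Y Z h
  funext j
  apply 𝒞.bits_injective
  rw [← drop_take_flatMap_bits, ← drop_take_flatMap_bits]
  simp only at h
  rw [h]

-- Strings of symbols are determined by their bits, so all entries of the list equal its head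
-- precisely when `S` has a single element; an empty list corresponds to an empty `S`.
open Classical in
theorem commonElement_eq {T : List Bool} {l : List (List Bool)}
    {S : Set (Fin (numBlocks ℓ) → AdjoinRoot 𝒞.f)}
    (h : ∀ x, x ∈ l ↔ ∃ Y ∈ S, (List.ofFn Y).flatMap 𝒞.bits = x) :
    commonElement T l = if h : ∃! Y, Y ∈ S then
      some (((List.ofFn h.choose).flatMap 𝒞.bits).take T.length) else none := by
  cases l with
  | nil =>
    rw [dif_neg]
    · rfl
    · rintro ⟨Y, hY, _⟩
      simpa using (h _).2 ⟨Y, hY, rfl⟩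
  | cons a t =>
    have hlen : ∀ x ∈ a :: t, x.length = numBlocks ℓ * ℓ := by
      intro x hx
      obtain ⟨Y, _, rfl⟩ := (h x).1 hx
      rw [length_flatMap_bits, List.length_ofFn]
    obtain ⟨Y, hY, rfl⟩ := (h a).1 (by simp)
    have hall : (t.all fun y => (xorBits ((List.ofFn Y).flatMap 𝒞.bits) y).all fun b => !b) =
        true ↔ ∃! Y, Y ∈ S := by
      rw [List.all_eq_true]
      constructor
      · intro ht
        refine ⟨Y, hY, fun Z hZ => 𝒞.flatMap_bits_injective ?_⟩
        rcases List.mem_cons.1 ((h _).2 ⟨Z, hZ, rfl⟩) with h1 | h1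
        · exact h1
        · exact ((all_not_xorBits (by
            rw [hlen _ (List.mem_cons_of_mem _ h1), hlen _ (by simp)])).1 (ht _ h1)).symm
      · intro hu y hy
        obtain ⟨Z, hZ, rfl⟩ := (h y).1 (by simp [hy])
        rw [hu.unique hY hZ]
        exact (all_not_xorBits rfl).2 rfl
    simp only [commonElement, List.isEmpty_cons, Bool.not_false, Bool.true_and, List.tail_cons,
      List.headD_cons, hall]
    split
    · rename_i hu
      rw [hu.unique hY hu.choose_spec.1]
    · rfl

/-- For a word with at most `δ` deletions the systematic part has between `2 ^ ℓ - δ` and `2 ^ ℓ`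
bits. The unary number of missing bits is then correct and less than `c`, as the uniqueness in
`mem_decodeGuess` requires. -/
theorem decodeAlg_received {δ : ℕ} (hc : δ < c) (u : Fin (2 ^ ℓ) → Bool)
    (D : Finset (Fin (gcLength δ c ℓ))) (hD : #D ≤ δ) :
    decodeAlg δ c 𝒞.lowCoeffs 𝒞.rowBits (𝒞.received δ u D) = 𝒞.decode δ (𝒞.received δ u D) := by
  obtain ⟨e, _, h1, h2⟩ := 𝒞.readParity_received u D hD
  have hl : ((List.replicate c ()).flatMap fun _ => 𝒞.lowCoeffs).length = c * ℓ := by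
    simp [List.length_flatMap]
  have hs : ((kept D e : List (Fin (2 ^ ℓ))).map u).length ≤ 2 ^ ℓ := by
    simpa using (kept_sublist D e).length_le
  have hT : (unaryTwoPow 𝒞.lowCoeffs).length = 2 ^ ℓ := by simp
  rw [decodeAlg]
  simp only [readBits_eq, hl, h2, List.append_nil, List.reverse_reverse]
  rw [parityBits, 𝒞.commonElement_eq (S := 𝒞.candidates δ (𝒞.received δ u D)), hT]
  · rfl
  · intro x
    rw [𝒞.mem_decodedStrings hc hT hs (by simpa using h1)]
    simp only [𝒞.mem_candidates_received h2]

end GCCode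
end

/-! ### Running times -/

/-- A vector of `c` field elements as bit strings of the length of `fl`. -/
def IsVec (c : ℕ) (fl : List Bool) (v : List (List Bool)) : Prop :=
  v.length = c ∧ ∀ x ∈ v, x.length = fl.length

theorem IsVec.axpy {c : ℕ} {fl b : List Bool} {row acc : List (List Bool)} (h0 : fl ≠ [])
    (hr : IsVec c fl row) (ha : IsVec c fl acc) : IsVec c fl (axpy fl b row acc) := by
  refine ⟨by simp [_root_.axpy, hr.1, ha.1], fun x hx => ?_⟩
  obtain ⟨i, hi, rfl⟩ := List.mem_iff_getElem.1 hx
  simp only [_root_.axpy, List.getElem_zipWith, length_xorBits]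
  rw [ha.2 _ (List.getElem_mem _), length_mulBits (hr.2 _ (List.getElem_mem _)) h0, min_self]

theorem length_padTo {fl b : List Bool} (h : b.length ≤ fl.length) :
    (padTo fl b).length = fl.length := by
  simp [padTo]; omega

theorem inTime_padTo : InTime (fun q : List Bool × List Bool => q.2.length ≤ q.1.length)
    (fun q => padTo q.1 q.2) (fun q => q.1.length) :=
  InTime.id.snd.append (InTime.map (fun _ _ => 0) (bf := fun _ => 0) (.const false)
    (InTime.id.fst.drop InTime.id.snd 1 fun q h => by omega) (by simp) 1 fun q h => by simp; omega) 1
    fun q h => by omega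

theorem inTime_axpy (c : ℕ) :
    InTime (fun q : List Bool × List Bool × List (List Bool) × List (List Bool) =>
      q.1 ≠ [] ∧ q.2.1.length ≤ q.1.length ∧ IsVec c q.1 q.2.2.1 ∧ IsVec c q.1 q.2.2.2)
      (fun q => axpy q.1 q.2.1 q.2.2.1 q.2.2.2) (fun q => q.1.length ^ 2) := by
  have hsq : ∀ l : List Bool, l.length ≤ l.length ^ 2 := fun l => by nlinarith [sq_nonneg l.length]
  refine InTime.zipWith (f := fun q x y => xorBits x (mulBits q.1 q.2.1 y))
    (bf := fun z => z.1.1.length ^ 2) (fun q _ => q.1.length ^ 2) ?_ InTime.id.snd.snd.snd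
    InTime.id.snd.snd.fst (by simp) c ?_
  · refine InTime.xorBits InTime.id.snd.fst (InTime.mulBits.app₃ InTime.id.fst.fst
      InTime.id.fst.snd.fst InTime.id.snd.snd 1 ?_ fun _ _ => by simp only; omega) 1 ?_
    · rintro z ⟨⟨h1, h2, h3, h4⟩, h5, h6⟩
      exact ⟨h1, h2, h3.2 _ h6⟩
    · rintro z ⟨⟨h1, h2, h3, h4⟩, h5, h6⟩
      rw [h4.2 _ h5]
      have := hsq z.1.1
      omega
  · rintro q ⟨h1, h2, h3, h4⟩
    simp [h4.1]

theorem isVec_zero (c : ℕ) (fl : List Bool) :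
    IsVec c fl ((List.replicate c ()).map fun _ => fl.map fun _ => false) :=
  ⟨by simp, fun x hx => by obtain ⟨_, _, rfl⟩ := List.mem_map.1 hx; simp⟩

theorem isVec_paritySymbols {c : ℕ} {fl : List Bool} {rows : List (List (List Bool))}
    (h0 : fl ≠ []) (hr : ∀ row ∈ rows, IsVec c fl row) (u : List Bool) :
    IsVec c fl (paritySymbols c fl rows u) := by
  rw [paritySymbols]
  generalize hv : ((List.replicate c ()).map fun _ => fl.map fun _ => false) = v
  replace hv : IsVec c fl v := hv ▸ isVec_zero c fl
  induction rows generalizing u v with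
  | nil => exact hv
  | cons row rows ih =>
    exact ih (fun r h => hr r (by simp [h])) _ _ ((hr row (by simp)).axpy h0 hv)

/-- Each row costs a bounded number of field multiplications, quadratic in the length of `fl`; the
summand 1 beside the number of rows pays for setting up the zero vector. -/
theorem inTime_paritySymbols (c : ℕ) :
    InTime (fun q : List Bool × List (List (List Bool)) × List Bool =>
      q.1 ≠ [] ∧ ∀ row ∈ q.2.1, IsVec c q.1 row)
      (fun q => paritySymbols c q.1 q.2.1 q.2.2) (fun q => (q.2.1.length + 1) * q.1.length ^ 2) := by
  have hsq : ∀ l : List Bool, l.length ≤ l.length ^ 2 := fun l => by nlinarith [sq_nonneg l.length]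
  refine (InTime.foldl' (fun q st => IsVec c q.1 st.2) (fun q => q.1.length ^ 2)
    (bs := fun z => z.1.1.length ^ 2) ?_ InTime.id.snd.fst (InTime.id.snd.snd.pair ?_) ?_ ?_
    (by simp) 2 ?_).snd
  · have htake : InTime (fun q : (List Bool × List (List (List Bool)) × List Bool) ×
        (List Bool × List (List Bool)) × List (List Bool) =>
        (q.1.1 ≠ [] ∧ ∀ row ∈ q.1.2.1, IsVec c q.1.1 row) ∧
          IsVec c q.1.1 q.2.1.2 ∧ q.2.2 ∈ q.1.2.1)
        (fun q => q.2.1.1.take q.1.1.length) (fun q => q.1.1.length ^ 2) :=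
      InTime.id.snd.fst.fst.take InTime.id.fst.fst 1 fun q _ => by have := hsq q.1.1; omega
    refine (InTime.id.snd.fst.fst.drop InTime.id.fst.fst 1 fun q _ => by
      have := hsq q.1.1; omega).pair ?_
    refine (inTime_axpy c).app₄ InTime.id.fst.fst
      (inTime_padTo.app₂ InTime.id.fst.fst htake 1 (fun q _ => by simp)
        fun q _ => by have := hsq q.1.1; simp only; omega) InTime.id.snd.snd InTime.id.snd.fst.snd 1
      (fun q h => ⟨h.1.1, ?_, h.1.2 _ h.2.2, h.2.1⟩) fun q _ => by simp only; omega
    simp only; rw [length_padTo (by simp)]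
  · refine InTime.map (fun q _ => q.1.length) (bf := fun z => z.1.1.length) ?_ (.const _) (by simp)
      c fun q _ => ?_
    · exact InTime.map (fun _ _ => 0) (bf := fun _ => 0) (.const false) InTime.id.fst.fst (by simp) 1
        fun z _ => by simp
    · simp only [List.map_const', List.sum_replicate, List.length_replicate, smul_eq_mul]
      gcongr; nlinarith [hsq q.1, Nat.zero_le (q.2.1.length * q.1.length ^ 2)]
  · exact fun q _ => isVec_zero c q.1
  · exact fun q x w h hw hx => (h.2 x hx).axpy h.1 hw
  · rintro q ⟨h0, -⟩
    have : 0 < q.1.length := List.length_pos_iff.2 h0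
    have h1 : 0 < q.1.length ^ 2 := by positivity
    nlinarith [Nat.mul_le_mul_left q.2.1.length h1]

theorem inTime_encodeAlg (δ c : ℕ) :
    InTime (fun q : (List Bool × List (List (List Bool))) × List Bool =>
      q.1.1.tail ≠ [] ∧ (∀ row ∈ q.1.2, IsVec c q.1.1.tail row))
      (fun q => encodeAlg δ c q.1.1.tail q.1.2 q.2)
      (fun q => q.2.length + (q.1.2.length + 1) * q.1.1.tail.length ^ 2) := by
  have hsq : ∀ l : List Bool, l.length ≤ l.length ^ 2 := fun l => by nlinarith [sq_nonneg l.length]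
  have hlen : ∀ q : (List Bool × List (List (List Bool))) × List Bool,
      q.1.1.tail ≠ [] ∧ (∀ row ∈ q.1.2, IsVec c q.1.1.tail row) →
      ((paritySymbols c q.1.1.tail q.1.2 q.2).map List.length).sum = c * q.1.1.tail.length := by
    rintro q ⟨h1, h2⟩
    obtain ⟨h3, h4⟩ := isVec_paritySymbols h1 h2 q.2
    rw [List.map_congr_left h4]
    simp [h3]
  have hpar : InTime (fun q : (List Bool × List (List (List Bool))) × List Bool =>
      q.1.1.tail ≠ [] ∧ (∀ row ∈ q.1.2, IsVec c q.1.1.tail row))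
      (fun q => (paritySymbols c q.1.1.tail q.1.2 q.2).flatMap fun x => x)
      (fun q => q.2.length + (q.1.2.length + 1) * q.1.1.tail.length ^ 2) := by
    refine InTime.flatMap (fun _ x => x.length) (bf := fun _ => 0) (f := fun _ x => x) InTime.id.snd
      ((inTime_paritySymbols c).app₃ InTime.id.fst.fst.tail InTime.id.fst.snd InTime.id.snd 1
        (fun q h => h) fun q _ => by simp only; omega) (by simp) (by simp) (2 * c) fun q h => ?_
    rw [List.sum_map_add, hlen q h, List.map_const', List.sum_replicate,
      (isVec_paritySymbols h.1 h.2 q.2).1]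
    have h1 := hsq q.1.1.tail
    have h2 : q.1.1.tail.length ≤ q.2.length + (q.1.2.length + 1) * q.1.1.tail.length ^ 2 := by
      nlinarith [Nat.zero_le (q.1.2.length * q.1.1.tail.length ^ 2)]
    have h3 := Nat.mul_le_mul_left c h2
    simp only [smul_eq_mul, mul_one]
    nlinarith
  refine InTime.id.snd.append (InTime.flatMap (fun _ _ => δ + 1) (bf := fun _ => 0)
    (f := fun _ b => List.replicate (δ + 1) b) ?_ hpar (by simp) (by simp) ((δ + 2) * c) ?_) 1
    fun q _ => by omega
  · have : ∀ n, InTime (fun q : ((List Bool × List (List (List Bool))) × List Bool) × Bool =>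
        True) (fun q => List.replicate n q.2) fun _ => 0 := by
      intro n
      induction n with
      | zero => exact .const []
      | succ n ih => exact InTime.id.snd.cons ih
    exact (this (δ + 1)).weaken fun _ _ => trivial
  · intro q h
    have h1 := hsq q.1.1.tail
    have h2 : q.1.1.tail.length ≤ q.2.length + (q.1.2.length + 1) * q.1.1.tail.length ^ 2 := by
      nlinarith [Nat.zero_le (q.1.2.length * q.1.1.tail.length ^ 2)]
    simp only [List.map_const', List.sum_replicate, smul_eq_mul, List.length_flatMap, hlen q h]
    calc c * q.1.1.tail.length * (δ + 1 + 1) = (δ + 2) * c * q.1.1.tail.length := by ring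
      _ ≤ _ := Nat.mul_le_mul_left _ (by omega)

theorem inTime_unaryTwoPow : InTime (fun _ : List Bool => True) (fun fl => unaryTwoPow fl)
    (fun fl => fl.length * 2 ^ fl.length) := by
  have h2 : ∀ (fl : List Bool), 0 < 2 ^ fl.length := fun fl => by positivity
  -- The invariant compares the current length with the final one, reached after doubling once for
  -- each remaining element.
  refine InTime.foldl (fun fl xs t => t.length * 2 ^ xs.length ≤ 2 ^ fl.length)
    (fun fl _ => 2 ^ fl.length) (bs := fun z => z.2.1.length)
    (InTime.id.snd.fst.append InTime.id.snd.fst 1 fun _ _ => by omega) InTime.id (.const _)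
    (by simp) (fun fl x xs t _ h => ?_) (fun fl x xs t _ h => ?_) 2 fun fl _ => ?_
  · simp only [List.length_cons, pow_succ] at h
    rw [List.length_append]; nlinarith
  · exact (Nat.le_mul_of_pos_right _ (by positivity)).trans h
  · simp only [List.map_const', List.sum_replicate, smul_eq_mul]
    nlinarith [Nat.mul_le_mul_left fl.length (h2 fl)]

theorem inTime_skipEqual (δ : ℕ) : InTime (fun _ : Bool × List Bool => True)
    (fun q => skipEqual δ q.1 q.2) fun _ => 0 := by
  refine InTime.foldSum (fun _ _ => 0) (bs := fun _ => 0) ?_ (.const _) InTime.id.snd (by simp) δ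
    (by simp)
  exact (InTime.id.snd.fst.isEmpty.not.and
    ((InTime.id.snd.fst.headD rfl).xor InTime.id.fst.fst).not).ite InTime.id.snd.fst.tail
    InTime.id.snd.fst

theorem inTime_readBits (δ : ℕ) : InTime (fun _ : List Bool × List Bool × List Bool => True)
    (fun q => readBits δ q.1 q.2) fun q => q.1.length := by
  refine InTime.foldSum (fun _ _ => 0) (bs := fun _ => 0) ?_ InTime.id.fst InTime.id.snd (by simp) 1
    (by simp)
  exact InTime.id.snd.fst.fst.isEmpty.ite InTime.id.snd.fst
    (((inTime_skipEqual δ).app₂ (InTime.id.snd.fst.fst.headD rfl) InTime.id.snd.fst.fst.tail 0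
      (fun _ _ => trivial) (by simp)).pair
      ((InTime.id.snd.fst.fst.headD rfl).cons InTime.id.snd.fst.snd))

theorem inTime_cutPieces (c : ℕ) : InTime (fun _ : List Bool × List Bool => True)
    (fun q => cutPieces c q.1 q.2) fun q => q.1.length := by
  have hlen : ∀ (fl w : List Bool) (o : List (List Bool)) (n : ℕ),
      ((List.replicate n ()).foldl (fun st _ => (st.1.drop fl.length, st.1.take fl.length :: st.2))
        (w, o)).2.length = n + o.length := by
    intro fl w o n
    induction n generalizing w o with
    | zero => simp
    | succ n ih => rw [List.replicate_succ, List.foldl_cons, ih]; simp; omega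
  refine InTime.reverse (InTime.snd (InTime.foldSum (fun q _ => q.1.length)
    (bs := fun z => z.1.1.length) ?_ (.const _) (InTime.id.snd.pair (.const [])) (by simp) c
    (by simp))) c fun q _ => ?_
  · exact (InTime.id.snd.fst.fst.drop InTime.id.fst.fst 1 fun _ _ => by omega).pair
      ((InTime.id.snd.fst.fst.take InTime.id.fst.fst 1 fun _ _ => by omega).cons
        InTime.id.snd.fst.snd)
  · rw [hlen]; simp; nlinarith [Nat.zero_le (c * q.1.length)]

/-! ### Cost of enumerating supersequences -/

theorem sum_map_flatMap {α β : Type*} (l : List α) (f : α → List β) (w : β → ℕ) :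
    ((l.flatMap f).map w).sum = (l.map fun x => ((f x).map w).sum).sum := by
  induction l <;> simp_all

/-- A bound for the number of ways to enumerate the supersequences of length `L` with `s`
additional bits. -/
def superBound (L s : ℕ) : ℕ := min ((2 * L + 1) ^ s) (3 ^ L)

theorem superBound_pos (L s : ℕ) : 0 < superBound L s := by
  rw [superBound, lt_min_iff]; constructor <;> positivity

theorem superBound_mono {L L' : ℕ} (h : L ≤ L') (s : ℕ) : superBound L s ≤ superBound L' s :=
  min_le_min (Nat.pow_le_pow_left (by omega) _) (Nat.pow_le_pow_right (by norm_num) h)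

/-- An invariant for the enumeration of supersequences with `n` more steps to do. -/
structure SuperInv (L s n : ℕ) (qs : List (List Bool × List Bool × List Bool)) : Prop where
  weight : (qs.map fun q => (2 * n + 1) ^ q.2.2.length).sum ≤ (2 * L + 1) ^ s
  card : qs.length * 3 ^ n ≤ 3 ^ L
  length : ∀ q ∈ qs, q.1.length + n ≤ L

theorem length_superStep (q : List Bool × List Bool × List Bool) : (superStep q).length ≤ 3 := by
  unfold superStep; split <;> split <;> simp

/-- A partial string with `s > 0` additional bits has at most one continuation with `s` and two with
`s - 1` of them, and `(2n+1)^s + 2 (2n+1)^(s-1) ≤ (2n+3)^s`. The weight therefore does not grow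
along the enumeration and bounds the number of strings at its end. -/
theorem weight_superStep (n : ℕ) (q : List Bool × List Bool × List Bool) :
    ((superStep q).map fun q => (2 * n + 1) ^ q.2.2.length).sum ≤
      (2 * (n + 1) + 1) ^ q.2.2.length := by
  obtain ⟨pre, b, sl⟩ := q
  cases sl with
  | nil => cases b <;> simp [superStep]
  | cons x sl =>
    have h1 : (2 * n + 1) ^ (sl.length + 1) + 2 * (2 * n + 1) ^ sl.length ≤
        (2 * (n + 1) + 1) ^ (sl.length + 1) := by
      have : (2 * n + 1) ^ sl.length ≤ (2 * (n + 1) + 1) ^ sl.length :=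
        Nat.pow_le_pow_left (by omega) _
      calc _ = (2 * n + 1) ^ sl.length * (2 * (n + 1) + 1) := by ring
        _ ≤ _ := by rw [pow_succ]; exact Nat.mul_le_mul_right _ this
    cases b <;> simp [superStep] <;> omega

namespace SuperInv
variable {L s n : ℕ} {qs : List (List Bool × List Bool × List Bool)}

theorem step (h : SuperInv L s (n + 1) qs) : SuperInv L s n (qs.flatMap superStep) := by
  refine ⟨?_, ?_, fun q hq => ?_⟩
  · rw [sum_map_flatMap]
    exact (List.sum_le_sum fun q _ => weight_superStep n q).trans h.weight
  · have : (qs.flatMap superStep).length ≤ qs.length * 3 := by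
      rw [List.length_flatMap]
      refine (List.sum_le_sum fun q _ => length_superStep q).trans ?_
      simp
    calc _ ≤ qs.length * 3 * 3 ^ n := Nat.mul_le_mul_right _ this
      _ = qs.length * 3 ^ (n + 1) := by ring
      _ ≤ _ := h.card
  · obtain ⟨q', h1, h2⟩ := List.mem_flatMap.1 hq
    have h3 := h.length q' h1
    have : q.1.length = q'.1.length + 1 := by
      simp only [superStep, List.mem_append] at h2
      rcases h2 with h2 | h2 <;> split at h2 <;> simp at h2
      · simp [h2]
      · rcases h2 with rfl | rfl <;> simp
    omega

theorem length_le (h : SuperInv L s n qs) : qs.length ≤ superBound L s := by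
  refine le_min (le_trans ?_ h.weight) ?_
  · rw [← List.length_map (f := fun q : List Bool × List Bool × List Bool =>
      (2 * n + 1) ^ q.2.2.length)]
    exact List.length_le_sum_of_one_le _ (by
      simp only [List.mem_map]; rintro _ ⟨q, _, rfl⟩; exact Nat.one_le_pow _ _ (by omega))
  · exact (Nat.le_mul_of_pos_right _ (by positivity)).trans h.card

theorem superFold {l : List Bool} (h : SuperInv L s l.length qs) :
    SuperInv L s 0 (superFold l qs) := by
  induction l generalizing qs with
  | nil => exact h
  | cons x l ih => exact ih h.step

theorem init (e : Entry) : SuperInv (e.2.1 ++ e.1).length e.1.length (e.2.1 ++ e.1).length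
    [(([] : List Bool), e.2.1, e.1)] :=
  ⟨by simp, by simp, by simp⟩

end SuperInv

theorem inTime_superStep :
    InTime (fun _ : List Bool × List Bool × List Bool => True) (fun q => superStep q)
      fun _ => 0 := by
  refine InTime.append (InTime.id.snd.fst.isEmpty.ite (.const []) (InTime.cons
    (InTime.pair ((InTime.id.snd.fst.headD rfl).cons InTime.id.fst)
      (InTime.id.snd.fst.tail.pair InTime.id.snd.snd)) (.const [])))
    (InTime.id.snd.snd.isEmpty.ite (.const []) (InTime.cons
    (InTime.pair ((InTime.const false).cons InTime.id.fst)
      (InTime.id.snd.fst.pair InTime.id.snd.snd.tail)) (InTime.cons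
    (InTime.pair ((InTime.const true).cons InTime.id.fst)
      (InTime.id.snd.fst.pair InTime.id.snd.snd.tail)) (.const [])))) 1 fun q _ => ?_
  split <;> simp

theorem length_superseqs_le (e : Entry) :
    (superseqs e).length ≤ superBound (e.2.1 ++ e.1).length e.1.length := by
  rw [superseqs, List.length_map]
  exact (SuperInv.init e).superFold.length_le

theorem inTime_superseqs : InTime (fun _ : Entry => True) (fun e => superseqs e) fun e =>
    ((e.2.1 ++ e.1).length + 1) * superBound (e.2.1 ++ e.1).length e.1.length := by
  have hpos : ∀ e : Entry, 0 < superBound (e.2.1 ++ e.1).length e.1.length := fun e =>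
    superBound_pos _ _
  have happ : InTime (fun _ : Entry => True) (fun e => e.2.1 ++ e.1) fun e =>
      ((e.2.1 ++ e.1).length + 1) * superBound (e.2.1 ++ e.1).length e.1.length :=
    InTime.id.snd.fst.append InTime.id.fst 1 fun e _ => by
      have := Nat.le_mul_of_pos_right ((e.2.1 ++ e.1).length + 1) (hpos e)
      simp only [List.length_append] at this ⊢; omega
  have hfold : InTime (fun _ : Entry => True)
      (fun e => superFold (e.2.1 ++ e.1) [(([] : List Bool), e.2.1, e.1)]) fun e =>
      ((e.2.1 ++ e.1).length + 1) * superBound (e.2.1 ++ e.1).length e.1.length := by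
    refine InTime.foldl (fun e xs qs => SuperInv (e.2.1 ++ e.1).length e.1.length xs.length qs)
      (fun e _ => superBound (e.2.1 ++ e.1).length e.1.length)
      (bs := fun z => superBound (z.1.2.1 ++ z.1.1).length z.1.1.length) ?_ happ
      (((InTime.const []).pair (InTime.id.snd.fst.pair InTime.id.fst)).cons (.const []))
      (fun e _ => SuperInv.init e) (fun e x xs w _ h => h.step) (fun _ _ _ _ _ _ => le_rfl) 2 ?_
    · refine InTime.flatMap (fun _ _ => 3) (bf := fun _ => 0) (inTime_superStep.comp InTime.id.snd 0
        (fun _ _ => trivial) (by simp)) InTime.id.snd.fst (by simp)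
        (fun z q _ _ => length_superStep q) 4 ?_
      rintro z ⟨-, xs, h⟩
      simp only [List.map_const', List.sum_replicate, smul_eq_mul]
      have := h.length_le
      omega
    · intro e _
      simp only [List.map_const', List.sum_replicate, smul_eq_mul]
      nlinarith [hpos e]
  refine InTime.map (fun e _ => (e.2.1 ++ e.1).length) (bf := fun z => z.2.1.length)
    (InTime.id.snd.fst.reverse 1 fun _ _ => by omega) hfold (fun e q _ hq => ?_) 1 fun e _ => ?_
  · have := (SuperInv.init e).superFold.length q hq
    simpa using this
  · have := (SuperInv.init e).superFold.length_le
    simp only [List.map_const', List.sum_replicate, smul_eq_mul]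
    nlinarith [Nat.mul_le_mul_right ((e.2.1 ++ e.1).length + 1) this]

/-! ### Cost of filling the erased blocks of one guess -/

/-- The number of choices considered for a block. -/
def numChoices (fl : List Bool) (e : Entry) : ℕ := superBound fl.length e.1.length

/-- The number of choices considered for a list of blocks. -/
def numFillings (fl : List Bool) (es : List Entry) : ℕ := (es.map (numChoices fl)).prod

theorem numFillings_pos (fl : List Bool) (es : List Entry) : 0 < numFillings fl es :=
  List.prod_pos fun x hx => by
    obtain ⟨e, _, rfl⟩ := List.mem_map.1 hx
    exact superBound_pos _ _

/-- A well-formed block of a guess. -/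
structure EntryOK (c : ℕ) (fl : List Bool) (e : Entry) : Prop where
  length : e.1.length + e.2.1.length ≤ fl.length
  row : e.1 ≠ [] → IsVec c fl e.2.2

theorem EntryOK.length_superseqs {c : ℕ} {fl : List Bool} {e : Entry} (h : EntryOK c fl e) :
    (superseqs e).length ≤ numChoices fl e :=
  (length_superseqs_le e).trans (superBound_mono (by
    rw [List.length_append]; have := h.length; omega) _)

/-- An invariant for the enumeration of the fillings, with the blocks `xs` still to do. -/
structure FillInv (c N : ℕ) (fl : List Bool) (xs : List Entry)
    (ps : List (List (List Bool) × List (List Bool))) : Prop where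
  card : ps.length * numFillings fl xs ≤ N
  vec : ∀ p ∈ ps, IsVec c fl p.1
  length : ∀ p ∈ ps, ∀ y ∈ p.2, y.length ≤ fl.length

namespace FillInv
variable {c N : ℕ} {fl : List Bool} {xs : List Entry}
  {ps : List (List (List Bool) × List (List Bool))} {e : Entry}

theorem step (h0 : fl ≠ []) (he : EntryOK c fl e) (hne : e.1 ≠ [])
    (h : FillInv c N fl (e :: xs) ps) : FillInv c N fl xs (ps.flatMap fun p =>
      (superseqs e).map fun y => (axpy fl y e.2.2 p.1, y :: p.2)) := by
  refine ⟨?_, fun p hp => ?_, fun p hp => ?_⟩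
  · have hl : (ps.flatMap fun p => (superseqs e).map fun y =>
        (axpy fl y e.2.2 p.1, y :: p.2)).length ≤ ps.length * numChoices fl e := by
      simp only [List.length_flatMap, List.length_map, List.map_const', List.sum_replicate,
        smul_eq_mul]
      exact Nat.mul_le_mul_left _ he.length_superseqs
    calc _ ≤ ps.length * numChoices fl e * numFillings fl xs := Nat.mul_le_mul_right _ hl
      _ = ps.length * numFillings fl (e :: xs) := by simp [numFillings, mul_assoc]
      _ ≤ _ := h.card
  all_goals
    obtain ⟨p', hp', hp⟩ := List.mem_flatMap.1 hp
    obtain ⟨y, hy, rfl⟩ := List.mem_map.1 hp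
  · exact (he.row hne).axpy h0 (h.vec _ hp')
  · have := (mem_superseqs e y).1 hy
    have h1 := he.length
    simp only [List.mem_cons, forall_eq_or_imp]
    exact ⟨by omega, h.length _ hp'⟩

theorem fillErased (h0 : fl ≠ []) (hes : ∀ e ∈ xs, EntryOK c fl e ∧ e.1 ≠ [])
    (h : FillInv c N fl xs ps) : FillInv c N fl [] (fillErased fl xs ps) := by
  induction xs generalizing ps with
  | nil => exact h
  | cons e xs ih =>
    exact ih (fun e h => hes e (by simp [h])) (h.step h0 (hes e (by simp)).1 (hes e (by simp)).2)

theorem init {acc : List (List Bool)} (h : IsVec c fl acc) :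
    FillInv c (numFillings fl xs) fl xs [(acc, [])] :=
  ⟨by simp, by simpa using h, by simp⟩

theorem length_le (h : FillInv c N fl xs ps) : ps.length ≤ N :=
  (Nat.le_mul_of_pos_right _ (numFillings_pos _ _)).trans h.card

end FillInv

/-- At any stage the number of partial fillings times the number of ways to complete them stays
below `numFillings`, so each of the at most `m` rounds costs no more than the final number of
fillings times the square of the symbol length, up to a constant. -/
theorem inTime_fillErased (c m : ℕ) :
    InTime (fun q : List Bool × List Entry × List (List Bool) => q.1 ≠ [] ∧
      (∀ e ∈ q.2.1, EntryOK c q.1 e ∧ e.1 ≠ []) ∧ q.2.1.length ≤ m ∧ IsVec c q.1 q.2.2)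
      (fun q => fillErased q.1 q.2.1 [(q.2.2, [])])
      (fun q => numFillings q.1 q.2.1 * q.1.length ^ 2) := by
  refine InTime.foldl (fun q xs ps => FillInv c (numFillings q.1 q.2.1) q.1 xs ps ∧
      ∀ e ∈ xs, EntryOK c q.1 e ∧ e.1 ≠ [])
    (fun q _ => numFillings q.1 q.2.1 * q.1.length ^ 2)
    (bs := fun z => numFillings z.1.1 z.1.2.1 * z.1.1.length ^ 2) ?_ InTime.id.snd.fst
    ((InTime.id.snd.snd.pair (.const [])).cons (.const []))
    (fun q h => ⟨FillInv.init h.2.2.2, h.2.1⟩)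
    (fun q e xs w hq h => ⟨h.1.step hq.1 (h.2 e (by simp)).1 (h.2 e (by simp)).2,
      fun e he => h.2 e (by simp [he])⟩)
    (fun _ _ _ _ _ _ => le_rfl) m ?_
  · have hone : ∀ l : List Bool, l ≠ [] → 1 ≤ l.length ∧ l.length ≤ l.length ^ 2 ∧
        1 ≤ l.length ^ 2 := fun l h => by
      have := List.length_pos_iff.2 h
      exact ⟨this, by nlinarith, by nlinarith⟩
    refine InTime.flatMap (fun z _ => 5 * (numChoices z.1.1 z.2.2 * z.1.1.length ^ 2))
      (bf := fun z => 5 * (numChoices z.1.1.1 z.1.2.2 * z.1.1.1.length ^ 2)) ?_ InTime.id.snd.fst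
      (fun _ _ _ _ => le_rfl) (fun z p hz hp => ?_) 6 ?_
    · refine InTime.map (fun z _ => z.1.1.1.length ^ 2) (bf := fun y => y.1.1.1.1.length ^ 2) ?_
        (inTime_superseqs.comp InTime.id.fst.snd.snd 1 (fun _ _ => trivial) ?_)
        (fun _ _ _ _ => le_rfl) 1 ?_
      · refine InTime.pair ((inTime_axpy c).app₄ InTime.id.fst.fst.fst.fst InTime.id.snd
          InTime.id.fst.fst.snd.snd.snd.snd InTime.id.fst.snd.fst 1 ?_
          fun _ _ => by simp only; omega) (InTime.id.snd.cons InTime.id.fst.snd.snd)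
        rintro ⟨⟨⟨q, ps, e⟩, p⟩, y⟩ ⟨⟨⟨hq, xs, h1, h2⟩, hp⟩, hy⟩
        obtain ⟨h3, h4⟩ := h2 e (by simp)
        have h5 : e.1.length + e.2.1.length ≤ q.1.length := h3.length
        have h6 := (mem_superseqs e y).1 hy
        refine ⟨hq.1, ?_, h3.row h4, h1.vec p hp⟩
        simp only at h6 ⊢; omega
      · rintro ⟨⟨q, ps, e⟩, p⟩ ⟨⟨hq, xs, h1, h2⟩, hp⟩
        obtain ⟨h3, h4⟩ := h2 e (by simp)
        have h5 : e.1.length + e.2.1.length ≤ q.1.length := h3.length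
        obtain ⟨k1, k2, k3⟩ := hone q.1 hq.1
        have h6 : (e.2.1 ++ e.1).length ≤ q.1.length := by rw [List.length_append]; omega
        have h7 : superBound (e.2.1 ++ e.1).length e.1.length ≤ numChoices q.1 e :=
          superBound_mono h6 _
        simp only
        have h8 := Nat.mul_le_mul (Nat.add_le_add_right h6 1) h7
        have h9 : (q.1.length + 1) * numChoices q.1 e ≤ 2 * q.1.length ^ 2 * numChoices q.1 e :=
          Nat.mul_le_mul_right _ (by omega)
        nlinarith [Nat.zero_le (numChoices q.1 e * q.1.length ^ 2)]
      · rintro ⟨⟨q, ps, e⟩, p⟩ ⟨⟨hq, xs, h1, h2⟩, hp⟩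
        obtain ⟨k1, k2, k3⟩ := hone q.1 hq.1
        have h7 := (h2 e (by simp)).1.length_superseqs
        simp only [List.map_const', List.sum_replicate, smul_eq_mul]
        have h8 := Nat.mul_le_mul h7 (show q.1.length ^ 2 + 1 ≤ 2 * q.1.length ^ 2 by omega)
        nlinarith [Nat.zero_le (numChoices q.1 e * q.1.length ^ 2)]
    · obtain ⟨q, ps, e⟩ := z
      obtain ⟨hq, xs, h1, h2⟩ := hz
      obtain ⟨k1, k2, k3⟩ := hone q.1 hq.1
      have h7 : _ ≤ numChoices q.1 e := (h2 e (by simp)).1.length_superseqs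
      simp only [List.length_map]
      have := Nat.le_mul_of_pos_right (numChoices q.1 e) k3
      omega
    · rintro ⟨q, ps, e⟩ ⟨hq, xs, h1, h2⟩
      obtain ⟨k1, k2, k3⟩ := hone q.1 hq.1
      have h3 : ps.length * numChoices q.1 e ≤ numFillings q.1 q.2.1 := by
        refine le_trans ?_ h1.card
        simp only [numFillings, List.map_cons, List.prod_cons, ← mul_assoc]
        exact Nat.le_mul_of_pos_right _ (numFillings_pos q.1 xs)
      have h4 : 1 ≤ numChoices q.1 e := superBound_pos _ _
      simp only [List.map_const', List.sum_replicate, smul_eq_mul]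
      have h5 : 1 ≤ numChoices q.1 e * q.1.length ^ 2 := Nat.mul_pos h4 k3
      calc ps.length * (5 * (numChoices q.1 e * q.1.length ^ 2) + 1)
          ≤ ps.length * (6 * (numChoices q.1 e * q.1.length ^ 2)) :=
            Nat.mul_le_mul_left _ (by omega)
        _ = 6 * (ps.length * numChoices q.1 e * q.1.length ^ 2) := by ring
        _ ≤ 6 * (numFillings q.1 q.2.1 * q.1.length ^ 2) := by gcongr
        _ ≤ _ := by omega
  · rintro q ⟨h0, h1, h2, h3⟩
    simp only [List.map_const', List.sum_replicate, smul_eq_mul]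
    exact Nat.mul_le_mul_right _ h2

theorem InTime.tails_tail {α τ : Type} [Enc α] [Enc τ] {P : α → Prop} {l : α → List τ} {B : α → ℕ}
    (hl : InTime P l B) (A : ℕ) (hB : ∀ a, P a → (l a).length ≤ A * (B a + 1)) :
    InTime P (fun a => (l a).tails.tail) B := by
  have key : ∀ (l : List τ) (o : List (List τ)),
      (l.foldl (fun st _ => (st.1.tail, st.1.tail :: st.2)) (l, o)).2 =
        l.tails.tail.reverse ++ o := by
    intro l
    induction l with
    | nil => simp
    | cons x l ih =>
      intro o
      rw [List.foldl_cons]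
      simp only [List.tail_cons, ih, List.tails]
      cases l <;> simp
  have h : InTime P (fun a => ((l a).foldl
      (fun (st : List τ × List (List τ)) _ => (st.1.tail, st.1.tail :: st.2)) (l a, [])).2) B :=
    (InTime.foldSum (fun _ _ => 0) (bs := fun _ => 0) (InTime.id.snd.fst.fst.tail.pair
      (InTime.id.snd.fst.fst.tail.cons InTime.id.snd.fst.snd)) hl (hl.pair (.const [])) (by simp) A
      (by simpa using hB)).snd
  refine (h.reverse A fun a ha => ?_).congr fun a _ => ?_
  · rw [key]; simpa using hB a ha
  · rw [key]; simp

theorem inTime_assemble :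
    InTime (fun q : List Bool × List Entry × List (List Bool) =>
      (∀ e ∈ q.2.1, e.2.1.length ≤ q.1.length) ∧ ∀ y ∈ q.2.2, y.length ≤ q.1.length)
      (fun q => (assemble q.2.1 (q.2.2, [])).2) (fun q => q.2.1.length * (q.1.length + 1)) := by
  refine (InTime.foldl' (fun q st => ∀ y ∈ st.1, y.length ≤ q.1.length) (fun q => q.1.length)
    (bs := fun z => z.1.1.length) ?_ InTime.id.snd.fst (InTime.id.snd.snd.pair (.const []))
    (fun q h => h.2) (fun q e st hq h he => ?_) (fun _ _ _ _ _ _ => le_rfl) 1 (by simp)).snd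
  · refine InTime.id.snd.snd.fst.isEmpty.ite (InTime.id.snd.fst.fst.pair
      (InTime.id.snd.snd.snd.fst.append InTime.id.snd.fst.snd 1 fun z h => ?_))
      (InTime.id.snd.fst.fst.tail.pair
      ((InTime.id.snd.fst.fst.headD rfl).append InTime.id.snd.fst.snd 1 fun z h => ?_))
    · have := h.1.1.1 _ h.1.2.2; omega
    · have : (z.2.1.1.headD []).length ≤ z.1.1.length := by
        have := h.1.2.1
        cases hz : z.2.1.1 with
        | nil => simp
        | cons y ys => exact this y (by simp [hz])
      omega
  · split
    · exact h
    · exact fun y hy => h y (List.mem_of_mem_tail hy)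

/-- The time for the decoding of a complete guess. -/
def leafCost (fl : List Bool) (it : Guess) : ℕ :=
  it.2.2.2.length * fl.length + numFillings fl it.2.2.2 * fl.length ^ 2

/-- A well-formed complete guess, with at most `m` erased blocks. -/
structure LeafOK (c m : ℕ) (fl : List Bool) (it : Guess) : Prop where
  ne_nil : fl ≠ []
  vec : IsVec c fl it.2.2.1
  entries : ∀ e ∈ it.2.2.2, EntryOK c fl e
  card : (it.2.2.2.filter fun e => !e.1.isEmpty).length ≤ m

theorem numFillings_filter_reverse (fl : List Bool) (es : List Entry) (p : Entry → Bool) :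
    numFillings fl (es.reverse.filter p) ≤ numFillings fl es := by
  refine Nat.le_of_dvd (numFillings_pos _ _) ?_
  have h := ((List.filter_sublist (p := p) (l := es.reverse)).map (numChoices fl)).prod_dvd_prod
  rwa [List.map_reverse, List.prod_reverse] at h

theorem inTime_decodeGuess (c m : ℕ) : InTime (fun q : List Bool × Guess => LeafOK c m q.1 q.2)
    (fun q => decodeGuess q.1 q.2) (fun q => leafCost q.1 q.2) := by
  have hone : ∀ q : List Bool × Guess, LeafOK c m q.1 q.2 → 1 ≤ q.1.length ∧
      q.1.length ≤ q.1.length ^ 2 ∧ q.2.2.2.2.length ≤ q.2.2.2.2.length * q.1.length ∧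
      q.1.length ^ 2 ≤ numFillings q.1 q.2.2.2.2 * q.1.length ^ 2 := fun q h => by
    have := List.length_pos_iff.2 h.ne_nil
    exact ⟨this, by nlinarith, Nat.le_mul_of_pos_right _ this,
      Nat.le_mul_of_pos_left _ (numFillings_pos _ _)⟩
  have hE : InTime (fun q : List Bool × Guess => LeafOK c m q.1 q.2)
      (fun q => q.2.2.2.2.reverse.filter fun e => !e.1.isEmpty)
      (fun q => leafCost q.1 q.2) := by
    refine InTime.filter (fun _ _ => 0) (bf := fun _ => 0) InTime.id.snd.fst.isEmpty.not
      (InTime.id.snd.snd.snd.snd.reverse 1 fun q h => ?_) (by simp) 1 fun q h => ?_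
    all_goals
      obtain ⟨h1, h2, h3, h4⟩ := hone q h
      simp [leafCost]; omega
  have hEOK : ∀ q : List Bool × Guess, LeafOK c m q.1 q.2 →
      (∀ e ∈ q.2.2.2.2.reverse.filter fun e => !e.1.isEmpty, EntryOK c q.1 e ∧ e.1 ≠ []) := by
    intro q h e he
    rw [List.mem_filter, List.mem_reverse] at he
    exact ⟨h.entries e he.1, by simpa using he.2⟩
  have hinv : ∀ q : List Bool × Guess, LeafOK c m q.1 q.2 →
      FillInv c (numFillings q.1 q.2.2.2.2) q.1 [] (fillErased q.1
        (q.2.2.2.2.reverse.filter fun e => !e.1.isEmpty) [(q.2.2.2.1, [])]) := by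
    intro q h
    refine FillInv.fillErased h.ne_nil (hEOK q h) ⟨?_, by simpa using h.vec, by simp⟩
    simpa using numFillings_filter_reverse _ _ _
  have hfill : InTime (fun q : List Bool × Guess => LeafOK c m q.1 q.2)
      (fun q => fillErased q.1 (q.2.2.2.2.reverse.filter fun e => !e.1.isEmpty) [(q.2.2.2.1, [])])
      (fun q => leafCost q.1 q.2) := by
    refine (inTime_fillErased c m).comp (f := fun q : List Bool × Guess =>
      (q.1, (q.2.2.2.2.reverse.filter fun e => !e.1.isEmpty), q.2.2.2.1))
      (InTime.id.fst.pair (hE.pair InTime.id.snd.snd.snd.fst)) 1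
      (fun q h => ⟨h.ne_nil, hEOK q h, ?_, h.vec⟩) fun q h => ?_
    · have := h.card
      rw [← List.length_reverse, ← List.filter_reverse] at this
      exact this
    · have := Nat.mul_le_mul_right (q.1.length ^ 2)
        (numFillings_filter_reverse q.1 q.2.2.2.2 fun e => !e.1.isEmpty)
      simp only [leafCost]; omega
  refine InTime.id.snd.snd.fst.isEmpty.ite ?_ (.const [])
  refine InTime.weaken (P := fun q : List Bool × Guess => LeafOK c m q.1 q.2) ?_ fun _ h => h.1
  have hzero : InTime (fun q : List Bool × Guess => LeafOK c m q.1 q.2)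
      (fun q => (fillErased q.1 (q.2.2.2.2.reverse.filter fun e => !e.1.isEmpty)
        [(q.2.2.2.1, [])]).filter fun p => isZero p.1) (fun q => leafCost q.1 q.2) := by
    refine InTime.filter (fun q _ => c * (q.1.length + 1)) (bf := fun z => c * (z.1.1.length + 1)) ?_
      hfill (fun _ _ _ _ => le_rfl) (2 * c + 1) fun q h => ?_
    · refine InTime.all (fun _ x => x.length) (bf := fun y => y.2.length) ?_ InTime.id.snd.fst
        (fun _ _ _ _ => le_rfl) 1 ?_
      · exact InTime.all (fun _ _ => 0) (bf := fun _ => 0) InTime.id.snd.not InTime.id.snd (by simp) 1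
          (by simp)
      · rintro ⟨q, p⟩ ⟨hq, hp⟩
        obtain ⟨h1, h2⟩ := (hinv q hq).vec p hp
        have : (p.1.map fun x => x.length + 1) = p.1.map fun _ => q.1.length + 1 :=
          List.map_congr_left fun x hx => by rw [h2 x hx]
        simp [this, h1]
    · obtain ⟨h1, h2, h3, h4⟩ := hone q h
      have h5 := (hinv q h).length_le
      simp only [List.map_const', List.sum_replicate, smul_eq_mul, leafCost]
      calc _ ≤ numFillings q.1 q.2.2.2.2 * ((2 * c + 1) * q.1.length ^ 2) := by
            refine Nat.mul_le_mul h5 ?_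
            nlinarith [Nat.mul_le_mul_left c h2, Nat.mul_le_mul_left c (h1.trans h2)]
        _ = (2 * c + 1) * (numFillings q.1 q.2.2.2.2 * q.1.length ^ 2) := by ring
        _ ≤ _ := Nat.mul_le_mul_left _ (by omega)
  refine InTime.map (fun q _ => q.2.2.2.2.length * (q.1.length + 1))
    (bf := fun z => z.1.2.2.2.2.length * (z.1.1.length + 1)) ?_
    (hzero.take (m := fun _ => [()]) (.const _) 1 (by simp)) (fun _ _ _ _ => le_rfl) 3 fun q h => ?_
  · refine inTime_assemble.comp (f := fun z : (List Bool × Guess) ×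
      (List (List Bool) × List (List Bool)) => (z.1.1, z.1.2.2.2.2, z.2.2))
      (InTime.id.fst.fst.pair (InTime.id.fst.snd.snd.snd.snd.pair InTime.id.snd.snd)) 1 ?_
      fun _ _ => by simp only; omega
    rintro ⟨q, p⟩ ⟨hq, hp⟩
    refine ⟨fun e he => ?_, fun y hy => ?_⟩
    · have := (hq.entries e he).length
      simp only at this ⊢; omega
    · exact (hinv q hq).length p (List.mem_of_mem_filter (List.mem_of_mem_take hp)) y hy
  · obtain ⟨h1, h2, h3, h4⟩ := hone q h
    have : (List.take [()].length (List.filter (fun p => isZero p.1) (fillErased q.1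
        (List.filter (fun e => !e.1.isEmpty) q.2.2.2.2.reverse) [(q.2.2.2.1, [])]))).length ≤ 1 := by
      simp
    have h5 := Nat.mul_le_mul_right (q.2.2.2.2.length * (q.1.length + 1) + 1) this
    refine le_trans (by simp) (h5.trans ?_)
    simp only [leafCost]
    nlinarith

theorem length_decodeGuess_le (fl : List Bool) (it : Guess) : (decodeGuess fl it).length ≤ 1 := by
  unfold decodeGuess; split <;> simp

/-! ### Number and total cost of the guesses -/

theorem sum_pow_le (x r : ℕ) : ∑ i ∈ range (r + 1), x ^ i ≤ (x + 1) ^ r := by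
  induction r with
  | zero => simp
  | succ r ih =>
    rw [sum_range_succ, pow_succ (x + 1)]
    have : x ^ (r + 1) ≤ (x + 1) ^ r * x := by
      rw [pow_succ]; exact Nat.mul_le_mul_right _ (Nat.pow_le_pow_left (by omega) _)
    nlinarith

/-- A potential for a guess with `r` remaining deletions and `n` remaining blocks. -/
def potential (C E n r : ℕ) : ℕ := (n + 1) ^ r * C + if r = 0 then 0 else (n + 1) ^ (r - 1) * E

/-- Treating one block leaves some `i ≤ r` deletions, with at most one extension for each `i`; thus
the total potential does not increase when guesses are extended. Here `C` stands for a guess with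
the last block intact and `E` for those with it erased: the latter reserve a deletion for the last
block, hence the exponent `r - 1`. -/
theorem sum_potential_le (C E n r : ℕ) :
    ∑ i ∈ range (r + 1), potential C E n i ≤ potential C E (n + 1) r := by
  simp only [potential, sum_add_distrib, ← sum_mul]
  gcongr ?_ * C + ?_
  · exact sum_pow_le (n + 1) r
  · rw [sum_range_succ']
    cases r with
    | zero => simp
    | succ r =>
      simp only [Nat.succ_ne_zero, if_false, Nat.add_sub_cancel, if_true, add_zero, ← sum_mul]
      exact Nat.mul_le_mul_right _ (sum_pow_le (n + 1) r)

theorem potential_mono {C E n r r' : ℕ} (h : r ≤ r') : potential C E n r ≤ potential C E n r' := by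
  unfold potential
  gcongr ?_ * C + ?_
  · exact Nat.pow_le_pow_right (by omega) h
  · split
    · omega
    · rw [if_neg (by omega)]
      exact Nat.mul_le_mul_right _ (Nat.pow_le_pow_right (by omega) (by omega))

theorem sum_map_tails {α : Type*} (l : List α) (w : ℕ → ℕ) :
    (l.tails.map fun t => w t.length).sum = ∑ i ∈ range (l.length + 1), w i := by
  induction l with
  | nil => simp
  | cons x l ih => rw [List.tails, List.map_cons, List.sum_cons, ih, List.length_cons,
      sum_range_succ _ (l.length + 1), add_comm]

theorem sum_map_tails_tail_zip_le {α β : Type*} (r : List α) (l : List β) (w : ℕ → ℕ) :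
    ((r.tails.tail.zip l).map fun q => w q.1.length).sum + w r.length ≤
      ∑ i ∈ range (r.length + 1), w i := by
  have h : ∀ (m : List (List α)) (l : List β),
      ((m.zip l).map fun q => w q.1.length).sum ≤ (m.map fun t => w t.length).sum := by
    intro m
    induction m with
    | nil => simp
    | cons x m ih =>
      intro l
      cases l with
      | nil => simp
      | cons y l => simpa using ih l
  rw [← sum_map_tails]
  cases r with
  | nil => simp
  | cons x r =>
    rw [List.tails, List.tail_cons, List.map_cons, List.sum_cons, add_comm]
    exact Nat.add_le_add_left (h _ _) _

/-- A well-formed guess with `n` remaining blocks of `R`. -/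
structure GuessOK (c δ R : ℕ) (fl : List Bool) (n : ℕ) (it : Guess) : Prop where
  vec : IsVec c fl it.2.2.1
  entries : ∀ e ∈ it.2.2.2, EntryOK c fl e
  card : it.2.2.2.length + n ≤ R
  -- For a block of full length the number of bits to be filled in equals the number of deletions
  -- spent on it. The last block, which stands first in the list once `n = 0`, is left out, because
  -- its padding bits have to be filled in too.
  slack : ((if n = 0 then it.2.2.2.tail else it.2.2.2).map fun e => e.1.length).sum +
    it.2.1.length ≤ δ

namespace GuessOK
variable {c δ R n : ℕ} {fl Lt : List Bool} {row : List (List Bool)} {it : Guess}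

theorem slack_succ (h : GuessOK c δ R fl (n + 1) it) :
    (it.2.2.2.map fun e => e.1.length).sum + it.2.1.length ≤ δ := by
  simpa using h.slack

theorem extendKnown (h : GuessOK c δ R fl (n + 1) it) (h0 : fl ≠ []) (hrow : IsVec c fl row)
    (hLt : Lt.length ≤ fl.length) : GuessOK c δ R fl n (extendKnown fl row Lt it) := by
  have hs := h.slack_succ
  have hp : (padTo fl (it.1.take Lt.length)).length = fl.length :=
    length_padTo (by rw [List.length_take]; omega)
  refine ⟨hrow.axpy h0 h.vec, ?_, ?_, ?_⟩
  · simp only [_root_.extendKnown, List.mem_cons, forall_eq_or_imp]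
    exact ⟨⟨by simp [hp], by simp⟩, h.entries⟩
  · have := h.card
    simp only [_root_.extendKnown, List.length_cons]; omega
  · simp only [_root_.extendKnown, List.tail_cons]
    split <;> simpa using hs

theorem extendErased (h : GuessOK c δ R fl (n + 1) it) (hrow : IsVec c fl row)
    (hLt : Lt.length ≤ fl.length) (hn : n ≠ 0 → Lt.length = fl.length) {q : List Bool × List Bool}
    (hq : q ∈ it.2.1.tails.tail.zip Lt.tails.tail) :
    GuessOK c δ R fl n (extendErased fl row it q) := by
  have hs := h.slack_succ
  obtain ⟨g, h1, h2, h3, rfl⟩ := mem_tails_zip.1 hq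
  refine ⟨h.vec, ?_, ?_, ?_⟩
  · simp only [_root_.extendErased, List.mem_cons, forall_eq_or_imp]
    exact ⟨⟨by simp; omega, fun _ => hrow⟩, h.entries⟩
  · have := h.card
    simp only [_root_.extendErased, List.length_cons]; omega
  · simp only [_root_.extendErased, List.tail_cons, List.length_drop]
    split
    · omega
    · rename_i h4
      have := hn h4
      simp only [List.map_cons, List.sum_cons, List.length_drop]
      omega

theorem of_mem_extendGuess (h : GuessOK c δ R fl (n + 1) it) (h0 : fl ≠ [])
    (hrow : IsVec c fl row) (hLt : Lt.length ≤ fl.length) (hn : n ≠ 0 → Lt.length = fl.length)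
    {it' : Guess} (hit : it' ∈ extendGuess fl row Lt it) : GuessOK c δ R fl n it' := by
  rw [extendGuess, List.mem_cons, List.mem_map] at hit
  rcases hit with rfl | ⟨q, hq, rfl⟩
  · exact h.extendKnown h0 hrow hLt
  · exact h.extendErased hrow hLt hn hq

/-- The slack allows at most `δ` erased blocks before the last one, which may be one more. -/
theorem leafOK (h : GuessOK c δ R fl 0 it) (h0 : fl ≠ []) : LeafOK c (δ + 1) fl it := by
  refine ⟨h0, h.vec, h.entries, ?_⟩
  have hs : (it.2.2.2.tail.map fun e => e.1.length).sum + it.2.1.length ≤ δ := by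
    simpa using h.slack
  have h1 : ∀ es : List Entry, (es.filter fun e => !e.1.isEmpty).length ≤
      (es.map fun e => e.1.length).sum := by
    intro es
    induction es with
    | nil => simp
    | cons e es ih =>
      rw [List.filter_cons]
      split
      · rename_i he
        have : 0 < e.1.length := List.length_pos_iff.2 (by simpa using he)
        simp only [List.length_cons, List.map_cons, List.sum_cons]; omega
      · simp only [List.map_cons, List.sum_cons]; omega
  have h2 : ∀ es : List Entry, (es.filter fun e => !e.1.isEmpty).length ≤
      (es.tail.filter fun e => !e.1.isEmpty).length + 1 := by
    intro es
    cases es with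
    | nil => simp
    | cons e es => rw [List.filter_cons, List.tail_cons]; split <;> simp
  have := h1 it.2.2.2.tail
  have := h2 it.2.2.2
  omega

end GuessOK

theorem numFillings_le_pow (fl : List Bool) (es : List Entry) :
    numFillings fl es ≤ (2 * fl.length + 1) ^ (es.map fun e => e.1.length).sum := by
  induction es with
  | nil => simp [numFillings]
  | cons e es ih =>
    simp only [numFillings, List.map_cons, List.prod_cons, List.sum_cons, pow_add]
    exact Nat.mul_le_mul (min_le_left _ _) ih

/-- A bound for the time spent on a complete guess in which the last block is not erased. -/
def knownCost (R δ L : ℕ) : ℕ := R * L + (2 * L + 1) ^ δ * L ^ 2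

/-- A bound for the time spent on a complete guess in which the last block is erased. -/
def erasedCost (R δ L : ℕ) : ℕ := R * L + 3 ^ L * (2 * L + 1) ^ δ * L ^ 2

namespace GuessOK
variable {c δ R n : ℕ} {fl Lt : List Bool} {row : List (List Bool)} {it : Guess}

theorem leafCost_le_knownCost (h : GuessOK c δ R fl 0 it)
    (hs : (it.2.2.2.map fun e => e.1.length).sum ≤ δ) : leafCost fl it ≤ knownCost R δ fl.length := by
  unfold leafCost knownCost
  gcongr
  · have := h.card; omega
  · exact (numFillings_le_pow _ _).trans (Nat.pow_le_pow_right (by omega) hs)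

/-- The number of unknown bits of a short last block is not bounded in terms of `δ`, so its
supersequences are counted by `3 ^ L`; the earlier blocks still contribute a power of `2 * L + 1`
with exponent at most `δ`. -/
theorem leafCost_le_erasedCost (h : GuessOK c δ R fl 0 it) :
    leafCost fl it ≤ erasedCost R δ fl.length := by
  have hs : (it.2.2.2.tail.map fun e => e.1.length).sum + it.2.1.length ≤ δ := by
    simpa using h.slack
  unfold leafCost erasedCost
  gcongr
  · have := h.card; omega
  · have h1 := (numFillings_le_pow fl it.2.2.2.tail).trans (Nat.pow_le_pow_right (by omega)
      (show _ ≤ δ by omega))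
    cases hes : it.2.2.2 with
    | nil => exact Nat.mul_pos (by positivity) (by positivity)
    | cons e es =>
      rw [hes, List.tail_cons] at h1
      simp only [numFillings, List.map_cons, List.prod_cons]
      exact Nat.mul_le_mul (min_le_right _ _) h1

theorem sum_potential_extendGuess_le (C E n : ℕ) (it : Guess) :
    ((extendGuess fl row Lt it).map fun x => potential C E n x.2.1.length).sum ≤
      potential C E (n + 1) it.2.1.length := by
  refine le_trans ?_ (sum_potential_le C E n it.2.1.length)
  refine le_trans (le_of_eq ?_) (sum_map_tails_tail_zip_le it.2.1 Lt.tails.tail (potential C E n))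
  rw [extendGuess, List.map_cons, List.sum_cons, List.map_map, add_comm]
  rfl

/-- At the last block one extension keeps it known, and at most `δ` extensions erase it, none if no
deletions remain. This explains the value `δ * erasedCost` of the second parameter. -/
theorem sum_leafCost_extendGuess_le (h : GuessOK c δ R fl 1 it) (h0 : fl ≠ [])
    (hrow : IsVec c fl row) (hLt : Lt.length ≤ fl.length) :
    ((extendGuess fl row Lt it).map (leafCost fl)).sum ≤
      potential (knownCost R δ fl.length) (δ * erasedCost R δ fl.length) 1 it.2.1.length := by
  have hs := h.slack_succ
  rw [extendGuess, List.map_cons, List.sum_cons, List.map_map, potential]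
  refine Nat.add_le_add ?_ ?_
  · refine ((h.extendKnown h0 hrow hLt).leafCost_le_knownCost ?_).trans
      (Nat.le_mul_of_pos_left _ (by positivity))
    simp only [_root_.extendKnown, List.map_cons, List.sum_cons, List.length_nil]
    omega
  · have h1 : ((it.2.1.tails.tail.zip Lt.tails.tail).map
        (leafCost fl ∘ _root_.extendErased fl row it)).sum ≤
        it.2.1.length * erasedCost R δ fl.length := by
      refine (List.sum_le_card_nsmul _ (erasedCost R δ fl.length) fun x hx => ?_).trans ?_
      · obtain ⟨q, hq, rfl⟩ := List.mem_map.1 hx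
        exact (h.extendErased hrow hLt (by simp) hq).leafCost_le_erasedCost
      · rw [smul_eq_mul, List.length_map, List.length_zip]
        refine Nat.mul_le_mul_right _ ((min_le_left _ _).trans ?_)
        simp
    split
    · rename_i h2; rw [h2] at h1; simpa using h1
    · refine h1.trans ((Nat.mul_le_mul_right _ (show _ ≤ δ by omega)).trans
        (Nat.le_mul_of_pos_left _ (by positivity)))

end GuessOK

/-- An invariant for the enumeration of the guesses, with the rows `xs` remaining. -/
structure GuessInv (c δ R : ℕ) (fl : List Bool) (xs : List (List (List Bool)))
    (st : List Bool × List Guess) : Prop where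
  ne_nil : fl ≠ []
  rows : ∀ row ∈ xs, IsVec c fl row
  -- Every remaining block is nonempty, so all but the last one have full length.
  template : xs.length * fl.length < st.1.length + fl.length
  items : ∀ it ∈ st.2, GuessOK c δ R fl xs.length it

namespace GuessInv
variable {c δ R : ℕ} {fl : List Bool} {row : List (List Bool)} {xs : List (List (List Bool))}
  {st : List Bool × List Guess}

theorem length_take_le (fl w : List Bool) : (w.take fl.length).length ≤ fl.length := by simp

theorem length_take (h : GuessInv c δ R fl (row :: xs) st) (hn : xs.length ≠ 0) :
    (st.1.take fl.length).length = fl.length := by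
  have h1 := h.template
  rw [List.length_cons, Nat.succ_mul] at h1
  have h2 : 1 * fl.length ≤ xs.length * fl.length := Nat.mul_le_mul_right _ (by omega)
  rw [List.length_take]; omega

theorem step (h : GuessInv c δ R fl (row :: xs) st) :
    GuessInv c δ R fl xs (st.1.drop fl.length,
      st.2.flatMap (extendGuess fl row (st.1.take fl.length))) := by
  refine ⟨h.ne_nil, fun r hr => h.rows r (by simp [hr]), ?_, fun it hit => ?_⟩
  · have h1 := h.template
    have h2 := List.length_pos_iff.2 h.ne_nil
    rw [List.length_cons, Nat.succ_mul] at h1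
    simp only [List.length_drop]
    rcases le_or_gt fl.length st.1.length with h3 | h3
    · omega
    · have : xs.length = 0 := by
        by_contra h4
        have h5 : 1 * fl.length ≤ xs.length * fl.length := Nat.mul_le_mul_right _ (by omega)
        omega
      rw [this]; omega
  · obtain ⟨it', h1, h2⟩ := List.mem_flatMap.1 hit
    exact (h.items it' h1).of_mem_extendGuess h.ne_nil (h.rows row (by simp))
      (length_take_le _ _) h.length_take h2

theorem guessFold (h : GuessInv c δ R fl xs st) : GuessInv c δ R fl [] (guessFold fl xs st) := by
  induction xs generalizing st with
  | nil => exact h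
  | cons row xs ih => exact ih h.step

theorem sum_potential_step (C E : ℕ) :
    ((st.2.flatMap (extendGuess fl row (st.1.take fl.length))).map
      fun x => potential C E xs.length x.2.1.length).sum ≤
    (st.2.map fun x => potential C E (row :: xs).length x.2.1.length).sum := by
  rw [sum_map_flatMap]
  exact List.sum_le_sum fun it _ => GuessOK.sum_potential_extendGuess_le C E xs.length it

theorem sum_leafCost_le (h : GuessInv c δ R fl xs st) (hne : xs ≠ []) :
    ((_root_.guessFold fl xs st).2.map (leafCost fl)).sum ≤
      (st.2.map fun x => potential (knownCost R δ fl.length) (δ * erasedCost R δ fl.length)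
        xs.length x.2.1.length).sum := by
  induction xs generalizing st with
  | nil => exact absurd rfl hne
  | cons row xs ih =>
    cases xs with
    | nil =>
      simp only [_root_.guessFold, List.foldl_cons, List.foldl_nil, sum_map_flatMap]
      exact List.sum_le_sum fun it hit => (h.items it hit).sum_leafCost_extendGuess_le h.ne_nil
        (h.rows row (by simp)) (length_take_le _ _)
    | cons row' xs =>
      exact (ih h.step (by simp)).trans (sum_potential_step _ _)

theorem init {rows : List (List (List Bool))} {T s r : List Bool} {acc : List (List Bool)}
    (h0 : fl ≠ []) (hrows : ∀ row ∈ rows, IsVec c fl row)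
    (hT : rows.length * fl.length < T.length + fl.length) (hr : r.length ≤ δ)
    (hacc : IsVec c fl acc) : GuessInv c δ rows.length fl rows (T, [(s, r, acc, [])]) := by
  refine ⟨h0, hrows, hT, fun it hit => ?_⟩
  obtain rfl := List.mem_singleton.1 hit
  exact ⟨hacc, by simp, by simp, by simpa⟩

end GuessInv

theorem length_extendGuess_le (fl : List Bool) (row : List (List Bool)) (Lt : List Bool)
    (it : Guess) : (extendGuess fl row Lt it).length ≤ it.2.1.length + 1 := by
  simp [extendGuess]

theorem inTime_extendGuess (c δ : ℕ) :
    InTime (fun z : List Bool × List (List Bool) × List Bool × Guess => z.1 ≠ [] ∧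
      IsVec c z.1 z.2.1 ∧ z.2.2.1.length ≤ z.1.length ∧ IsVec c z.1 z.2.2.2.2.2.1 ∧
      z.2.2.2.2.1.length ≤ δ)
      (fun z => extendGuess z.1 z.2.1 z.2.2.1 z.2.2.2) (fun z => z.1.length ^ 2) := by
  have hsq : ∀ l : List Bool, l.length ≤ l.length ^ 2 := fun l => by nlinarith [sq_nonneg l.length]
  have hLt : ∀ z : List Bool × List (List Bool) × List Bool × Guess, z.1 ≠ [] ∧
      IsVec c z.1 z.2.1 ∧ z.2.2.1.length ≤ z.1.length ∧ IsVec c z.1 z.2.2.2.2.2.1 ∧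
      z.2.2.2.2.1.length ≤ δ → z.2.2.1.length ≤ 1 * (z.1.length ^ 2 + 1) := fun z h => by
    have := hsq z.1; have := h.2.2.1; omega
  refine InTime.cons ?_ ?_
  · have hpad : InTime (fun z : List Bool × List (List Bool) × List Bool × Guess => z.1 ≠ [] ∧
        IsVec c z.1 z.2.1 ∧ z.2.2.1.length ≤ z.1.length ∧ IsVec c z.1 z.2.2.2.2.2.1 ∧
        z.2.2.2.2.1.length ≤ δ)
        (fun z => padTo z.1 (z.2.2.2.1.take z.2.2.1.length)) (fun z => z.1.length ^ 2) :=
      inTime_padTo.app₂ InTime.id.fst (InTime.id.snd.snd.snd.fst.take InTime.id.snd.snd.fst 1 hLt) 1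
        (fun z h => by have := h.2.2.1; simp only [List.length_take]; omega)
        fun z _ => by have := hsq z.1; simp only; omega
    refine (InTime.id.snd.snd.snd.fst.drop InTime.id.snd.snd.fst 1 hLt).pair
      (InTime.id.snd.snd.snd.snd.fst.pair (InTime.pair ?_
      (((InTime.const []).pair (hpad.pair (.const []))).cons InTime.id.snd.snd.snd.snd.snd.snd)))
    refine (inTime_axpy c).app₄ InTime.id.fst hpad InTime.id.snd.fst InTime.id.snd.snd.snd.snd.snd.fst
      1 (fun z h => ⟨h.1, ?_, h.2.1, h.2.2.2.1⟩) fun z _ => by simp only; omega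
    simp only
    rw [length_padTo]
    have := h.2.2.1; simp only [List.length_take]; omega
  · refine InTime.map (fun z _ => z.1.length) (bf := fun y => y.1.1.length) ?_
      (InTime.zip (InTime.id.snd.snd.snd.snd.fst.tails_tail δ fun z h => ?_)
        (InTime.id.snd.snd.fst.tails_tail 1 hLt) δ fun z h => ?_) (fun _ _ _ _ => le_rfl) δ
      fun z h => ?_
    · have hq : ∀ y : (List Bool × List (List Bool) × List Bool × Guess) × List Bool × List Bool,
          (y.1.1 ≠ [] ∧ IsVec c y.1.1 y.1.2.1 ∧ y.1.2.2.1.length ≤ y.1.1.length ∧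
            IsVec c y.1.1 y.1.2.2.2.2.2.1 ∧ y.1.2.2.2.2.1.length ≤ δ) ∧
            y.2 ∈ y.1.2.2.2.2.1.tails.tail.zip y.1.2.2.1.tails.tail →
          y.2.2.length ≤ 1 * (y.1.1.length + 1) := by
        rintro ⟨z, q⟩ ⟨⟨_, _, h, _, _⟩, hq⟩
        obtain ⟨g, h1, h2, h3, hg⟩ := mem_tails_zip.1 hq
        dsimp only at hg h
        simp only [hg, List.length_drop]; omega
      exact (InTime.id.fst.snd.snd.snd.fst.drop InTime.id.snd.snd 1 hq).pair
        (InTime.id.snd.fst.pair (InTime.id.fst.snd.snd.snd.snd.snd.fst.pair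
        (((InTime.id.fst.fst.drop InTime.id.snd.snd 1 hq).pair
          ((InTime.id.fst.snd.snd.snd.fst.take InTime.id.snd.snd 1 hq).pair
            InTime.id.fst.snd.fst)).cons InTime.id.fst.snd.snd.snd.snd.snd.snd)))
    · have := h.2.2.2.2; nlinarith [Nat.zero_le (δ * z.1.length ^ 2)]
    · have := h.2.2.2.2
      simp only [List.length_tail, List.length_tails, Nat.add_sub_cancel]
      nlinarith [Nat.zero_le (δ * z.1.length ^ 2)]
    · have h1 : (z.2.2.2.2.1.tails.tail.zip z.2.2.1.tails.tail).length ≤ δ := by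
        have := h.2.2.2.2
        simp; omega
      have := hsq z.1
      simp only [List.map_const', List.sum_replicate, smul_eq_mul]
      exact Nat.mul_le_mul h1 (by omega)

/-- The data handed to the search for the decodable guesses: the template for field elements, the
rows, the template for the message, and the empty guess. -/
abbrev SearchData := List Bool × List (List (List Bool)) × List Bool × Guess

/-- Well-formed data for the search. -/
def SearchData.OK (c δ : ℕ) (q : SearchData) : Prop :=
  GuessInv c δ q.2.1.length q.1 q.2.1 (q.2.2.1, [q.2.2.2]) ∧ q.2.1 ≠ []

/-- A bound for the time of the search. -/
def searchCost (δ R L : ℕ) : ℕ :=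
  R * ((R + 1) ^ δ * L ^ 2) + potential (knownCost R δ L) (δ * erasedCost R δ L) R δ

theorem SearchData.OK.length_le {c δ : ℕ} {q : SearchData} (h : q.OK c δ) :
    q.2.2.2.2.1.length ≤ δ := by
  have := (h.1.items q.2.2.2 (by simp)).slack
  omega

theorem length_le_of_sum_potential {n N : ℕ} {items : List Guess}
    (h : (items.map fun x => potential 1 0 n x.2.1.length).sum ≤ N) : items.length ≤ N := by
  refine le_trans ?_ h
  rw [← List.length_map (f := fun x : Guess => potential 1 0 n x.2.1.length)]
  refine List.length_le_sum_of_one_le _ ?_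
  simp only [List.mem_map]
  rintro _ ⟨q, _, rfl⟩
  rw [potential, mul_one]
  exact le_add_right (Nat.one_le_pow _ _ (by omega))

theorem potential_one_zero (n r : ℕ) : potential 1 0 n r = (n + 1) ^ r := by simp [potential]

/-- With the parameters 1 and 0 the potential of a partial guess is at least 1, so it bounds the
number of partial guesses at every stage; initially it is at most `(R + 1) ^ δ` for `R` rows. -/
theorem inTime_guessFold (c δ : ℕ) : InTime (SearchData.OK c δ)
    (fun q => guessFold q.1 q.2.1 (q.2.2.1, [q.2.2.2]))
    (fun q => q.2.1.length * ((q.2.1.length + 1) ^ δ * q.1.length ^ 2)) := by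
  refine InTime.foldl (fun q xs st => GuessInv c δ q.2.1.length q.1 xs st ∧
      (st.2.map fun x => potential 1 0 xs.length x.2.1.length).sum ≤ (q.2.1.length + 1) ^ δ)
    (fun q _ => (q.2.1.length + 1) ^ δ * q.1.length ^ 2)
    (bs := fun z => (z.1.2.1.length + 1) ^ δ * z.1.1.length ^ 2) ?_ InTime.id.snd.fst
    (InTime.id.snd.snd.fst.pair (InTime.id.snd.snd.snd.cons (.const [])))
    (fun q h => ⟨h.1, ?_⟩) (fun q row xs w _ h => ⟨h.1.step, (GuessInv.sum_potential_step 1 0).trans h.2⟩)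
    (fun _ _ _ _ _ _ => le_rfl) 2 ?_
  · have hpos : ∀ (q : SearchData), q.1 ≠ [] →
        q.1.length ≤ (q.2.1.length + 1) ^ δ * q.1.length ^ 2 ∧ 1 ≤ q.1.length ^ 2 := by
      intro q h
      have h1 := List.length_pos_iff.2 h
      have h2 : q.1.length ≤ q.1.length ^ 2 := by nlinarith
      exact ⟨h2.trans (Nat.le_mul_of_pos_left _ (by positivity)), by nlinarith⟩
    have htake : ∀ z : SearchData × (List Bool × List Guess) × List (List Bool),
        (z.1.OK c δ ∧ ∃ xs, GuessInv c δ z.1.2.1.length z.1.1 (z.2.2 :: xs) z.2.1 ∧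
          (z.2.1.2.map fun x => potential 1 0 (z.2.2 :: xs).length x.2.1.length).sum ≤
            (z.1.2.1.length + 1) ^ δ) →
        z.1.1.length ≤ 1 * ((z.1.2.1.length + 1) ^ δ * z.1.1.length ^ 2 + 1) := by
      rintro z ⟨_, xs, h, _⟩
      have := (hpos z.1 h.ne_nil).1
      omega
    refine (InTime.id.snd.fst.fst.drop InTime.id.fst.fst 1 htake).pair ?_
    -- The template of the current block is computed once and handed over as context to the loop
    -- over the partial guesses.
    have hpre := InTime.id.fst.fst.pair (InTime.id.snd.snd.pair
      (InTime.take InTime.id.snd.fst.fst InTime.id.fst.fst 1 htake))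
    refine (InTime.flatMap (α := (SearchData × (List Bool × List Guess) × List (List Bool)) ×
        (List Bool × List (List Bool) × List Bool)) (l := fun y => y.1.2.1.2)
      (P := fun y => (y.1.1.OK c δ ∧ ∃ xs, GuessInv c δ y.1.1.2.1.length y.1.1.1 (y.1.2.2 :: xs) y.1.2.1 ∧
          (y.1.2.1.2.map fun x => potential 1 0 (y.1.2.2 :: xs).length x.2.1.length).sum ≤
            (y.1.1.2.1.length + 1) ^ δ) ∧ y.2 = (y.1.1.1, y.1.2.2, y.1.2.1.1.take y.1.1.1.length))
      (f := fun y it => extendGuess y.2.1 y.2.2.1 y.2.2.2 it)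
      (B := fun y => (y.1.1.2.1.length + 1) ^ δ * y.1.1.1.length ^ 2)
      (fun y _ => y.1.1.1.length ^ 2 + δ) (bf := fun x => x.1.1.1.1.length ^ 2) ?_
      InTime.id.fst.snd.fst.snd (fun _ _ _ _ => by simp) ?_ (δ + 2) ?_).comp
      (f := fun z => (z, (z.1.1, z.2.2, z.2.1.1.take z.1.1.length)))
      (InTime.id.pair hpre) 1 (fun z h => ⟨h, rfl⟩) fun z _ => by simp only; omega
    · refine (inTime_extendGuess c δ).app₄ InTime.id.fst.snd.fst InTime.id.fst.snd.snd.fst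
        InTime.id.fst.snd.snd.snd InTime.id.snd 1 ?_ ?_
      · rintro ⟨⟨⟨q, st, row⟩, t⟩, it⟩ ⟨⟨⟨hq, xs, h1, h2⟩, he⟩, hit⟩
        dsimp only at he hq h1 h2 hit
        subst he
        have h3 := h1.items it hit
        refine ⟨h1.ne_nil, h1.rows row (by simp), by simp, h3.vec, ?_⟩
        have := h3.slack
        simp only; omega
      · rintro ⟨⟨⟨q, st, row⟩, t⟩, it⟩ ⟨⟨⟨hq, xs, h1, h2⟩, he⟩, hit⟩
        dsimp only at he hq h1 h2 hit
        subst he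
        simp only; omega
    · rintro ⟨⟨q, st, row⟩, t⟩ it ⟨⟨hq, xs, h1, h2⟩, he⟩ hit
      dsimp only at he hq h1 h2 hit
      subst he
      have := (h1.items it hit).slack
      have h4 := length_extendGuess_le q.1 row (st.1.take q.1.length) it
      have := (hpos q h1.ne_nil).2
      simp only at h4 ⊢; omega
    · rintro ⟨⟨q, st, row⟩, t⟩ ⟨⟨hq, xs, h1, h2⟩, he⟩
      dsimp only at he hq h1 h2
      subst he
      have h3 := length_le_of_sum_potential h2
      have h4 := (hpos q h1.ne_nil).2
      simp only [List.map_const', List.sum_replicate, smul_eq_mul] at h3 ⊢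
      calc st.2.length * (q.1.length ^ 2 + δ + 1)
          ≤ (q.2.1.length + 1) ^ δ * ((δ + 2) * q.1.length ^ 2) :=
            Nat.mul_le_mul h3 (by nlinarith [Nat.mul_le_mul_left δ h4])
        _ = (δ + 2) * ((q.2.1.length + 1) ^ δ * q.1.length ^ 2) := by ring
        _ ≤ _ := Nat.mul_le_mul_left _ (by omega)
  · simp only [List.map_cons, List.map_nil, List.sum_cons, List.sum_nil, add_zero,
      potential_one_zero]
    exact Nat.pow_le_pow_right (by omega) h.length_le
  · intro q h
    have h1 : 1 ≤ (q.2.1.length + 1) ^ δ * q.1.length ^ 2 := by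
      have := List.length_pos_iff.2 h.1.ne_nil
      exact Nat.mul_pos (by positivity) (by positivity)
    simp only [List.map_const', List.sum_replicate, smul_eq_mul]
    nlinarith [Nat.mul_le_mul_left q.2.1.length h1]

/-- The strings found by the search. -/
def search (q : SearchData) : List (List Bool) :=
  (guessFold q.1 q.2.1 (q.2.2.1, [q.2.2.2])).2.flatMap (decodeGuess q.1)

theorem one_le_knownCost {R L : ℕ} (δ : ℕ) (hL : 0 < L) : 1 ≤ knownCost R δ L :=
  le_add_left (Nat.mul_pos (by positivity) (by positivity))

theorem SearchData.OK.card_le {c δ : ℕ} {q : SearchData} (h : q.OK c δ) :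
    (guessFold q.1 q.2.1 (q.2.2.1, [q.2.2.2])).2.length ≤ (q.2.1.length + 1) ^ δ := by
  have key : ∀ (xs : List (List (List Bool))) (st : List Bool × List Guess),
      ((guessFold q.1 xs st).2.map fun x => potential 1 0 0 x.2.1.length).sum ≤
        (st.2.map fun x => potential 1 0 xs.length x.2.1.length).sum := by
    intro xs
    induction xs with
    | nil => intro st; exact le_rfl
    | cons row xs ih => intro st; exact (ih _).trans (GuessInv.sum_potential_step 1 0)
  refine length_le_of_sum_potential ((key _ _).trans ?_)
  simp only [List.map_cons, List.map_nil, List.sum_cons, List.sum_nil, add_zero, potential_one_zero]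
  exact Nat.pow_le_pow_right (by omega) h.length_le

theorem SearchData.OK.length_search_le {c δ : ℕ} {q : SearchData} (h : q.OK c δ) :
    (search q).length ≤ (q.2.1.length + 1) ^ δ := by
  refine le_trans ?_ h.card_le
  rw [search, List.length_flatMap]
  refine (List.sum_le_sum fun it _ => length_decodeGuess_le q.1 it).trans ?_
  simp

theorem inTime_search (c δ : ℕ) : InTime (SearchData.OK c δ) search
    (fun q => searchCost δ q.2.1.length q.1.length) := by
  have hleaf : ∀ q : SearchData, q.OK c δ → ∀ it ∈ (guessFold q.1 q.2.1 (q.2.2.1, [q.2.2.2])).2,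
      LeafOK c (δ + 1) q.1 it := fun q h it hit =>
    (h.1.guessFold.items it hit).leafOK h.1.ne_nil
  refine InTime.flatMap (fun q it => leafCost q.1 it + 1) (bf := fun z => leafCost z.1.1 z.2)
    ?_ (InTime.snd ((inTime_guessFold c δ).mono 1 (fun _ h => h) fun q _ => ?_))
    (fun _ _ _ _ => by simp only; omega) (fun q it _ _ => (length_decodeGuess_le _ _).trans (by omega)) 3
    fun q h => ?_
  · exact (inTime_decodeGuess c (δ + 1)).app₂ InTime.id.fst.fst InTime.id.snd 1
      (fun z h => hleaf z.1 h.1 z.2 h.2) fun _ _ => by simp only; omega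
  · simp only [searchCost]; omega
  · have h1 := h.1.sum_leafCost_le h.2
    simp only [List.map_cons, List.map_nil, List.sum_cons, List.sum_nil, add_zero] at h1
    have h2 := h1.trans (potential_mono h.length_le)
    have h3 : q.2.1.length ≠ 0 := fun h' => h.2 (List.length_eq_zero_iff.1 h')
    have h4 : (q.2.1.length + 1) ^ δ ≤
        potential (knownCost q.2.1.length δ q.1.length)
          (δ * erasedCost q.2.1.length δ q.1.length) q.2.1.length δ := by
      unfold potential
      exact le_add_right (Nat.le_mul_of_pos_right _
        (one_le_knownCost _ (List.length_pos_iff.2 h.1.ne_nil)))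
    have h5 := h.card_le
    rw [List.sum_map_add, List.sum_map_add]
    simp only [List.map_const', List.sum_replicate, smul_eq_mul, mul_one, searchCost]
    omega

theorem inTime_commonElement : InTime
    (fun q : List Bool × List (List Bool) => ∀ x ∈ q.2, x.length ≤ 2 * q.1.length)
    (fun q => commonElement q.1 q.2) (fun q => (q.2.length + 1) * (q.1.length + 1)) := by
  have hhead : ∀ q : List Bool × List (List Bool), (∀ x ∈ q.2, x.length ≤ 2 * q.1.length) →
      (q.2.headD []).length ≤ 2 * q.1.length := by
    intro q h
    cases hz : q.2 with
    | nil => simp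
    | cons y ys => exact h y (by simp [hz])
  refine InTime.ite (InTime.id.snd.isEmpty.not.and ?_) ?_ (.const none)
  · refine InTime.all (fun q _ => 2 * q.1.length) (bf := fun z => 2 * z.1.1.length) ?_
      InTime.id.snd.tail (fun _ _ _ _ => le_rfl) 3 ?_
    · refine InTime.all (fun _ _ => 0) (bf := fun _ => 0) InTime.id.snd.not
        ((InTime.id.fst.snd.headD rfl).xorBits InTime.id.snd 1 fun z h => ?_) (by simp) 1 fun z h => ?_
      · have := hhead z.1 h.1; omega
      · have := hhead z.1 h.1
        simp only [zero_add, List.map_const', List.sum_replicate, smul_eq_mul, mul_one,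
          length_xorBits]
        omega
    · intro q h
      have h1 : q.2.tail.length ≤ q.2.length := by simp
      simp only [List.map_const', List.sum_replicate, smul_eq_mul]
      nlinarith [Nat.mul_le_mul_right (2 * q.1.length + 1) h1]
  · exact InTime.some (((InTime.id.snd.headD rfl).take InTime.id.fst 1 fun q _ => by
      nlinarith [Nat.zero_le (q.2.length * q.1.length)]))

/-- The data handed to the search by the decoder. -/
def searchData (δ c : ℕ) (fl : List Bool) (rows : List (List (List Bool))) (y : List Bool) :
    SearchData :=
  let T := unaryTwoPow fl
  let r := readBits δ ((List.replicate c ()).flatMap fun _ => fl) (y.reverse, [])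
  (fl, rows, T, r.1.reverse, T.drop r.1.reverse.length, cutPieces c fl r.2, [])

theorem decodeAlg_eq_search (δ c : ℕ) (fl : List Bool) (rows : List (List (List Bool)))
    (y : List Bool) :
    decodeAlg δ c fl rows y =
      commonElement (unaryTwoPow fl) (search (searchData δ c fl rows y)) := rfl

/-! ### Received words as inputs of the search -/

section
variable {c ℓ : ℕ} (𝒞 : GCCode c ℓ)
namespace GCCode

theorem isVec_vecBits {n : ℕ} (v : Fin n → AdjoinRoot 𝒞.f) : IsVec n 𝒞.lowCoeffs (𝒞.vecBits v) := by
  refine ⟨by simp [vecBits], fun x hx => ?_⟩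
  obtain ⟨i, rfl⟩ := (List.mem_ofFn' _ _).1 hx
  simp

theorem isVec_rowBits : ∀ row ∈ 𝒞.rowBits, IsVec c 𝒞.lowCoeffs row := by
  intro row h
  obtain ⟨j, _, rfl⟩ := List.mem_map.1 h
  exact 𝒞.isVec_vecBits _

theorem length_rowBits : 𝒞.rowBits.length = numBlocks ℓ := by simp [rowBits]

theorem lowCoeffs_ne_nil : 𝒞.lowCoeffs ≠ [] := by
  rw [← List.length_pos_iff]; simpa using 𝒞.ℓ_pos

theorem length_received_le {δ : ℕ} (u : Fin (2 ^ ℓ) → Bool) (D : Finset (Fin (gcLength δ c ℓ))) :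
    (𝒞.received δ u D).length ≤ gcLength δ c ℓ := by
  rw [received, deletePositions, List.length_map]
  exact (List.length_filter_le _ _).trans (by rw [List.length_zipIdx, length_encode])

theorem exists_searchData_received {δ : ℕ} (u : Fin (2 ^ ℓ) → Bool)
    (D : Finset (Fin (gcLength δ c ℓ))) (hD : #D ≤ δ) :
    ∃ s : List Bool, s.length ≤ 2 ^ ℓ ∧ 2 ^ ℓ ≤ s.length + δ ∧
      readBits δ ((List.replicate c ()).flatMap fun _ => 𝒞.lowCoeffs)
        ((𝒞.received δ u D).reverse, []) = (s.reverse, 𝒞.parityBits u) := by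
  obtain ⟨e, _, h1, h2⟩ := 𝒞.readParity_received u D hD
  have hl : ((List.replicate c ()).flatMap fun _ => 𝒞.lowCoeffs).length = c * ℓ := by
    simp [List.length_flatMap]
  refine ⟨(kept D e).map u, ?_, by simpa using h1, ?_⟩
  · simpa using (kept_sublist D e).length_le
  · rw [readBits_eq, hl, h2]; simp

theorem searchData_ok {δ : ℕ} (u : Fin (2 ^ ℓ) → Bool) (D : Finset (Fin (gcLength δ c ℓ)))
    (hD : #D ≤ δ) :
    (searchData δ c 𝒞.lowCoeffs 𝒞.rowBits (𝒞.received δ u D)).OK c δ := by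
  obtain ⟨s, h1, h2, h3⟩ := 𝒞.exists_searchData_received u D hD
  have h4 := numBlocks_pos 𝒞.ℓ_pos
  have h5 := mul_lt_of_lt_numBlocks 𝒞.ℓ_pos (Nat.sub_lt h4 one_pos)
  have h6 : numBlocks ℓ * ℓ = (numBlocks ℓ - 1) * ℓ + ℓ := by
    rw [← Nat.succ_mul]; congr 1; omega
  simp only [searchData, h3, List.reverse_reverse]
  refine ⟨GuessInv.init 𝒞.lowCoeffs_ne_nil 𝒞.isVec_rowBits ?_ ?_ ?_, ?_⟩
  · rw [length_rowBits, length_unaryTwoPow, length_lowCoeffs]; omega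
  · rw [List.length_drop, length_unaryTwoPow, length_lowCoeffs]; omega
  · rw [parityBits, cutPieces_eq]; exact 𝒞.isVec_vecBits _
  · rw [← List.length_pos_iff]; exact 𝒞.length_rowBits ▸ h4

theorem length_of_mem_search {δ : ℕ} (hc : δ < c) (u : Fin (2 ^ ℓ) → Bool)
    (D : Finset (Fin (gcLength δ c ℓ))) (hD : #D ≤ δ) :
    ∀ x ∈ search (searchData δ c 𝒞.lowCoeffs 𝒞.rowBits (𝒞.received δ u D)),
      x.length ≤ 2 * 2 ^ ℓ := by
  obtain ⟨s, h1, h2, h3⟩ := 𝒞.exists_searchData_received u D hD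
  intro x hx
  have hx : x ∈ decodedStrings c 𝒞.lowCoeffs 𝒞.rowBits (unaryTwoPow 𝒞.lowCoeffs) s
      (𝒞.parityBits u) := by
    simp only [searchData, h3, List.reverse_reverse] at hx
    exact hx
  obtain ⟨Y, _, rfl⟩ := (𝒞.mem_decodedStrings hc (by simp) h1 h2 _ x).1 hx
  rw [length_flatMap_bits, List.length_ofFn]
  exact numBlocks_mul_le 𝒞.ℓ_pos

end GCCode
end

/-- Descriptions of codes, without tags, together with received words. -/
def IsReceived (δ c : ℕ) (a : (List Bool × List (List (List Bool))) × List Bool) : Prop :=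
  ∃ (ℓ : ℕ) (𝒞 : GCCode c ℓ) (u : Fin (2 ^ ℓ) → Bool) (D : Finset (Fin (gcLength δ c ℓ))),
    #D ≤ δ ∧ a = ((true :: 𝒞.lowCoeffs, 𝒞.rowBits), 𝒞.received δ u D)

/-- A bound for the time of the decoder. -/
def decodeCost (δ R L : ℕ) : ℕ := searchCost δ R L + ((R + 1) ^ δ + L) * 2 ^ L

theorem inTime_searchData (δ c : ℕ) : InTime (IsReceived δ c)
    (fun a => searchData δ c a.1.1.tail a.1.2 a.2)
    (fun a => decodeCost δ a.1.2.length a.1.1.tail.length) := by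
  have hL : ∀ δ R L : ℕ, L ≤ decodeCost δ R L ∧ L * 2 ^ L ≤ decodeCost δ R L ∧
      2 ^ L ≤ decodeCost δ R L := by
    intro δ R L
    have h1 : 1 ≤ 2 ^ L := Nat.one_le_two_pow
    have h2 : 1 ≤ (R + 1) ^ δ := Nat.one_le_pow _ _ (by omega)
    have h3 := Nat.mul_le_mul_right (2 ^ L) h2
    have h4 := Nat.mul_le_mul_left L h1
    unfold decodeCost
    refine ⟨?_, ?_, ?_⟩ <;> nlinarith
  have hT : InTime (IsReceived δ c) (fun a => unaryTwoPow a.1.1.tail)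
      (fun a => decodeCost δ a.1.2.length a.1.1.tail.length) :=
    inTime_unaryTwoPow.comp InTime.id.fst.fst.tail 1 (fun _ _ => trivial)
      fun a _ => by have := (hL δ a.1.2.length a.1.1.tail.length).2.1; omega
  have htempl : InTime (IsReceived δ c) (fun a => (List.replicate c ()).flatMap fun _ => a.1.1.tail)
      (fun a => decodeCost δ a.1.2.length a.1.1.tail.length) :=
    InTime.flatMap (fun a _ => a.1.1.tail.length) (bf := fun _ => 0) InTime.id.fst.fst.fst.tail
      (.const _) (by simp) (fun _ _ _ _ => le_rfl) c fun a _ => by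
        simp only [List.map_const', List.sum_replicate, List.length_replicate, smul_eq_mul]
        have := (hL δ a.1.2.length a.1.1.tail.length).1
        gcongr
  have hlen : ∀ a, IsReceived δ c a → a.2.length ≤ (c * (δ + 1) + 1) *
      (decodeCost δ a.1.2.length a.1.1.tail.length + 1) := by
    rintro a ⟨ℓ, 𝒞, u, D, hD, rfl⟩
    obtain ⟨h1, _, h2⟩ := hL δ (numBlocks ℓ) ℓ
    have := 𝒞.length_received_le u D
    simp only [List.tail_cons, 𝒞.length_lowCoeffs, 𝒞.length_rowBits]
    refine this.trans ?_
    unfold gcLength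
    nlinarith [Nat.mul_le_mul_left (c * (δ + 1)) h1]
  have hr : InTime (IsReceived δ c) (fun a => readBits δ ((List.replicate c ()).flatMap
      fun _ => a.1.1.tail) (a.2.reverse, []))
      (fun a => decodeCost δ a.1.2.length a.1.1.tail.length) :=
    (inTime_readBits δ).app₂ htempl ((InTime.id.snd.reverse _ hlen).pair (.const [])) c
      (fun _ _ => trivial) fun a _ => by
        simp only [List.length_flatMap, List.map_const', List.sum_replicate, List.length_replicate,
          smul_eq_mul]
        have := (hL δ a.1.2.length a.1.1.tail.length).1
        exact Nat.mul_le_mul_left c (by omega)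
  have hs' : ∀ a, IsReceived δ c a → (readBits δ ((List.replicate c ()).flatMap
      fun _ => a.1.1.tail) (a.2.reverse, [])).1.length ≤
        1 * (decodeCost δ a.1.2.length a.1.1.tail.length + 1) := by
    rintro a ⟨ℓ, 𝒞, u, D, hD, rfl⟩
    obtain ⟨s, h1, h2, h3⟩ := 𝒞.exists_searchData_received u D hD
    have := (hL δ (numBlocks ℓ) ℓ).2.2
    simp only [List.tail_cons, 𝒞.length_lowCoeffs, 𝒞.length_rowBits, h3, List.length_reverse]
    omega
  have hs := hr.fst.reverse 1 hs'
  exact InTime.id.fst.fst.tail.pair (InTime.id.fst.snd.pair (hT.pair (hs.pair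
    ((hT.drop hs 1 fun a ha => by rw [List.length_reverse]; exact hs' a ha).pair
    (((inTime_cutPieces c).app₂ InTime.id.fst.fst.tail hr.snd 1 (fun _ _ => trivial) fun a _ => by
      have := (hL δ a.1.2.length a.1.1.tail.length).1
      simp only; omega).pair (.const []))))))

theorem inTime_decodeAlg {δ c : ℕ} (hc : δ < c) : InTime (IsReceived δ c)
    (fun a => decodeAlg δ c a.1.1.tail a.1.2 a.2)
    (fun a => decodeCost δ a.1.2.length a.1.1.tail.length) := by
  have hT : InTime (IsReceived δ c) (fun a => unaryTwoPow a.1.1.tail)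
      (fun a => decodeCost δ a.1.2.length a.1.1.tail.length) :=
    (inTime_searchData δ c).snd.snd.fst.congr fun _ _ => rfl
  have hsearch : InTime (IsReceived δ c)
      (fun a => search (searchData δ c a.1.1.tail a.1.2 a.2))
      (fun a => decodeCost δ a.1.2.length a.1.1.tail.length) := by
    refine (inTime_search c δ).comp (inTime_searchData δ c) 1 ?_ ?_
    · rintro a ⟨ℓ, 𝒞, u, D, hD, rfl⟩
      exact 𝒞.searchData_ok u D hD
    · intro a _
      simp only [searchData, decodeCost]
      omega
  refine (inTime_commonElement.comp (hT.pair hsearch) 4 ?_ ?_).congr fun a _ =>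
    decodeAlg_eq_search δ c a.1.1.tail a.1.2 a.2
  · rintro a ⟨ℓ, 𝒞, u, D, hD, rfl⟩
    simpa using 𝒞.length_of_mem_search hc u D hD
  · rintro a ⟨ℓ, 𝒞, u, D, hD, rfl⟩
    have h1 := (𝒞.searchData_ok u D hD).length_search_le
    simp only [List.tail_cons, length_unaryTwoPow, decodeCost]
    have h2 : 1 ≤ 2 ^ 𝒞.lowCoeffs.length := Nat.one_le_two_pow
    have h3 : 1 ≤ (𝒞.rowBits.length + 1) ^ δ := Nat.one_le_pow _ _ (by omega)
    have h4 := Nat.mul_le_mul (Nat.add_le_add_right h1 1)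
      (show 2 ^ 𝒞.lowCoeffs.length + 1 ≤ 2 * 2 ^ 𝒞.lowCoeffs.length by omega)
    have h5 : (searchData δ c 𝒞.lowCoeffs 𝒞.rowBits (𝒞.received δ u D)).2.1.length =
      𝒞.rowBits.length := rfl
    rw [h5] at h4
    have h6 := Nat.mul_le_mul_right (2 ^ 𝒞.lowCoeffs.length) h3
    nlinarith [Nat.zero_le (𝒞.lowCoeffs.length * 2 ^ 𝒞.lowCoeffs.length),
      Nat.zero_le (searchCost δ 𝒞.rowBits.length 𝒞.lowCoeffs.length)]

/-! ### Asymptotics of the cost bounds -/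

theorem exists_three_pow_mul_pow_le (n : ℕ) : ∃ A, ∀ ℓ : ℕ, 3 ^ ℓ * ℓ ^ n ≤ A * (2 ^ ℓ * 2 ^ ℓ) := by
  obtain ⟨B, hB⟩ := (tendsto_pow_const_div_const_pow_of_one_lt n
    (show (1 : ℝ) < 4 / 3 by norm_num)).bddAbove_range
  refine ⟨⌈B⌉₊, fun ℓ => ?_⟩
  have h := hB ⟨ℓ, rfl⟩
  rw [div_le_iff₀ (by positivity)] at h
  have h2 : (ℓ : ℝ) ^ n ≤ ⌈B⌉₊ * (4 / 3) ^ ℓ :=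
    h.trans (mul_le_mul_of_nonneg_right (Nat.le_ceil B) (by positivity))
  have h3 : (3 : ℝ) ^ ℓ * ℓ ^ n ≤ ⌈B⌉₊ * (2 ^ ℓ * 2 ^ ℓ) := by
    -- The polynomial factor is absorbed by the gap between 3 and 4: `ℓ ^ n` is `O((4/3) ^ ℓ)`, and
    -- `4 ^ ℓ` is the square of the message length.
    calc (3 : ℝ) ^ ℓ * ℓ ^ n ≤ 3 ^ ℓ * (⌈B⌉₊ * (4 / 3) ^ ℓ) := by gcongr
      _ = ⌈B⌉₊ * (3 * (4 / 3)) ^ ℓ := by rw [mul_pow]; ring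
      _ = ⌈B⌉₊ * (2 ^ ℓ * 2 ^ ℓ) := by rw [← mul_pow]; norm_num
  exact_mod_cast h3

/-- The four terms are the enumeration of the guesses (`t1`), the guesses with the last block known
(`t2`), those with it erased (`t3`), and the preparation and comparison of strings (`t4`). Only `t3`
needs the exponent `δ - 1`, which makes up for a cost of order `N ^ 2` for each guess. -/
theorem exists_decodeCost_le (δ : ℕ) : ∃ A, ∀ ℓ : ℕ, 0 < ℓ →
    decodeCost δ (numBlocks ℓ) ℓ ≤ A * (numBlocks ℓ ^ δ * 2 ^ ℓ * ℓ) := by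
  obtain ⟨A₁, h₁⟩ := exists_pow_le_two_pow (δ + 2)
  obtain ⟨A₂, h₂⟩ := exists_three_pow_mul_pow_le (δ + 2)
  refine ⟨2 ^ δ * 2 + 2 ^ δ * (2 + 3 ^ δ * A₁) + 2 ^ δ * δ * (2 + 3 ^ δ * A₂) + (2 ^ δ + 1),
    fun ℓ hℓ => ?_⟩
  have hK := numBlocks_pos hℓ
  have hKle := numBlocks_mul_le hℓ
  have hKge := numBlocks_mul_ge hℓ
  set K := numBlocks ℓ
  have hpow : ∀ d, (K + 1) ^ d ≤ 2 ^ d * K ^ d := fun d => by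
    rw [← mul_pow]; exact Nat.pow_le_pow_left (by omega) d
  have hpoly : (2 * ℓ + 1) ^ δ * ℓ ^ 2 ≤ 3 ^ δ * ℓ ^ (δ + 2) := by
    rw [pow_add, ← mul_assoc, ← mul_pow]
    exact Nat.mul_le_mul_right _ (Nat.pow_le_pow_left (by omega) δ)
  set N := 2 ^ ℓ
  have hN : 1 ≤ N := Nat.one_le_two_pow
  have t1 : K * ((K + 1) ^ δ * ℓ ^ 2) ≤ 2 ^ δ * 2 * (K ^ δ * N * ℓ) := by
    calc K * ((K + 1) ^ δ * ℓ ^ 2) = (K + 1) ^ δ * (K * ℓ) * ℓ := by ring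
      _ ≤ 2 ^ δ * K ^ δ * (2 * N) * ℓ := by gcongr; exact hpow δ
      _ = _ := by ring
  have t2 : (K + 1) ^ δ * knownCost K δ ℓ ≤ 2 ^ δ * (2 + 3 ^ δ * A₁) * (K ^ δ * N * ℓ) := by
    have : knownCost K δ ℓ ≤ (2 + 3 ^ δ * A₁) * N := by
      unfold knownCost
      calc _ ≤ 2 * N + 3 ^ δ * (A₁ * N) := Nat.add_le_add hKle
            (hpoly.trans (Nat.mul_le_mul_left _ (h₁ ℓ)))
        _ = _ := by ring
    calc _ ≤ 2 ^ δ * K ^ δ * ((2 + 3 ^ δ * A₁) * N) := Nat.mul_le_mul (hpow δ) this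
      _ = 2 ^ δ * (2 + 3 ^ δ * A₁) * (K ^ δ * N * 1) := by ring
      _ ≤ _ := by gcongr; exact hℓ
  have t3 : (if δ = 0 then 0 else (K + 1) ^ (δ - 1) * (δ * erasedCost K δ ℓ)) ≤
      2 ^ δ * δ * (2 + 3 ^ δ * A₂) * (K ^ δ * N * ℓ) := by
    have : erasedCost K δ ℓ ≤ (2 + 3 ^ δ * A₂) * (N * N) := by
      unfold erasedCost
      calc _ ≤ 2 * (N * N) + 3 ^ δ * (A₂ * (N * N)) := by
            refine Nat.add_le_add (hKle.trans (by nlinarith)) ?_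
            calc 3 ^ ℓ * (2 * ℓ + 1) ^ δ * ℓ ^ 2 = 3 ^ ℓ * ((2 * ℓ + 1) ^ δ * ℓ ^ 2) := by ring
              _ ≤ 3 ^ ℓ * (3 ^ δ * ℓ ^ (δ + 2)) := Nat.mul_le_mul_left _ hpoly
              _ = 3 ^ δ * (3 ^ ℓ * ℓ ^ (δ + 2)) := by ring
              _ ≤ _ := Nat.mul_le_mul_left _ (h₂ ℓ)
        _ = _ := by ring
    split
    · exact Nat.zero_le _
    · rename_i h0
      obtain ⟨d, rfl⟩ := Nat.exists_eq_succ_of_ne_zero h0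
      simp only [Nat.succ_eq_add_one, Nat.add_sub_cancel] at this ⊢
      calc _ ≤ 2 ^ d * K ^ d * ((d + 1) * ((2 + 3 ^ (d + 1) * A₂) * (N * N))) := by
            gcongr; exact hpow d
        -- One factor `N` is traded for `K * ℓ ≥ N`, which restores the missing power of `K`.
        _ ≤ 2 ^ (d + 1) * K ^ d * ((d + 1) * ((2 + 3 ^ (d + 1) * A₂) * (N * (K * ℓ)))) := by
            gcongr <;> omega
        _ = _ := by ring
  have t4 : ((K + 1) ^ δ + ℓ) * N ≤ (2 ^ δ + 1) * (K ^ δ * N * ℓ) := by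
    have h1 : (K + 1) ^ δ ≤ 2 ^ δ * K ^ δ * ℓ := (hpow δ).trans (Nat.le_mul_of_pos_right _ hℓ)
    have h2 : ℓ ≤ K ^ δ * ℓ := Nat.le_mul_of_pos_left _ (by positivity)
    calc _ ≤ (2 ^ δ * K ^ δ * ℓ + K ^ δ * ℓ) * N := by gcongr
      _ = _ := by ring
  exact (Nat.add_le_add (Nat.add_le_add t1 (Nat.add_le_add t2 t3)) t4).trans (le_of_eq (by ring))

/-- Each factor `numBlocks ℓ` is at most `2 * 2 ^ ℓ / ℓ`, and the remaining `ℓ` lowers the exponent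
of the denominator by one. The exponent is an integer since it equals `-1` for `δ = 0`. -/
theorem numBlocks_pow_mul_le {ℓ : ℕ} (δ : ℕ) (hℓ : 0 < ℓ) :
    ((numBlocks ℓ ^ δ * 2 ^ ℓ * ℓ : ℕ) : ℝ) ≤
      2 ^ δ * ((2 ^ ℓ : ℝ) ^ (δ + 1) / (ℓ : ℝ) ^ ((δ : ℤ) - 1)) := by
  have hℓ' : (0 : ℝ) < ℓ := by exact_mod_cast hℓ
  have h : ((numBlocks ℓ : ℝ) * ℓ) ^ δ ≤ (2 * 2 ^ ℓ) ^ δ :=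
    pow_le_pow_left₀ (by positivity) (by exact_mod_cast numBlocks_mul_le hℓ) δ
  rw [zpow_sub_one₀ hℓ'.ne', zpow_natCast, ← div_eq_mul_inv, div_div_eq_mul_div, mul_div_assoc',
    le_div_iff₀ (by positivity)]
  push_cast
  rw [mul_pow, mul_pow] at h
  calc (numBlocks ℓ : ℝ) ^ δ * 2 ^ ℓ * ℓ * ℓ ^ δ = numBlocks ℓ ^ δ * ℓ ^ δ * (2 ^ ℓ * ℓ) := by ring
    _ ≤ 2 ^ δ * (2 ^ ℓ) ^ δ * (2 ^ ℓ * ℓ) := by gcongr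
    _ = _ := by ring

/-! ### The encoding and decoding programs, and the theorem -/

theorem Computes.haltsWithin {p : Prog} {v w : Val} {t : ℕ} (h : Computes p v w t) {T : ℝ}
    (hT : (t : ℝ) ≤ T) : HaltsWithin p v w T := by
  obtain ⟨s, t', h1, h2, h3⟩ := h
  exact ⟨s, t', h1, h2, le_trans (by exact_mod_cast h3) hT⟩

theorem exists_encoder (δ c : ℕ) : ∃ (p : Prog) (C : ℝ), 0 ≤ C ∧ ∀ (ℓ : ℕ) (𝒞 : GCCode c ℓ)
    (u : Fin (2 ^ ℓ) → Bool),
    HaltsWithin p (Val.cons 𝒞.description (Val.ofBits (List.ofFn u)))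
      (Val.ofBits (𝒞.encode δ u)) (C * ((2 ^ ℓ : ℝ) * ℓ)) := by
  obtain ⟨p, A, h⟩ := inTime_encodeAlg δ c
  refine ⟨p, 5 * A, by positivity, fun ℓ 𝒞 u => ?_⟩
  have key := h ((true :: 𝒞.lowCoeffs, 𝒞.rowBits), List.ofFn u)
    ⟨𝒞.lowCoeffs_ne_nil, 𝒞.isVec_rowBits⟩
  simp only [List.tail_cons, 𝒞.encodeAlg_eq, enc_pair _ (List.ofFn u), enc_bits,
    ← 𝒞.description_eq, 𝒞.length_rowBits, 𝒞.length_lowCoeffs, List.length_ofFn] at key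
  refine key.haltsWithin ?_
  have hℓ := 𝒞.ℓ_pos
  have h1 := numBlocks_mul_le hℓ
  have h2 : ℓ ≤ 2 ^ ℓ := Nat.lt_two_pow_self.le
  have h3 : A * (2 ^ ℓ + (numBlocks ℓ + 1) * ℓ ^ 2 + 1) ≤ 5 * A * (2 ^ ℓ * ℓ) := by
    have h4 : 1 ≤ 2 ^ ℓ := Nat.one_le_two_pow
    have : 2 ^ ℓ + (numBlocks ℓ + 1) * ℓ ^ 2 + 1 ≤ 5 * (2 ^ ℓ * ℓ) := by
      have h5 := Nat.mul_le_mul_right ℓ h1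
      have h6 := Nat.mul_le_mul_right ℓ h2
      have h7 := Nat.mul_le_mul_left (2 ^ ℓ) hℓ
      nlinarith
    calc _ ≤ A * (5 * (2 ^ ℓ * ℓ)) := Nat.mul_le_mul_left _ this
      _ = _ := by ring
  exact_mod_cast h3

theorem exists_decoder {δ c : ℕ} (hc : δ < c) : ∃ (p : Prog) (C : ℝ), 0 ≤ C ∧
    ∀ (ℓ : ℕ) (𝒞 : GCCode c ℓ) (u : Fin (2 ^ ℓ) → Bool) (D : Finset (Fin (gcLength δ c ℓ))),
    #D ≤ δ → HaltsWithin p (Val.cons 𝒞.description (Val.ofBits (𝒞.received δ u D)))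
      (Val.ofOptionBits (𝒞.decode δ (𝒞.received δ u D)))
      (C * ((2 ^ ℓ : ℝ) ^ (δ + 1) / (ℓ : ℝ) ^ ((δ : ℤ) - 1))) := by
  obtain ⟨p, A, h⟩ := inTime_decodeAlg hc
  obtain ⟨A', h'⟩ := exists_decodeCost_le δ
  refine ⟨p, A * (A' + 1) * 2 ^ δ, by positivity, fun ℓ 𝒞 u D hD => ?_⟩
  have key := h ((true :: 𝒞.lowCoeffs, 𝒞.rowBits), 𝒞.received δ u D) ⟨ℓ, 𝒞, u, D, hD, rfl⟩
  simp only [List.tail_cons, 𝒞.decodeAlg_received hc u D hD, enc_pair _ (𝒞.received δ u D),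
    enc_bits, enc_option, ← 𝒞.description_eq, 𝒞.length_rowBits, 𝒞.length_lowCoeffs] at key
  refine key.haltsWithin ?_
  have hℓ := 𝒞.ℓ_pos
  have hK := numBlocks_pos hℓ
  have h1 : 1 ≤ numBlocks ℓ ^ δ * 2 ^ ℓ * ℓ := by
    have : 0 < numBlocks ℓ ^ δ * 2 ^ ℓ * ℓ := by positivity
    exact this
  have h2 : A * (decodeCost δ (numBlocks ℓ) ℓ + 1) ≤
      A * (A' + 1) * (numBlocks ℓ ^ δ * 2 ^ ℓ * ℓ) := by
    rw [mul_assoc]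
    refine Nat.mul_le_mul_left _ ?_
    have := h' ℓ hℓ
    nlinarith
  have h3 : ((A * (decodeCost δ (numBlocks ℓ) ℓ + 1) : ℕ) : ℝ) ≤
      A * (A' + 1) * ((numBlocks ℓ ^ δ * 2 ^ ℓ * ℓ : ℕ) : ℝ) := by exact_mod_cast h2
  refine h3.trans ?_
  rw [mul_assoc _ ((2 : ℝ) ^ δ)]
  exact mul_le_mul_of_nonneg_left (numBlocks_pow_mul_le δ hℓ) (by positivity)

theorem theorem1 (δ c : ℕ) (hc : δ < c) :
    ∃ (enc dec : Prog) (C : ℝ), ∀ (ℓ : ℕ) (𝒞 : GCCode c ℓ),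
      -- redundancy
      (∀ u : Fin (2 ^ ℓ) → Bool,
        ((𝒞.encode δ u).length : ℤ) - 2 ^ ℓ = c * (δ + 1) * ℓ) ∧
      -- the decoder never outputs a wrong message
      (∀ (u : Fin (2 ^ ℓ) → Bool) (D : Finset (Fin (gcLength δ c ℓ))), #D ≤ δ →
        𝒞.decode δ (𝒞.received δ u D) = none ∨
          𝒞.decode δ (𝒞.received δ u D) = some (List.ofFn u)) ∧
      -- encoding complexity
      (∀ u : Fin (2 ^ ℓ) → Bool,
        HaltsWithin enc (Val.cons 𝒞.description (Val.ofBits (List.ofFn u)))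
          (Val.ofBits (𝒞.encode δ u)) (C * ((2 ^ ℓ : ℝ) * ℓ))) ∧
      -- decoding complexity
      (∀ (u : Fin (2 ^ ℓ) → Bool) (D : Finset (Fin (gcLength δ c ℓ))), #D ≤ δ →
        HaltsWithin dec (Val.cons 𝒞.description (Val.ofBits (𝒞.received δ u D)))
          (Val.ofOptionBits (𝒞.decode δ (𝒞.received δ u D)))
          (C * ((2 ^ ℓ : ℝ) ^ (δ + 1) / (ℓ : ℝ) ^ ((δ : ℤ) - 1)))) ∧
      -- probability of decoding failure
      (∀ μ : PMF (Finset (Fin (gcLength δ c ℓ))), (∀ D ∈ μ.support, #D ≤ δ) →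
        𝒞.failureProb δ μ ≤
          C * ((2 ^ ℓ : ℝ) ^ (2 * (δ : ℤ) - c) / (ℓ : ℝ) ^ δ)) := by
  obtain ⟨p, C₁, h₁, hp⟩ := exists_encoder δ c
  obtain ⟨q, C₂, h₂, hq⟩ := exists_decoder hc
  obtain ⟨C₃, h₃, hμ⟩ := exists_failureProb_le δ c hc
  have mono : ∀ {p v w T T'}, HaltsWithin p v w T → T ≤ T' → HaltsWithin p v w T' :=
    fun ⟨s, t, k1, k2, k3⟩ h => ⟨s, t, k1, k2, k3.trans h⟩
  refine ⟨p, q, C₁ + C₂ + C₃, fun ℓ 𝒞 => ⟨fun u => ?_, fun u D hD => 𝒞.decode_received u D hD,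
    fun u => mono (hp ℓ 𝒞 u) ?_, fun u D hD => mono (hq ℓ 𝒞 u D hD) ?_,
    fun μ h => (hμ ℓ 𝒞 μ h).trans ?_⟩⟩
  · rw [𝒞.length_encode, gcLength]; push_cast; ring
  all_goals exact mul_le_mul_of_nonneg_right (by linarith) (by positivity)
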